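/- A labeled graph $G=(V,E)$ is a complete graph on $n$ vertices in which every edge is labeled $(+)$ or $(-)$. The cost of a clustering (a partition of $V$) is the number of $(+)$-edges between different clusters plus the number of $(-)$-edges inside clusters; a clustering is an $\alpha$-approximation if its cost is at most $\alpha$ times the cost of every clustering of $V$. In the single-pass streaming model the vertex set $V=\{0,\dots,n-1\}$ is known and the edges of $G$ arrive once each, in an arbitrary order and together with their labels. A streaming algorithm is a pair of fixed programs (independent of $n$ and $G$) for a randomized word RAM with zero-initialized memory and words of $O(\log n)$ bits, which performs arithmetic on words and draws a uniformly random element of $\{0,\dots,m-1\}$, for $m$ a word, in unit time: one program is run upon each arriving edge, the other one (post-processing) after the end of the stream. Space is the number of memory words used. **Theorem.** There is a constant $\alpha$ such that for every $k\ge 0$ there is a randomized single-pass streaming algorithm with the following properties for every $n\ge 2$, every labeled graph $G$ on $n$ vertices and every order of its edge stream. The algorithm always uses $O(n\log n)$ words of space, $O(\log n)$ time for each element of the stream, and $O(n\log^2 n)$ post-processing time, and with probability at least $1-n^{-k}$ it outputs a clustering that is an $\alpha$-approximation to correlation clustering on $G$. The constants hidden in the $O(\cdot)$ depend only on $k$.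 -/

import Mathlib

namespace CorrClust

/-! ## Correlation clustering -/

/-- A labeled graph on `V`: the complete graph on `V` with every edge labeled `(+)` or `(-)`.
It is given by its `(+)`-subgraph; the remaining edges of the complete graph are the
`(-)`-edges. -/
structure LabeledGraph (V : Type*) where
  /-- the subgraph of `(+)`-edges -/
  pos : SimpleGraph V

/-- The subgraph of `(-)`-edges. -/
def LabeledGraph.neg {V : Type*} (G : LabeledGraph V) : SimpleGraph V := G.posᶜ

/-- A clustering, given by the name of the cluster of every vertex: `u` and `v` are in the same
cluster when `c u = c v`. -/
abbrev Clustering (V : Type*) := V → ℕ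

/-- Both endpoints of the edge `e` are in the same cluster. -/
def Clustering.Joins {V : Type*} (c : Clustering V) (e : Sym2 V) : Prop := (e.map c).IsDiag

open Classical in
/-- Cost of an edge: `1` for a `(+)`-edge between different clusters, `1` for a `(-)`-edge inside
a cluster, and `0` otherwise. -/
noncomputable def LabeledGraph.edgeCost {V : Type*} (G : LabeledGraph V) (c : Clustering V)
    (e : Sym2 V) : ℕ :=
  if e ∈ G.pos.edgeSet ∧ ¬ c.Joins e then 1
  else if e ∈ G.neg.edgeSet ∧ c.Joins e then 1
  else 0

open Classical in
/-- Total cost of a clustering: the sum over all edges of the complete graph. -/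
noncomputable def LabeledGraph.cost {V : Type*} [Fintype V] (G : LabeledGraph V)
    (c : Clustering V) : ℕ :=
  ∑ e ∈ (⊤ : SimpleGraph V).edgeFinset, G.edgeCost c e

/-- `c` costs at most `α` times as much as any clustering. -/
def LabeledGraph.IsApprox {V : Type*} [Fintype V] (G : LabeledGraph V) (α : ℕ)
    (c : Clustering V) : Prop :=
  ∀ c' : Clustering V, G.cost c ≤ α * G.cost c'

/-! ## Streams of labeled edges -/

/-- One stream element: the two endpoints of an edge and its label (`true` is `(+)`). -/
structure Item (n : ℕ) where
  /-- first endpoint -/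
  fst : Fin n
  /-- second endpoint -/
  snd : Fin n
  /-- label -/
  plus : Bool

/-- The underlying edge. -/
def Item.edge {n : ℕ} (x : Item n) : Sym2 (Fin n) := s(x.fst, x.snd)

/-- `σ` lists every edge of the complete graph exactly once (in any order, with the endpoints of
an edge in either order), with its label in `G`. -/
structure IsStream {n : ℕ} (G : LabeledGraph (Fin n)) (σ : List (Item n)) : Prop where
  nodup : (σ.map Item.edge).Nodup
  complete : ∀ e : Sym2 (Fin n), e ∈ σ.map Item.edge ↔ ¬ e.IsDiag
  label : ∀ x ∈ σ, x.plus = true ↔ G.pos.Adj x.fst x.snd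

/-! ## A randomized word RAM

Registers and memory cells hold words, that is, numbers less than a modulus `M = 2 ^ w`.
A program is a fixed piece of syntax, so it mentions `O(1)` registers and its expressions have
size `O(1)`. -/

/-- Binary operations on words. -/
inductive BinOp
  | add | sub | mul | div | mod | lt | eq

/-- Value of a binary operation before reduction to a word: `sub` is truncated at `0`, `div` and
`mod` are the integer quotient and remainder, `lt` and `eq` return `0` or `1`. -/
def BinOp.eval : BinOp → ℕ → ℕ → ℕ
  | .add, a, b => a + b
  | .sub, a, b => a - b
  | .mul, a, b => a * b
  | .div, a, b => a / b
  | .mod, a, b => a % b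
  | .lt, a, b => if a < b then 1 else 0
  | .eq, a, b => if a = b then 1 else 0

/-- Expressions over the registers. They do not access the memory. -/
inductive Expr
  | const (k : ℕ)
  | reg (i : ℕ)
  | bin (o : BinOp) (a b : Expr)

/-- Programs. A condition is true when it is not `0`. There are no procedure calls. -/
inductive Cmd
  /-- do nothing -/
  | skip
  /-- `reg i := e` -/
  | assign (i : ℕ) (e : Expr)
  /-- `reg i := mem[a]` -/
  | load (i : ℕ) (a : Expr)
  /-- `mem[a] := e` -/
  | store (a e : Expr)
  /-- `reg i :=` a fresh uniformly random element of `{0, …, e - 1}` (`0` if `e = 0`) -/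
  | rand (i : ℕ) (e : Expr)
  /-- first `p`, then `q` -/
  | seq (p q : Cmd)
  /-- if `e` then `p` else `q` -/
  | cond (e : Expr) (p q : Cmd)
  /-- while `e` do `p` -/
  | loop (e : Expr) (p : Cmd)

/-- State of the machine. The number `peak` only measures space, programs cannot read it: it is
the least number such that all memory addresses accessed so far, by reading or writing, are
smaller. -/
structure State where
  /-- registers -/
  regs : ℕ → ℕ
  /-- memory -/
  mem : ℕ → ℕ
  /-- number of memory cells used so far -/
  peak : ℕ

/-- Everything is `0` at the start. -/
def State.zero : State := ⟨fun _ => 0, fun _ => 0, 0⟩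

/-- Write a number into a register. -/
def State.setReg (s : State) (i x : ℕ) : State := { s with regs := Function.update s.regs i x }

/-- Write a number into a memory cell. -/
def State.setMem (s : State) (a x : ℕ) : State := { s with mem := Function.update s.mem a x }

/-- Record an access to address `a`. -/
def State.touch (s : State) (a : ℕ) : State := { s with peak := max s.peak (a + 1) }

/-- Value of an expression, with all intermediate results reduced modulo `M`. -/
def Expr.eval (M : ℕ) (s : State) : Expr → ℕ
  | .const k => k % M
  | .reg i => s.regs i
  | .bin o a b => o.eval (a.eval M s) (b.eval M s) % M

/-- The uniform distribution on `{0, …, m - 1}` (and the point mass at `0` if `m = 0`). -/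
noncomputable def uniformBelow : ℕ → PMF ℕ
  | 0 => PMF.pure 0
  | m + 1 => (PMF.uniformOfFintype (Fin (m + 1))).map Fin.val

/-- A configuration: the commands still to be executed and the state. The machine has halted
when no command is left. -/
structure Config where
  /-- commands still to be executed -/
  todo : List Cmd
  /-- current state -/
  st : State

/-- One step of the machine; it costs one unit of time. -/
noncomputable def step (M : ℕ) : Config → PMF Config
  | ⟨[], s⟩ => PMF.pure ⟨[], s⟩
  | ⟨.skip :: k, s⟩ => PMF.pure ⟨k, s⟩
  | ⟨.assign i e :: k, s⟩ => PMF.pure ⟨k, s.setReg i (e.eval M s)⟩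
  | ⟨.load i a :: k, s⟩ =>
      PMF.pure ⟨k, (s.setReg i (s.mem (a.eval M s))).touch (a.eval M s)⟩
  | ⟨.store a e :: k, s⟩ =>
      PMF.pure ⟨k, (s.setMem (a.eval M s) (e.eval M s)).touch (a.eval M s)⟩
  | ⟨.rand i e :: k, s⟩ => (uniformBelow (e.eval M s)).map fun x => ⟨k, s.setReg i x⟩
  | ⟨.seq p q :: k, s⟩ => PMF.pure ⟨p :: q :: k, s⟩
  | ⟨.cond e p q :: k, s⟩ => PMF.pure ⟨(if e.eval M s = 0 then q else p) :: k, s⟩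
  | ⟨.loop e p :: k, s⟩ =>
      PMF.pure ⟨if e.eval M s = 0 then k else p :: .loop e p :: k, s⟩

/-- Distribution of the configuration after `T` steps. -/
noncomputable def steps (M : ℕ) : ℕ → Config → PMF Config
  | 0, γ => PMF.pure γ
  | T + 1, γ => (step M γ).bind (steps M T)

open Classical in
/-- Run the program `p` from the state `s`. The outcome is `none` when `p` has not halted after
`T` steps or when more than `S` memory cells have been used; otherwise it is the final state. -/
noncomputable def exec (M S T : ℕ) (p : Cmd) (s : State) : PMF (Option State) :=
  (steps M T ⟨[p], s⟩).map fun γ =>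
    if γ.todo = [] ∧ γ.st.peak ≤ S then some γ.st else none

/-! ## Single-pass streaming algorithms -/

/-- A single-pass streaming algorithm: a program that is run once for each stream element and a
program that is run at the end of the stream. -/
structure StreamAlg where
  /-- executed for each stream element -/
  update : Cmd
  /-- executed after the last stream element -/
  post : Cmd

/-- Resources available to a streaming algorithm. -/
structure Budget where
  /-- number of bits of a word -/
  wordBits : ℕ
  /-- number of memory cells (words) -/
  space : ℕ
  /-- number of steps for each stream element -/
  updateTime : ℕ
  /-- number of steps after the last stream element -/
  postTime : ℕ

/-- Start on a graph with `n` vertices: register `0` holds `n`, all else is `0`. -/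
def startState (M n : ℕ) : State := State.zero.setReg 0 (n % M)

/-- A stream element is delivered by writing its endpoints into the registers `1` and `2` and its
label (`1` for `(+)` and `0` for `(-)`) into register `3`. -/
def State.receive (M : ℕ) {n : ℕ} (s : State) (x : Item n) : State :=
  ((s.setReg 1 (x.fst % M)).setReg 2 (x.snd % M)).setReg 3 ((if x.plus then 1 else 0) % M)

/-- Read the elements of the stream once, in the given order. The outcome is `none` as soon as the
budget is exceeded. -/
noncomputable def StreamAlg.pass (A : StreamAlg) (B : Budget) {n : ℕ} :
    List (Item n) → State → PMF (Option State)
  | [], s => PMF.pure (some s)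
  | x :: σ, s =>
      (exec (2 ^ B.wordBits) B.space B.updateTime A.update
        (s.receive (2 ^ B.wordBits) x)).bind fun o =>
          match o with
          | none => PMF.pure none
          | some s' => A.pass B σ s'

/-- The clustering that the algorithm outputs is found in the first `n` memory cells: cell `v`
holds the name of the cluster of vertex `v`. -/
def State.output (n : ℕ) (s : State) : Clustering (Fin n) := fun v => s.mem v

/-- Distribution of the output of the algorithm on the stream `σ`; the outcome `none` means that
the budget was exceeded. -/
noncomputable def StreamAlg.run (A : StreamAlg) (B : Budget) {n : ℕ} (σ : List (Item n)) :
    PMF (Option (Clustering (Fin n))) :=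
  (A.pass B σ (startState (2 ^ B.wordBits) n)).bind fun o =>
    match o with
    | none => PMF.pure none
    | some s =>
        (exec (2 ^ B.wordBits) B.space B.postTime A.post s).map
          (Option.map (State.output n))

/-- For `C` fixed and `n ≥ 2`: words of `O(log n)` bits, `O(n log n)` words of memory, time
`O(log n)` for each stream element, and time `O(n log² n)` after the stream. Here
`Nat.clog 2 n` is `⌈log₂ n⌉`. -/
def semiStreamingBudget (C n : ℕ) : Budget where
  wordBits := C * Nat.clog 2 n
  space := C * (n * Nat.clog 2 n)
  updateTime := C * Nat.clog 2 n
  postTime := C * (n * Nat.clog 2 n ^ 2)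

end CorrClust

open CorrClust

/-! Each vertex keeps a max-wise hash sketch of its closed `(+)`-neighborhood. There are K = Θ(k log
n) slots. In every slot each vertex has a random key, and slot `i` of `u` holds the vertex of
largest key in `G.nbhd u`. Up to a factor 2 caused by ties, two sketches differ in a slot with
probability at most the relative symmetric difference of the neighborhoods, and agree with
probability at most their Jaccard similarity. A Chernoff bound and a union bound make all these
statistics accurate at once (`IsFaithful`, `card_not_isFaithful_le`).

The slots also serve as random neighbors. A slot is good if the sketch of its vertex is close to
that of `u`, and `u` is dense if at most an eighth of its slots are bad. Dense vertices with close
sketches are clustered together; the others are singletons. No pairwise comparison is needed: each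
dense vertex leaves its name at the vertices of its good slots, and then adopts the largest name
found in its own good slots (`isSketchClustering_of_leaders`).

On a faithful sketch the cost is compared with an arbitrary clustering c' by charging
(`sum_card_le_of_charge`). If c' joins `u` and `v`, it errs at `u` or `v` on every vertex of the
symmetric difference of the neighborhoods; if it separates them, it errs on every common neighbor.
This pays for `(+)`-edges with dissimilar neighborhoods and for `(-)`-edges inside clusters. A
non-dense vertex has a constant fraction of dissimilar neighbors, so cutting all its edges is
affordable. The result is `IsSketchClustering.cost_le`.

For the machine, keys are drawn lazily when a vertex first occurs. The state law is shown to be that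
of a state computed from a uniform table `Draws n K` chosen in advance: redrawing an unread entry
preserves the uniform law (`bind_update_draws`). So `RunsOn` asserts equality of laws only after
averaging over the table. An update costs O(K) steps, and post-processing compares sketches for each
of the n K slots in O(K) steps, which gives n log² n. -/

namespace CorrClust

/-! ### Semantics of the word RAM: exact running times and output laws. -/

/-! ## Expressions -/

instance : Add Expr := ⟨.bin .add⟩
instance : Sub Expr := ⟨.bin .sub⟩
instance : Mul Expr := ⟨.bin .mul⟩
instance : Div Expr := ⟨.bin .div⟩
instance : Mod Expr := ⟨.bin .mod⟩

theorem Expr.add_def (a b : Expr) : a + b = .bin .add a b := rfl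
theorem Expr.sub_def (a b : Expr) : a - b = .bin .sub a b := rfl
theorem Expr.mul_def (a b : Expr) : a * b = .bin .mul a b := rfl
theorem Expr.div_def (a b : Expr) : a / b = .bin .div a b := rfl

/-- Value of an expression without reduction modulo the word size. -/
def Expr.val (r : ℕ → ℕ) : Expr → ℕ
  | .const k => k
  | .reg i => r i
  | .bin o a b => o.eval (a.val r) (b.val r)

/-- No reduction modulo the word size takes place in the evaluation of an expression. -/
def Expr.Fits (M : ℕ) (r : ℕ → ℕ) : Expr → Prop
  | .const k => k < M
  | .reg _ => True
  | .bin o a b => a.Fits M r ∧ b.Fits M r ∧ o.eval (a.val r) (b.val r) < M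

theorem Expr.eval_eq_val {M : ℕ} {s : State} {e : Expr} (h : e.Fits M s.regs) :
    e.eval M s = e.val s.regs := by
  induction e with
  | const k => exact Nat.mod_eq_of_lt h
  | reg i => rfl
  | bin o a b iha ihb =>
    rw [Expr.eval, iha h.1, ihb h.2.1, Expr.val, Nat.mod_eq_of_lt h.2.2]

/-! ## Running programs -/

/-- From the state `s` the program `p` halts after exactly `t` steps, and the state is then
distributed according to `ν`. -/
def Runs (M : ℕ) (p : Cmd) (s : State) (t : ℕ) (ν : PMF State) : Prop :=
  ∀ (k : List Cmd) (T : ℕ),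
    steps M (t + T) ⟨p :: k, s⟩ = ν.bind fun s' => steps M T ⟨k, s'⟩

theorem steps_succ (M T : ℕ) (γ : Config) :
    steps M (1 + T) γ = (step M γ).bind (steps M T) := by
  rw [add_comm]; rfl

theorem steps_nil (M T : ℕ) (s : State) : steps M T ⟨[], s⟩ = PMF.pure ⟨[], s⟩ := by
  induction T with
  | zero => rfl
  | succ T ih => rw [steps, step, PMF.pure_bind, ih]

theorem runs_of_step {M : ℕ} {p : Cmd} {s s' : State}
    (h : ∀ k, step M ⟨p :: k, s⟩ = PMF.pure ⟨k, s'⟩) : Runs M p s 1 (PMF.pure s') := by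
  intro k T
  rw [steps_succ, h, PMF.pure_bind, PMF.pure_bind]

theorem runs_seq {M : ℕ} {p q : Cmd} {s s₁ s₂ : State} {t₁ t₂ : ℕ}
    (h₁ : Runs M p s t₁ (PMF.pure s₁)) (h₂ : Runs M q s₁ t₂ (PMF.pure s₂)) :
    Runs M (.seq p q) s (1 + t₁ + t₂) (PMF.pure s₂) := by
  intro k T
  rw [show 1 + t₁ + t₂ + T = 1 + (t₁ + (t₂ + T)) by ring, steps_succ, step, PMF.pure_bind, h₁,
    PMF.pure_bind, h₂]

/-- Running times are tracked exactly, so both branches must take equally long; in `leaderBody` a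
store is paired with a `skip`, each of one step. -/
theorem runs_cond {M : ℕ} {e : Expr} {p q : Cmd} {s s' : State} {t : ℕ}
    (hp : e.eval M s ≠ 0 → Runs M p s t (PMF.pure s'))
    (hq : e.eval M s = 0 → Runs M q s t (PMF.pure s')) :
    Runs M (.cond e p q) s (1 + t) (PMF.pure s') := by
  intro k T
  rw [add_assoc, steps_succ, step, PMF.pure_bind]
  split_ifs with h
  · exact hq h k T
  · exact hp h k T

/-- `while reg i < reg b do p`. -/
def forLoop (i b : ℕ) (p : Cmd) : Cmd := .loop (.bin .lt (.reg i) (.reg b)) p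

theorem eval_lt_regs {M : ℕ} (hM : 1 < M) (s : State) (i b : ℕ) :
    (Expr.bin .lt (.reg i) (.reg b)).eval M s = if s.regs i < s.regs b then 1 else 0 := by
  by_cases h : s.regs i < s.regs b <;> simp [Expr.eval, BinOp.eval, h, Nat.mod_eq_of_lt hM]

theorem eval_lt_eq_zero {M : ℕ} (hM : 1 < M) {s : State} {i b j N : ℕ}
    (h : s.regs i = j ∧ s.regs b = N) (hj : j ≤ N) :
    (Expr.bin .lt (.reg i) (.reg b)).eval M s = 0 ↔ j = N := by
  rw [eval_lt_regs hM, h.1, h.2]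
  split_ifs <;> simp <;> omega

/-- A halted configuration is a fixed point of `step`, so the surplus of the time budget has no
effect. -/
theorem exec_of_runs {M S T t : ℕ} {p : Cmd} {s s' : State} (h : Runs M p s t (PMF.pure s'))
    (ht : t ≤ T) (hS : s'.peak ≤ S) : exec M S T p s = PMF.pure (some s') := by
  obtain ⟨d, rfl⟩ := Nat.exists_eq_add_of_le ht
  rw [exec, h, PMF.pure_bind, steps_nil, PMF.pure_map]
  simp [hS]

/-! ## Running programs on a random state -/

/-- If the state is `g ω` with `ω` drawn from `U`, then the program `p` halts after exactly `t`
steps, and the state is then distributed as `g' ω` with `ω` drawn from `U`. -/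
def RunsOn {Ω : Type*} (U : PMF Ω) (M : ℕ) (p : Cmd) (g : Ω → State) (t : ℕ) (g' : Ω → State) :
    Prop :=
  ∀ (k : List Cmd) (T : ℕ), (U.bind fun ω => steps M (t + T) ⟨p :: k, g ω⟩) =
    U.bind fun ω => steps M T ⟨k, g' ω⟩

section
variable {Ω : Type*} {U : PMF Ω} {M : ℕ}

/-- Deterministic code is verified for each sample separately. The averaged form is needed only
where random numbers are drawn, since there the sample is re-parametrized. -/
theorem RunsOn.of_runs {p : Cmd} {g g' : Ω → State} {t : ℕ}
    (h : ∀ ω, Runs M p (g ω) t (PMF.pure (g' ω))) : RunsOn U M p g t g' := by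
  intro k T
  congr 1
  funext ω
  rw [h ω, PMF.pure_bind]

/-- A one-point sample space makes the averaged notion pointwise, so loops need to be treated only
once. -/
theorem runs_iff_runsOn {p : Cmd} {s s' : State} {t : ℕ} :
    Runs M p s t (PMF.pure s') ↔
      RunsOn (PMF.pure ()) M p (fun _ => s) t (fun _ => s') := by
  simp only [Runs, RunsOn, PMF.pure_bind]

theorem RunsOn.seq {p q : Cmd} {g g₁ g₂ : Ω → State} {t₁ t₂ : ℕ}
    (h₁ : RunsOn U M p g t₁ g₁) (h₂ : RunsOn U M q g₁ t₂ g₂) :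
    RunsOn U M (.seq p q) g (1 + t₁ + t₂) g₂ := by
  intro k T
  rw [← h₂ k T, ← h₁ (q :: k) (t₂ + T)]
  congr 1
  funext ω
  rw [show 1 + t₁ + t₂ + T = 1 + (t₁ + (t₂ + T)) by ring, steps_succ, step, PMF.pure_bind]

theorem RunsOn.loop {e : Expr} {N t : ℕ} {p : Cmd} (g : ℕ → Ω → State)
    (he : ∀ j ≤ N, ∀ ω, e.eval M (g j ω) = 0 ↔ j = N)
    (h : ∀ j < N, RunsOn U M p (g j) t (g (j + 1))) :
    RunsOn U M (.loop e p) (g 0) (N * (t + 1) + 1) (g N) := by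
  -- The induction is on the number `d` of remaining iterations; each costs the body and one test,
  -- and the final `+ 1` is the failing test.
  suffices H : ∀ d j, j + d = N → RunsOn U M (.loop e p) (g j) (d * (t + 1) + 1) (g N) from
    H N 0 (by omega)
  intro d
  induction d with
  | zero =>
    intro j hj k T
    obtain rfl : j = N := by omega
    congr 1
    funext ω
    rw [show 0 * (t + 1) + 1 + T = 1 + T by ring, steps_succ, step, PMF.pure_bind,
      if_pos ((he _ le_rfl ω).2 rfl)]
  | succ d ih =>
    intro j hj k T
    rw [← ih (j + 1) (by omega) k T, ← h j (by omega)]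
    congr 1
    funext ω
    rw [show (d + 1) * (t + 1) + 1 + T = 1 + (t + (d * (t + 1) + 1 + T)) by ring, steps_succ,
      step, PMF.pure_bind, if_neg fun h0 => ?_]
    have := (he j (by omega) ω).1 h0
    omega

theorem RunsOn.forLoop (hM : 1 < M) {i b N t : ℕ} {p : Cmd} (g : ℕ → Ω → State)
    (hi : ∀ j ω, (g j ω).regs i = j ∧ (g j ω).regs b = N)
    (h : ∀ j < N, RunsOn U M p (g j) t (g (j + 1))) :
    RunsOn U M (CorrClust.forLoop i b p) (g 0) (N * (t + 1) + 1) (g N) :=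
  RunsOn.loop g (fun j hj ω => eval_lt_eq_zero hM (hi j ω) hj) h

theorem Runs.forLoop (hM : 1 < M) {i b N t : ℕ} {p : Cmd} (g : ℕ → State)
    (hi : ∀ j, (g j).regs i = j ∧ (g j).regs b = N)
    (h : ∀ j < N, Runs M p (g j) t (PMF.pure (g (j + 1)))) :
    Runs M (CorrClust.forLoop i b p) (g 0) (N * (t + 1) + 1) (PMF.pure (g N)) :=
  runs_iff_runsOn.2 (RunsOn.forLoop hM (fun j _ => g j) (fun j _ => hi j)
    fun j hj => runs_iff_runsOn.1 (h j hj))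

theorem RunsOn.exec {p : Cmd} {g g' : Ω → State} {t S T : ℕ} (h : RunsOn U M p g t g')
    (ht : t ≤ T) (hS : ∀ ω, (g' ω).peak ≤ S) :
    (U.bind fun ω => CorrClust.exec M S T p (g ω)) = U.map fun ω => some (g' ω) := by
  obtain ⟨d, rfl⟩ := Nat.exists_eq_add_of_le ht
  have := congrArg (PMF.map fun γ : Config =>
    if γ.todo = [] ∧ γ.st.peak ≤ S then some γ.st else none) (h [] d)
  rw [PMF.map_bind, PMF.map_bind] at this
  simp only [CorrClust.exec]
  convert this using 1
  · simp only [steps_nil, PMF.pure_map, hS, and_self, if_true]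
    rfl

end

/-! ### Deterministic core: faithful sketches yield a constant-factor approximation. -/

section
open Classical Finset

section
variable {V : Type*} {K : ℕ}

/-! ## Sketches -/

/-- Number of slots in which the sketches of `u` and `v` differ. -/
noncomputable def far (w : V → Fin K → V) (u v : V) : ℕ := #{i | w u i ≠ w v i}

/-- The slot `i` of `u` holds a vertex whose sketch is close to that of `u`. -/
def IsGoodSlot (w : V → Fin K → V) (u : V) (i : Fin K) : Prop := 8 * far w u (w u i) ≤ K

/-- Almost all slots of `u` are good. -/
def IsDense (w : V → Fin K → V) (u : V) : Prop := 8 * #{i | ¬ IsGoodSlot w u i} ≤ K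

theorem far_comm (w : V → Fin K → V) (u v : V) : far w u v = far w v u := by
  simp only [far, ne_comm]

theorem far_add_card_eq (w : V → Fin K → V) (u v : V) :
    far w u v + #{i | w u i = w v i} = K := by
  have := card_filter_add_card_filter_not (s := (univ : Finset (Fin K))) (fun i => w u i = w v i)
  simp only [card_univ, Fintype.card_fin] at this
  rw [far, add_comm]
  convert this using 2

theorem far_triangle (w : V → Fin K → V) (u v x : V) : far w u x ≤ far w u v + far w v x := by
  refine (card_le_card fun i hi => ?_).trans (card_union_le _ _)
  simp only [mem_filter, mem_univ, true_and, mem_union] at hi ⊢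
  by_contra! h
  exact hi (h.1.trans h.2)

end

section
variable {V : Type*}

/-! ## Mistakes of a clustering -/

/-- The graph of the edges on which the clustering `c` makes a mistake. -/
def LabeledGraph.mistakes (G : LabeledGraph V) (c : Clustering V) : SimpleGraph V where
  Adj u v := u ≠ v ∧ (G.pos.Adj u v ↔ c u ≠ c v)
  symm := ⟨fun u v h => ⟨h.1.symm, by rw [G.pos.adj_comm, h.2, ne_comm]⟩⟩
  loopless := ⟨fun _ h => h.1 rfl⟩

theorem LabeledGraph.edgeCost_eq (G : LabeledGraph V) (c : Clustering V) (e : Sym2 V) :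
    G.edgeCost c e = if e ∈ (G.mistakes c).edgeSet then 1 else 0 := by
  induction e with
  | _ u v =>
    have hj : Clustering.Joins c s(u, v) ↔ c u = c v := by
      simp [Clustering.Joins]
    simp only [LabeledGraph.edgeCost, SimpleGraph.mem_edgeSet, hj, LabeledGraph.neg,
      SimpleGraph.compl_adj, LabeledGraph.mistakes]
    by_cases huv : u = v
    · subst huv
      simp
    · by_cases ha : G.pos.Adj u v <;> by_cases hc : c u = c v <;> simp [huv, ha, hc]

variable [Fintype V]

/-- Number of edges at `u` on which `c` makes a mistake. -/
noncomputable def LabeledGraph.numMistakes (G : LabeledGraph V) (c : Clustering V) (u : V) : ℕ :=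
  #{v | (G.mistakes c).Adj u v}

/-- Handshake lemma for the graph of mistakes. Costs are compared through mistake degrees, which
makes charging a local matter. -/
theorem LabeledGraph.two_mul_cost (G : LabeledGraph V) (c : Clustering V) :
    2 * G.cost c = ∑ u, G.numMistakes c u := by
  have h : G.cost c = #(G.mistakes c).edgeFinset := by
    rw [LabeledGraph.cost, sum_congr rfl fun e _ => G.edgeCost_eq c e, ← card_filter]
    congr 1
    ext e
    simp only [mem_filter, SimpleGraph.mem_edgeFinset]
    exact ⟨fun h => h.2, fun h => ⟨SimpleGraph.edgeSet_mono le_top h, h⟩⟩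
  rw [h, ← SimpleGraph.sum_degrees_eq_twice_card_edges]
  refine sum_congr rfl fun u _ => ?_
  rw [← SimpleGraph.card_neighborFinset_eq_degree, SimpleGraph.neighborFinset_eq_filter]
  rfl

/-- Closed neighborhood in the `(+)`-graph. -/
noncomputable def LabeledGraph.nbhd (G : LabeledGraph V) (u : V) : Finset V :=
  {v | v = u ∨ G.pos.Adj u v}

variable (G : LabeledGraph V)

theorem LabeledGraph.mem_nbhd {u v : V} : v ∈ G.nbhd u ↔ v = u ∨ G.pos.Adj u v := by
  simp [LabeledGraph.nbhd]

theorem LabeledGraph.self_mem_nbhd (u : V) : u ∈ G.nbhd u := G.mem_nbhd.2 (Or.inl rfl)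

theorem LabeledGraph.mem_nbhd_comm {u v : V} : v ∈ G.nbhd u ↔ u ∈ G.nbhd v := by
  rw [G.mem_nbhd, G.mem_nbhd, eq_comm, G.pos.adj_comm]

theorem LabeledGraph.nbhd_card_pos (u : V) : 0 < #(G.nbhd u) :=
  card_pos.2 ⟨u, G.self_mem_nbhd u⟩

theorem LabeledGraph.card_le_numMistakes_add {G : LabeledGraph V} {c : Clustering V} {u v : V}
    {A : Finset V} (h : ∀ x ∈ A, (G.mistakes c).Adj u x ∨ (G.mistakes c).Adj v x) :
    #A ≤ G.numMistakes c u + G.numMistakes c v := by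
  refine (card_le_card fun x hx => ?_).trans (card_union_le _ _)
  simpa using h x hx

/-- For `x` in exactly one neighborhood the pairs `ux` and `vx` carry different labels, while `c`
treats them alike; so one of them is a mistake. -/
theorem LabeledGraph.card_symmDiff_le {c : Clustering V} {u v : V} (h : c u = c v) :
    #(symmDiff (G.nbhd u) (G.nbhd v)) ≤ G.numMistakes c u + G.numMistakes c v := by
  refine card_le_numMistakes_add fun x hx => ?_
  simp only [mem_symmDiff, G.mem_nbhd, not_or] at hx
  simp only [LabeledGraph.mistakes]
  by_cases hx' : c u = c x
  · rcases hx with ⟨-, h1, h2⟩ | ⟨-, h1, h2⟩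
    · exact Or.inr ⟨Ne.symm h1, by simp [h2, ← hx', h]⟩
    · exact Or.inl ⟨Ne.symm h1, by simp [h2, ← hx']⟩
  · have hux : u ≠ x := fun h => hx' (by rw [h])
    have hvx : v ≠ x := fun h' => hx' (by rw [h, h'])
    rcases hx with ⟨h0, h1, h2⟩ | ⟨h0, h1, h2⟩
    · exact Or.inl ⟨hux, by simp [h0.resolve_left hux.symm, hx']⟩
    · exact Or.inr ⟨hvx, by simp [h0.resolve_left hvx.symm, ← h, hx']⟩

/-- A common `(+)`-neighbor can share a cluster with at most one of `u` and `v`, and is cut off from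
the other. -/
theorem LabeledGraph.card_inter_le {c : Clustering V} {u v : V} (h : c u ≠ c v) :
    #(G.nbhd u ∩ G.nbhd v) ≤ G.numMistakes c u + G.numMistakes c v := by
  refine card_le_numMistakes_add fun x hx => ?_
  simp only [mem_inter, G.mem_nbhd] at hx
  simp only [LabeledGraph.mistakes]
  by_cases hx' : c u = c x
  · have hvx : v ≠ x := fun h' => h (by rw [hx', h'])
    exact Or.inr ⟨hvx, by simp [hx.2.resolve_left hvx.symm, ← hx', h.symm]⟩
  · have hux : u ≠ x := fun h => hx' (by rw [h])
    exact Or.inl ⟨hux, by simp [hx.1.resolve_left hux.symm, hx']⟩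

/-- Pairs in a symmetric relation `P` that are mistakes of `c` or can be charged to the mistakes
of `c` at their endpoints. -/
theorem LabeledGraph.sum_card_le_of_charge {c : Clustering V} {P : V → V → Prop} {d : V → ℕ}
    {x y : ℕ} (hP : ∀ u v, P u v → P v u) (hd : ∀ u, 0 < d u)
    (h : ∀ u v, P u v → (G.mistakes c).Adj u v ∨
      (d u ≤ x * (G.numMistakes c u + G.numMistakes c v) ∧
        d v ≤ x * (G.numMistakes c u + G.numMistakes c v)))
    (hrow : ∀ u, #{v | P u v} ≤ y * d u) :
    ∑ u, #{v | P u v} ≤ (1 + 2 * x * y) * ∑ u, G.numMistakes c u := by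
  set m := G.numMistakes c with hm
  have hpt : ∀ u v, (if P u v then (1 : ℚ) else 0) ≤
      (if (G.mistakes c).Adj u v then 1 else 0) +
        ((if P u v then x * (m u / d u : ℚ) else 0) +
          (if P v u then x * (m v / d v : ℚ) else 0)) := by
    intro u v
    by_cases hp : P u v
    · have hu : (0 : ℚ) < d u := by exact_mod_cast hd u
      have hv : (0 : ℚ) < d v := by exact_mod_cast hd v
      rw [if_pos hp, if_pos hp, if_pos (hP u v hp)]
      rcases h u v hp with h | ⟨h1, h2⟩
      · rw [if_pos h]
        have : (0 : ℚ) ≤ x * (m u / d u : ℚ) + x * (m v / d v : ℚ) := by positivity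
        linarith
      · have h1 : (d u : ℚ) ≤ x * (m u + m v) := by exact_mod_cast h1
        have h2 : (d v : ℚ) ≤ x * (m u + m v) := by exact_mod_cast h2
        have h0 : (0 : ℚ) ≤ if (G.mistakes c).Adj u v then 1 else 0 := by split_ifs <;> norm_num
        -- Divide by the larger of `d u` and `d v`: it is still at most `x * (m u + m v)`, and
        -- replacing it by the own degree in each fraction only increases the sum.
        have h3 : (1 : ℚ) ≤ x * (m u / d u : ℚ) + x * (m v / d v : ℚ) := by
          have hmu : (0 : ℚ) ≤ m u := by positivity
          have hmv : (0 : ℚ) ≤ m v := by positivity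
          have hx : (0 : ℚ) ≤ x := by positivity
          rcases le_total (d u : ℚ) (d v) with hle | hle
          · calc (1 : ℚ) ≤ x * (m u + m v) / d v := by rwa [le_div_iff₀ hv, one_mul]
              _ = x * (m u / d v) + x * (m v / d v) := by ring
              _ ≤ _ := by gcongr
          · calc (1 : ℚ) ≤ x * (m u + m v) / d u := by rwa [le_div_iff₀ hu, one_mul]
              _ = x * (m u / d u) + x * (m v / d u) := by ring
              _ ≤ _ := by gcongr
        linarith
    · have hp' : ¬ P v u := fun h => hp (hP _ _ h)
      rw [if_neg hp, if_neg hp, if_neg hp']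
      split_ifs <;> norm_num
  -- Row `u` has at most `y * d u` pairs, each charging `x * m u / d u`, so the degree cancels. The
  -- charge to the other endpoint is the same sum with the two summations exchanged, whence the
  -- factor 2.
  have hA : (∑ u, ∑ v, if P u v then x * (m u / d u : ℚ) else 0) ≤ x * y * ∑ u, (m u : ℚ) := by
    rw [mul_sum]
    refine sum_le_sum fun u _ => ?_
    rw [← sum_filter, sum_const, nsmul_eq_mul]
    have hu : (0 : ℚ) < d u := by exact_mod_cast hd u
    have hr : ((#{v | P u v} : ℕ) : ℚ) ≤ y * d u := by exact_mod_cast hrow u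
    calc ((#{v | P u v} : ℕ) : ℚ) * (x * (m u / d u)) ≤ (y * d u) * (x * (m u / d u)) := by gcongr
      _ = x * y * m u := by field_simp
  have hsum := sum_le_sum fun u (_ : u ∈ univ) => sum_le_sum fun v (_ : v ∈ univ) => hpt u v
  simp only [sum_add_distrib] at hsum
  rw [sum_comm (f := fun u v => if P v u then x * (m v / d v : ℚ) else 0)] at hsum
  have e1 : ∀ Q : V → V → Prop, (∑ u, ∑ v, if Q u v then (1 : ℚ) else 0) =
      ((∑ u, #{v | Q u v} : ℕ) : ℚ) := by
    intro Q
    push_cast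
    refine sum_congr rfl fun u _ => ?_
    rw [sum_boole]
  rw [e1, e1] at hsum
  have e2 : (∑ u, #{v | (G.mistakes c).Adj u v}) = ∑ u, m u := rfl
  rw [e2] at hsum
  have hfin : ((∑ u, #{v | P u v} : ℕ) : ℚ) ≤ ((1 + 2 * x * y) * ∑ u, m u : ℕ) := by
    push_cast at hsum ⊢
    linarith
  exact_mod_cast hfin

/-! ## Clusterings from sketches -/

/-- The closed neighborhoods of `u` and `v` are not close to each other. -/
def LabeledGraph.Disagree (u v : V) : Prop :=
  #(G.nbhd u ∪ G.nbhd v) < 32 * #(symmDiff (G.nbhd u) (G.nbhd v))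

/-- Neighbors of `u` whose neighborhoods are not close to that of `u`. -/
noncomputable def LabeledGraph.disagreeing (u : V) : Finset V :=
  {v ∈ G.nbhd u | G.Disagree u v}

variable {K : ℕ}

/-- The slots `w u i` represent the closed neighborhoods faithfully. -/
structure IsFaithful (w : V → Fin K → V) : Prop where
  mem : ∀ u i, w u i ∈ G.nbhd u
  close : ∀ u v, ¬ G.Disagree u v → 8 * far w u v ≤ K
  apart : ∀ u v, 4 * #(G.nbhd u ∩ G.nbhd v) < #(G.nbhd u ∪ G.nbhd v) →
    4 * #{i | w u i = w v i} < 3 * K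
  sample : ∀ u, 32 * #(G.disagreeing u) ≤ #(G.nbhd u) →
    8 * #{i | w u i ∈ G.disagreeing u} ≤ K

/-- The clusters of `c` are the classes of dense vertices with close sketches, and all other
vertices are singletons. -/
structure IsSketchClustering (w : V → Fin K → V) (c : Clustering V) : Prop where
  singleton : ∀ u v, ¬ IsDense w u → c u = c v → u = v
  close : ∀ u v, IsDense w u → IsDense w v → c u = c v → 4 * far w u v ≤ K
  join : ∀ u v, IsDense w u → IsDense w v → 8 * far w u v ≤ K → c u = c v

variable {G} {w : V → Fin K → V} {c c' : Clustering V}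

theorem Disagree.symm {u v : V} (h : G.Disagree u v) : G.Disagree v u := by
  unfold LabeledGraph.Disagree at *
  rwa [union_comm, symmDiff_comm]

/-- Agreement in three quarters of the slots rules out Jaccard similarity below 1/4, by `apart`. -/
theorem IsFaithful.union_le (hw : IsFaithful G w) {u v : V} (h : 4 * far w u v ≤ K) :
    #(G.nbhd u ∪ G.nbhd v) ≤ 4 * #(G.nbhd u ∩ G.nbhd v) := by
  by_contra! h'
  have := hw.apart u v h'
  have := far_add_card_eq w u v
  omega

/-- A disagreeing pair separated by `c'` is itself a mistake. If it is joined, the symmetric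
difference consists of mistakes at the endpoints and exceeds 1/32 of either neighborhood. Hence 65 =
1 + 2 · 32 · 1. -/
theorem sum_card_disagreeing_le (c' : Clustering V) :
    ∑ u, #(G.disagreeing u) ≤ 65 * ∑ u, G.numMistakes c' u := by
  have := G.sum_card_le_of_charge (c := c') (P := fun u v => v ∈ G.disagreeing u)
    (d := fun u => #(G.nbhd u)) (x := 32) (y := 1) ?_ G.nbhd_card_pos ?_ ?_
  · refine le_trans (sum_le_sum fun u _ => card_le_card fun v hv => ?_) this
    simpa using hv
  · intro u v h
    simp only [LabeledGraph.disagreeing, mem_filter] at h ⊢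
    exact ⟨G.mem_nbhd_comm.1 h.1, Disagree.symm h.2⟩
  · intro u v h
    simp only [LabeledGraph.disagreeing, mem_filter] at h
    have hd := h.2
    unfold LabeledGraph.Disagree at hd
    by_cases hc : c' u = c' v
    · right
      have := G.card_symmDiff_le hc
      have := card_le_card (subset_union_left (s₁ := G.nbhd u) (s₂ := G.nbhd v))
      have := card_le_card (subset_union_right (s₁ := G.nbhd u) (s₂ := G.nbhd v))
      constructor <;> omega
    · left
      have huv : u ≠ v := fun h => hc (by rw [h])
      exact ⟨huv, by simp [hc, (G.mem_nbhd.1 h.1).resolve_left huv.symm]⟩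
  · intro u
    rw [one_mul]
    refine card_le_card fun v hv => ?_
    simp only [LabeledGraph.disagreeing, mem_filter, mem_univ, true_and] at hv
    exact hv.1

/-- A slot holding a neighbor that does not disagree with `u` is good by `close`. With few
disagreeing neighbors, `sample` would therefore leave few bad slots. -/
theorem IsFaithful.card_nbhd_lt (hw : IsFaithful G w) {u : V} (hu : ¬ IsDense w u) :
    #(G.nbhd u) < 32 * #(G.disagreeing u) := by
  by_contra! h
  refine hu (le_trans ?_ (hw.sample u h))
  refine Nat.mul_le_mul_left _ (card_le_card fun i hi => ?_)
  simp only [mem_filter, mem_univ, true_and, LabeledGraph.disagreeing] at hi ⊢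
  refine ⟨hw.mem u i, ?_⟩
  by_contra h'
  exact hi (hw.close _ _ h')

/-- Double counting of pairs of `v ∈ Q` and a good slot of `u` where the sketches agree. Each `v`
has at least 7K/8 - K/4 = 5K/8 such slots. In a good slot with vertex `x`, all such `v` lie in the
neighborhood of `x`, of size at most four times that of `u`. So the ratio is at most 32/5 < 7. -/
theorem IsFaithful.card_class_le (hw : IsFaithful G w) (hK : 0 < K) {u : V} (hu : IsDense w u)
    (Q : Finset V) (hQ : ∀ v ∈ Q, 4 * far w u v ≤ K) : #Q ≤ 7 * #(G.nbhd u) := by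
  set A : Finset (Fin K) := {i | IsGoodSlot w u i} with hA
  have hcount := sum_card_bipartiteAbove_eq_sum_card_bipartiteBelow
    (s := Q) (t := A) (fun v i => w u i = w v i)
  have hAK : 7 * K ≤ 8 * #A := by
    have h1 := card_filter_add_card_filter_not (s := (univ : Finset (Fin K)))
      (fun i => IsGoodSlot w u i)
    rw [card_univ, Fintype.card_fin] at h1
    unfold IsDense at hu
    rw [← hA] at h1
    omega
  have hleft : ∀ v ∈ Q, 5 * K ≤ 8 * #(bipartiteAbove (fun v i => w u i = w v i) A v) := by
    intro v hv
    have h1 : #A ≤ #(bipartiteAbove (fun v i => w u i = w v i) A v) + far w u v := by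
      refine (card_le_card fun i hi => ?_).trans (card_union_le _ _)
      simp only [bipartiteAbove, mem_union, mem_filter, mem_univ, true_and]
      by_cases h : w u i = w v i
      · exact Or.inl ⟨hi, h⟩
      · exact Or.inr h
    have := hQ v hv
    omega
  have hright : ∀ i ∈ A, #(bipartiteBelow (fun v i => w u i = w v i) Q i) ≤ 4 * #(G.nbhd u) := by
    intro i hi
    have hi : 8 * far w u (w u i) ≤ K := (mem_filter.1 hi).2
    calc #(bipartiteBelow (fun v i => w u i = w v i) Q i) ≤ #(G.nbhd (w u i)) := by
          refine card_le_card fun v hv => ?_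
          rw [bipartiteBelow, mem_filter] at hv
          rw [hv.2, G.mem_nbhd_comm]
          exact hw.mem v i
      _ ≤ #(G.nbhd u ∪ G.nbhd (w u i)) := card_le_card subset_union_right
      _ ≤ 4 * #(G.nbhd u ∩ G.nbhd (w u i)) := hw.union_le (by omega)
      _ ≤ 4 * #(G.nbhd u) := Nat.mul_le_mul_left _ (card_le_card inter_subset_left)
  have h1 : #Q * (5 * K) ≤ 8 * (#A * (4 * #(G.nbhd u))) := by
    calc #Q * (5 * K) = ∑ v ∈ Q, 5 * K := by rw [sum_const, smul_eq_mul]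
      _ ≤ ∑ v ∈ Q, 8 * #(bipartiteAbove (fun v i => w u i = w v i) A v) := sum_le_sum hleft
      _ = 8 * ∑ i ∈ A, #(bipartiteBelow (fun v i => w u i = w v i) Q i) := by
          rw [← mul_sum, hcount]
      _ ≤ 8 * ∑ i ∈ A, 4 * #(G.nbhd u) := Nat.mul_le_mul_left _ (sum_le_sum hright)
      _ = _ := by rw [sum_const, smul_eq_mul]
  have h2 : #A ≤ K := (card_le_univ A).trans (by simp)
  have h3 : #Q * (5 * K) ≤ (32 * #(G.nbhd u)) * K := by
    refine h1.trans ?_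
    calc 8 * (#A * (4 * #(G.nbhd u))) ≤ 8 * (K * (4 * #(G.nbhd u))) := by gcongr
      _ = _ := by ring
  have h4 : #Q * 5 ≤ 32 * #(G.nbhd u) := by
    refine Nat.le_of_mul_le_mul_right ?_ hK
    rw [mul_assoc]; exact h3
  omega

/-- Pairs in the same cluster that are joined by a `(-)`-edge. -/
theorem IsSketchClustering.sum_card_le (hw : IsFaithful G w) (hc : IsSketchClustering w c)
    (hK : 0 < K) (c' : Clustering V) :
    ∑ u, #{v | (IsDense w u ∧ IsDense w v) ∧ c u = c v ∧ v ∉ G.nbhd u} ≤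
      57 * ∑ u, G.numMistakes c' u := by
  -- The 4 comes from `union_le`, which makes the intersection large enough to pay for a separated
  -- pair; the 7 is the class size bound of `card_class_le`.
  have h57 : (1 + 2 * 4 * 7) = 57 := by norm_num
  rw [← h57]
  refine le_trans (le_of_eq (sum_congr rfl fun u _ => by congr!)) <|
    G.sum_card_le_of_charge (c := c') (d := fun u => #(G.nbhd u)) (x := 4) (y := 7)
    (P := fun u v => (IsDense w u ∧ IsDense w v) ∧ c u = c v ∧ v ∉ G.nbhd u)
    ?_ G.nbhd_card_pos ?_ ?_
  · rintro u v ⟨h1, h2, h3⟩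
    exact ⟨h1.symm, h2.symm, fun h => h3 (G.mem_nbhd_comm.1 h)⟩
  · rintro u v ⟨⟨h1, h1'⟩, h2, h3⟩
    by_cases hcc : c' u = c' v
    · left
      rw [G.mem_nbhd, not_or] at h3
      exact ⟨Ne.symm h3.1, by simp [hcc, h3.2]⟩
    · right
      have := G.card_inter_le hcc
      have := hw.union_le (hc.close u v h1 h1' h2)
      have := card_le_card (subset_union_left (s₁ := G.nbhd u) (s₂ := G.nbhd v))
      have := card_le_card (subset_union_right (s₁ := G.nbhd u) (s₂ := G.nbhd v))
      constructor <;> omega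
  · intro u
    by_cases hu : IsDense w u
    · refine hw.card_class_le hK hu _ fun v hv => ?_
      simp only [mem_filter, mem_univ, true_and] at hv
      exact hc.close u v hv.1.1 hv.1.2 hv.2.1
    · simp [hu]

/-- A cut `(+)`-edge either disagrees (else `join` applies) or has a non-dense end; a joined
`(-)`-edge has two dense ends. Non-dense ends cost 32 times the disagreements, counted from both
sides, so the factor is 65 + 2 · 32 · 65 + 57 = 4282. -/
theorem IsSketchClustering.cost_le (hw : IsFaithful G w) (hc : IsSketchClustering w c)
    (hK : 0 < K) (c' : Clustering V) : G.cost c ≤ 4282 * G.cost c' := by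
  have hrow : ∀ u, G.numMistakes c u ≤ #(G.disagreeing u) +
      ((if IsDense w u then 0 else #(G.nbhd u)) + #{v | ¬ IsDense w v ∧ v ∈ G.nbhd u}) +
        #{v | (IsDense w u ∧ IsDense w v) ∧ c u = c v ∧ v ∉ G.nbhd u} := by
    intro u
    have e : (if IsDense w u then 0 else #(G.nbhd u)) = #{v | ¬ IsDense w u ∧ v ∈ G.nbhd u} := by
      by_cases h : IsDense w u <;> simp [h]
    rw [e]
    refine le_trans ?_ (Nat.add_le_add_right (Nat.add_le_add_left (card_union_le _ _) _) _)
    refine le_trans ?_ (Nat.add_le_add_right (card_union_le _ _) _)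
    refine le_trans (card_le_card fun v hv => ?_) (card_union_le _ _)
    obtain ⟨huv, hv⟩ : u ≠ v ∧ (G.pos.Adj u v ↔ c u ≠ c v) := (mem_filter.1 hv).2
    simp only [mem_filter, mem_univ, true_and, mem_union]
    by_cases hadj : G.pos.Adj u v
    · have hcuv := hv.1 hadj
      have hmem : v ∈ G.nbhd u := G.mem_nbhd.2 (Or.inr hadj)
      by_cases hu : IsDense w u
      · by_cases hv' : IsDense w v
        · refine Or.inl (Or.inl ?_)
          rw [LabeledGraph.disagreeing, mem_filter]
          refine ⟨hmem, ?_⟩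
          by_contra h
          exact hcuv (hc.join u v hu hv' (hw.close u v h))
        · exact Or.inl (Or.inr (Or.inr ⟨hv', hmem⟩))
      · exact Or.inl (Or.inr (Or.inl ⟨hu, hmem⟩))
    · have hcuv : c u = c v := by
        by_contra h
        exact hadj (hv.2 h)
      refine Or.inr ⟨⟨?_, ?_⟩, hcuv, fun h => ?_⟩
      · by_contra h
        exact huv (hc.singleton u v h hcuv)
      · by_contra h
        exact huv (hc.singleton v u h hcuv.symm).symm
      · exact (G.mem_nbhd.1 h).elim (fun h => huv h.symm) hadj
  have hswap : ∑ u, #{v | ¬ IsDense w v ∧ v ∈ G.nbhd u} =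
      ∑ u, if IsDense w u then 0 else #(G.nbhd u) := by
    have := sum_card_bipartiteAbove_eq_sum_card_bipartiteBelow
      (s := (univ : Finset V)) (t := (univ : Finset V)) (fun u v => ¬ IsDense w v ∧ v ∈ G.nbhd u)
    simp only [bipartiteAbove, bipartiteBelow] at this
    rw [this]
    refine sum_congr rfl fun u _ => ?_
    by_cases h : IsDense w u
    · simp [h]
    · simp only [h, not_false_eq_true, true_and, if_false]
      congr 1
      ext v
      simp only [mem_filter, mem_univ, true_and]
      exact G.mem_nbhd_comm
  have hsparse : (∑ u, if IsDense w u then 0 else #(G.nbhd u)) ≤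
      32 * ∑ u, #(G.disagreeing u) := by
    rw [mul_sum]
    refine sum_le_sum fun u _ => ?_
    split_ifs with h
    · exact Nat.zero_le _
    · exact (hw.card_nbhd_lt h).le
  have h1 := sum_le_sum fun u (_ : u ∈ univ) => hrow u
  simp only [sum_add_distrib] at h1
  rw [hswap] at h1
  have h2 := hc.sum_card_le hw hK c'
  have h3 := sum_card_disagreeing_le (G := G) c'
  have h4 := G.two_mul_cost c
  have h5 := G.two_mul_cost c'
  omega

end

/-- A clustering computed from leaders `L`: every dense vertex `v` proposes itself to the vertices
in its good slots, and takes the largest leader that it finds in its good slots. -/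
theorem isSketchClustering_of_leaders {n K : ℕ} (hK : 0 < K) {w : Fin n → Fin K → Fin n}
    {c : Clustering (Fin n)} (L : Fin n → ℕ)
    (hle : ∀ v i, IsDense w v → IsGoodSlot w v i → (v : ℕ) + 1 ≤ L (w v i))
    (hex : ∀ x, L x ≠ 0 → ∃ v i, IsDense w v ∧ IsGoodSlot w v i ∧ w v i = x ∧ L x = v + 1)
    (hdense : ∀ u, IsDense w u →
      c u = ({i | IsGoodSlot w u i} : Finset (Fin K)).sup fun i => L (w u i))
    (hsparse : ∀ u, ¬ IsDense w u → c u = n + 1 + u) : IsSketchClustering w c := by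
  have hgood : ∀ u, IsDense w u → 7 * K ≤ 8 * #{i | IsGoodSlot w u i} := by
    intro u hu
    have h1 := card_filter_add_card_filter_not (s := (univ : Finset (Fin K)))
      (fun i => IsGoodSlot w u i)
    rw [card_univ, Fintype.card_fin] at h1
    unfold IsDense at hu
    omega
  have hgood' : ∀ u i, IsGoodSlot w u i → 8 * far w u (w u i) ≤ K := fun _ _ h => h
  -- two dense vertices with close sketches share a vertex in good slots
  have hshare : ∀ u v, IsDense w u → IsDense w v → 2 * far w u v ≤ K →
      ∃ i, IsGoodSlot w u i ∧ IsGoodSlot w v i ∧ w u i = w v i := by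
    intro u v hu hv huv
    by_contra! h
    have h1 : (univ : Finset (Fin K)) ⊆ ({i | w u i ≠ w v i} : Finset (Fin K)) ∪
        (({i | ¬ IsGoodSlot w u i} : Finset (Fin K)) ∪
          ({i | ¬ IsGoodSlot w v i} : Finset (Fin K))) := by
      intro i _
      simp only [mem_union, mem_filter, mem_univ, true_and]
      by_cases h1 : IsGoodSlot w u i
      · by_cases h2 : IsGoodSlot w v i
        · exact Or.inl (h i h1 h2)
        · exact Or.inr (Or.inr h2)
      · exact Or.inr (Or.inl h1)
    have h2 := (card_le_card h1).trans ((card_union_le _ _).trans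
      (Nat.add_le_add_left (card_union_le _ _) _))
    rw [card_univ, Fintype.card_fin] at h2
    have h3 : #({i | w u i ≠ w v i} : Finset (Fin K)) = far w u v := by unfold far; congr!
    rw [h3] at h2
    unfold IsDense at hu hv
    omega
  -- the leader of a dense vertex
  have hlead : ∀ u, IsDense w u → ∃ v, IsDense w v ∧ 4 * far w u v ≤ K ∧ c u = v + 1 := by
    intro u hu
    have hne : ({i | IsGoodSlot w u i} : Finset (Fin K)).Nonempty := by
      rw [← card_pos]
      have := hgood u hu
      omega
    obtain ⟨i, hi, he⟩ := exists_mem_eq_sup _ hne fun i => L (w u i)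
    simp only [mem_filter, mem_univ, true_and] at hi
    obtain ⟨v, j, hv, hj, hx, hL⟩ := hex (w u i) (by have := hle u i hu hi; omega)
    -- The vertex in slot `i` of `u` is within K/8 of both `u` and its leader `v`.
    refine ⟨v, hv, ?_, by rw [hdense u hu, he, hL]⟩
    have h1 := hgood' _ _ hi
    have h2 := hgood' _ _ hj
    rw [hx, far_comm] at h2
    have := far_triangle w u (w u i) v
    omega
  -- Every dense vertex within K/2, not only within K/4, competes to lead `u`. The slack lets the
  -- leader of `u` also compete at a dense vertex within K/4 of `u`.
  have hmax : ∀ u v, IsDense w u → IsDense w v → 2 * far w u v ≤ K → (v : ℕ) + 1 ≤ c u := by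
    intro u v hu hv h
    obtain ⟨i, h1, h2, h3⟩ := hshare u v hu hv h
    rw [hdense u hu]
    refine (hle v i hv h2).trans ?_
    rw [← h3]
    exact le_sup (f := fun i => L (w u i)) (by simpa using h1)
  have hjoin : ∀ u v, IsDense w u → IsDense w v → 4 * far w u v ≤ K → c u ≤ c v := by
    intro u v hu hv h
    obtain ⟨x, hx, hux, hc⟩ := hlead u hu
    rw [hc]
    refine hmax v x hv hx ?_
    have := far_triangle w v u x
    rw [far_comm w v u] at this
    omega
  have hlt : ∀ u, IsDense w u → c u ≤ n := by
    intro u hu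
    obtain ⟨x, -, -, hc⟩ := hlead u hu
    omega
  refine ⟨fun u v hu h => ?_, fun u v hu hv h => ?_, fun u v hu hv h => ?_⟩
  · by_cases hv : IsDense w v
    · have := hlt v hv
      have := hsparse u hu
      omega
    · rw [hsparse u hu, hsparse v hv] at h
      exact Fin.ext (by omega)
  -- A common leader gives only distance K/2, but this already forces a common vertex in good slots,
  -- which improves the distance to K/8 + K/8 = K/4.
  · obtain ⟨x, hx, hux, hcu⟩ := hlead u hu
    obtain ⟨y, hy, hvy, hcv⟩ := hlead v hv
    obtain rfl : x = y := Fin.ext (by omega)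
    have h1 := far_triangle w u x v
    rw [far_comm w x v] at h1
    obtain ⟨i, h2, h3, h4⟩ := hshare u v hu hv (by omega)
    have h5 := hgood' _ _ h2
    have h6 := hgood' _ _ h3
    rw [← h4, far_comm] at h6
    have := far_triangle w u (w u i) v
    omega
  · refine le_antisymm (hjoin u v hu hv (by omega)) (hjoin v u hv hu ?_)
    rw [far_comm]; omega

end

/-! ### Random keys give faithful sketches with high probability. -/

section
open Classical Finset

/-! ## Concentration -/

/-- Unnormalized moment generating function: by independence of the slots it factors into `K` equal
terms. -/
theorem sum_exp_count {F : Type*} [Fintype F] (E : Finset F) (K : ℕ) (l : ℝ) :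
    ∑ ω : Fin K → F, Real.exp (l * #{i | ω i ∈ E}) =
      (Fintype.card F + #E * (Real.exp l - 1)) ^ K := by
  have h1 : ∑ f : F, Real.exp (l * if f ∈ E then 1 else 0) =
      Fintype.card F + #E * (Real.exp l - 1) := by
    have : ∀ f : F, Real.exp (l * if f ∈ E then 1 else 0) =
        1 + (if f ∈ E then (Real.exp l - 1) else 0) := by
      intro f
      split_ifs <;> simp
    rw [sum_congr rfl fun f _ => this f, sum_add_distrib, ← sum_filter]
    simp [mul_sub]
  rw [← h1, Fintype.sum_pow]
  refine sum_congr rfl fun ω _ => ?_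
  rw [← Real.exp_sum, ← mul_sum, sum_boole]

/-- Among `K` independent uniform samples from `F`, it is unlikely that many more than expected
fall into `E`. -/
theorem card_count_ge_le {F : Type*} [Fintype F] [Nonempty F] (E : Finset F) (K : ℕ) {q : ℝ}
    (hq : q ≤ 1) (hE : (#E : ℝ) ≤ q * Fintype.card F) :
    (#{ω : Fin K → F | (q + 1 / 16) * K ≤ (#{i | ω i ∈ E} : ℝ)} : ℝ) ≤
      Real.exp (-(K / 1024)) * Fintype.card (Fin K → F) := by
  have hF : (0 : ℝ) < Fintype.card F := by exact_mod_cast Fintype.card_pos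
  have hq0 : 0 ≤ q := by
    by_contra! h
    have : (0 : ℝ) ≤ #E := by positivity
    nlinarith
  -- With this choice the exponent is K (q l² - l / 16), which is at most K (1/1024 - 1/512) =
  -- -K/1024 for `q ≤ 1`.
  set l : ℝ := 1 / 32 with hl
  have hexp : Real.exp l - 1 ≤ l + l ^ 2 := by
    have := Real.abs_exp_sub_one_sub_id_le (x := l) (by rw [hl]; norm_num)
    have := (abs_le.1 this).2
    linarith
  have hexp0 : 0 ≤ Real.exp l - 1 := by
    have := Real.add_one_le_exp l
    have : 0 ≤ l := by rw [hl]; norm_num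
    linarith
  have hbase : Fintype.card F + #E * (Real.exp l - 1) ≤
      Fintype.card F * Real.exp (q * (l + l ^ 2)) := by
    have h1 := Real.add_one_le_exp (q * (l + l ^ 2))
    calc Fintype.card F + #E * (Real.exp l - 1)
        ≤ Fintype.card F + (q * Fintype.card F) * (l + l ^ 2) := by
          gcongr
      _ = Fintype.card F * (q * (l + l ^ 2) + 1) := by ring
      _ ≤ _ := by gcongr
  have hmarkov : (#{ω : Fin K → F | (q + 1 / 16) * K ≤ (#{i | ω i ∈ E} : ℝ)} : ℝ) *
      Real.exp (l * ((q + 1 / 16) * K)) ≤ ∑ ω : Fin K → F, Real.exp (l * #{i | ω i ∈ E}) := by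
    rw [← nsmul_eq_mul, ← sum_const]
    refine (sum_le_sum fun ω hω => ?_).trans
      (sum_le_sum_of_subset_of_nonneg (filter_subset _ _) fun _ _ _ => (Real.exp_pos _).le)
    rw [mem_filter] at hω
    rw [Real.exp_le_exp]
    have : 0 ≤ l := by rw [hl]; norm_num
    exact mul_le_mul_of_nonneg_left hω.2 this
  rw [sum_exp_count] at hmarkov
  have hpow : (Fintype.card F + #E * (Real.exp l - 1)) ^ K ≤
      (Fintype.card F : ℝ) ^ K * Real.exp (K * (q * (l + l ^ 2))) := by
    rw [Real.exp_nat_mul, ← mul_pow]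
    refine pow_le_pow_left₀ ?_ hbase K
    positivity
  have h2 := hmarkov.trans hpow
  rw [← le_div_iff₀ (Real.exp_pos _), mul_div_assoc, ← Real.exp_sub] at h2
  refine h2.trans ?_
  rw [Fintype.card_fun, Fintype.card_fin, mul_comm]
  push_cast
  gcongr
  have : (0 : ℝ) ≤ K := by positivity
  rw [hl]
  nlinarith

/-! ## Random keys -/

section
variable {n : ℕ}

/-- The key of the vertex `x` if its random number is `f x`. Keys are positive, and ordered by
the random numbers with ties broken by the vertices. -/
def hashKey (f : Fin n → Fin (n * n)) (x : Fin n) : ℕ := f x * n + n + x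

theorem hashKey_mod (f : Fin n → Fin (n * n)) (x : Fin n) : hashKey f x % n = x := by
  rw [hashKey, show (f x : ℕ) * n + n + x = x + n * (f x + 1) by ring, Nat.add_mul_mod_self_left,
    Nat.mod_eq_of_lt x.2]

/-- Positivity frees 0 to mean that no key has been drawn, in accordance with zero-initialized
memory and empty suprema. -/
theorem hashKey_pos (f : Fin n → Fin (n * n)) (x : Fin n) : 0 < hashKey f x := by
  have := x.2
  rw [hashKey]; omega

theorem hashKey_lt {f : Fin n → Fin (n * n)} {x y : Fin n} (h : f x < f y) :
    hashKey f x < hashKey f y := by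
  have h1 : ((f x : ℕ) + 1) * n ≤ f y * n := Nat.mul_le_mul_right _ h
  have := x.2
  rw [hashKey, hashKey]
  rw [add_mul] at h1
  omega

theorem hashKey_injective (f : Fin n → Fin (n * n)) : Function.Injective (hashKey f) := by
  intro x y h
  refine Fin.ext ?_
  rw [← hashKey_mod f x, ← hashKey_mod f y, h]

/-- Symmetry: exchanging the numbers of `x` and `y` maps one event onto the other. -/
theorem card_weakMax_eq {R : ℕ} {U : Finset (Fin n)} {x y : Fin n} (hx : x ∈ U) (hy : y ∈ U) :
    #{f : Fin n → Fin R | ∀ z ∈ U, f z ≤ f x} = #{f : Fin n → Fin R | ∀ z ∈ U, f z ≤ f y} := by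
  have hU : ∀ z ∈ U, Equiv.swap x y z ∈ U := by
    intro z hz
    rw [Equiv.swap_apply_def]
    split_ifs <;> assumption
  refine card_bij' (fun f _ => f ∘ Equiv.swap x y) (fun f _ => f ∘ Equiv.swap x y) ?_ ?_ ?_ ?_
  · intro f hf
    simp only [mem_filter, mem_univ, true_and, Function.comp_apply, Equiv.swap_apply_right] at hf ⊢
    exact fun z hz => hf _ (hU z hz)
  · intro f hf
    simp only [mem_filter, mem_univ, true_and, Function.comp_apply, Equiv.swap_apply_left] at hf ⊢
    exact fun z hz => hf _ (hU z hz)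
  · intro f _
    funext z
    simp
  · intro f _
    funext z
    simp

/-- Collision probability at most 1/R: overwriting the number of `x` arbitrarily is injective on
collisions, as the old value can be read off at `y`. -/
theorem card_eq_mul_le {R : ℕ} {x y : Fin n} (h : x ≠ y) :
    #{f : Fin n → Fin R | f x = f y} * R ≤ Fintype.card (Fin n → Fin R) := by
  have := card_le_card_of_injOn (s := ({f : Fin n → Fin R | f x = f y} : Finset _) ×ˢ
    (univ : Finset (Fin R))) (t := (univ : Finset (Fin n → Fin R)))
    (fun p => Function.update p.1 x p.2) (fun _ _ => mem_univ _) ?_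
  · rwa [card_product, card_univ, card_univ, Fintype.card_fin] at this
  · rintro ⟨f, a⟩ hf ⟨g, b⟩ hg hfg
    simp only [coe_product, Set.mem_prod, mem_coe, mem_filter, mem_univ, true_and, and_true]
      at hf hg hfg
    have hz : ∀ z, z ≠ x → f z = g z := fun z hz => by
      simpa [hz] using congrFun hfg z
    have hab : a = b := by simpa using congrFun hfg x
    have : f = g := by
      funext z
      by_cases hzx : z = x
      · rw [hzx, hf, hg]
        exact hz y h.symm
      · exact hz z hzx
    rw [this, hab]

/-- By symmetry the probability times `#U` is the expected number of maximizers. It is at most 1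
plus the expected number of colliding ordered pairs, which is at most 1 because the range has `n *
n` elements. -/
theorem card_mul_card_weakMax_le {U : Finset (Fin n)} {x : Fin n} (hx : x ∈ U) :
    #U * #{f : Fin n → Fin (n * n) | ∀ z ∈ U, f z ≤ f x} ≤
      2 * Fintype.card (Fin n → Fin (n * n)) := by
  have h1 : #U * #{f : Fin n → Fin (n * n) | ∀ z ∈ U, f z ≤ f x} =
      ∑ f : Fin n → Fin (n * n), #{y ∈ U | ∀ z ∈ U, f z ≤ f y} := by
    have := sum_card_bipartiteAbove_eq_sum_card_bipartiteBelow (s := U)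
      (t := (univ : Finset (Fin n → Fin (n * n)))) (fun y f => ∀ z ∈ U, f z ≤ f y)
    simp only [bipartiteAbove, bipartiteBelow] at this
    rw [← this, sum_congr rfl fun y hy => card_weakMax_eq hy hx, sum_const, smul_eq_mul]
  have h2 : ∀ f : Fin n → Fin (n * n), #{y ∈ U | ∀ z ∈ U, f z ≤ f y} ≤
      1 + #{p : Fin n × Fin n | p.1 ≠ p.2 ∧ f p.1 = f p.2} := by
    intro f
    rcases ({y ∈ U | ∀ z ∈ U, f z ≤ f y} : Finset (Fin n)).eq_empty_or_nonempty with h | ⟨y, hy⟩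
    · rw [h]; simp
    · rw [← insert_erase hy]
      refine (card_insert_le _ _).trans ?_
      rw [add_comm]
      refine Nat.add_le_add_left ?_ 1
      refine card_le_card_of_injOn (fun z => (y, z)) (fun z hz => ?_) fun a _ b _ h => by simpa using h
      simp only [coe_erase, coe_filter, Set.mem_sdiff, Set.mem_ofPred_eq, Set.mem_singleton_iff,
        mem_filter] at hz hy
      simp only [coe_filter, mem_univ, true_and, Set.mem_ofPred_eq]
      exact ⟨Ne.symm hz.2, le_antisymm (hz.1.2 y hy.1) (hy.2 z hz.1.1)⟩
  have h3 : ∑ f : Fin n → Fin (n * n), #{p : Fin n × Fin n | p.1 ≠ p.2 ∧ f p.1 = f p.2} ≤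
      Fintype.card (Fin n → Fin (n * n)) := by
    have hn : 0 < n := x.pos
    have := sum_card_bipartiteAbove_eq_sum_card_bipartiteBelow
      (s := (univ : Finset (Fin n → Fin (n * n)))) (t := (univ : Finset (Fin n × Fin n)))
      (fun f p => p.1 ≠ p.2 ∧ f p.1 = f p.2)
    simp only [bipartiteAbove, bipartiteBelow] at this
    rw [this]
    refine Nat.le_of_mul_le_mul_right ?_ (Nat.mul_pos hn hn)
    rw [sum_mul]
    refine (sum_le_card_nsmul _ _ (Fintype.card (Fin n → Fin (n * n))) ?_).trans ?_
    · rintro ⟨a, b⟩ -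
      by_cases hab : a = b
      · simp [hab]
      · simp only [ne_eq, hab, not_false_eq_true, true_and]
        exact card_eq_mul_le hab
    · simp [mul_comm]
  rw [h1]
  refine (sum_le_sum fun f _ => h2 f).trans ?_
  rw [sum_add_distrib, sum_const, smul_eq_mul, mul_one, card_univ]
  omega

/-- The largest key in `U` belongs to `A` with probability at most `2 |A| / |U|`. -/
theorem card_mul_card_argmax_le {U A : Finset (Fin n)} (hA : A ⊆ U) :
    #U * #{f : Fin n → Fin (n * n) | ∃ x ∈ A, ∀ y ∈ U, hashKey f y ≤ hashKey f x} ≤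
      2 * #A * Fintype.card (Fin n → Fin (n * n)) := by
  have h1 : #{f : Fin n → Fin (n * n) | ∃ x ∈ A, ∀ y ∈ U, hashKey f y ≤ hashKey f x} ≤
      ∑ x ∈ A, #{f : Fin n → Fin (n * n) | ∀ z ∈ U, f z ≤ f x} := by
    refine (card_le_card fun f hf => ?_).trans card_biUnion_le
    simp only [mem_filter, mem_univ, true_and, mem_biUnion] at hf ⊢
    obtain ⟨x, hx, h⟩ := hf
    refine ⟨x, hx, fun z hz => ?_⟩
    by_contra! hlt
    exact (hashKey_lt hlt).not_ge (h z hz)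
  refine (Nat.mul_le_mul_left _ h1).trans ?_
  rw [mul_sum]
  refine (sum_le_sum fun x hx => card_mul_card_weakMax_le (hA hx)).trans ?_
  rw [sum_const, smul_eq_mul]
  exact le_of_eq (by ring)

variable (G : LabeledGraph (Fin n))

/-- The largest key in the closed neighborhood of `u`. -/
noncomputable def LabeledGraph.maxKey (f : Fin n → Fin (n * n)) (u : Fin n) : ℕ :=
  (G.nbhd u).sup (hashKey f)

/-- The vertex with the largest key in the closed neighborhood of `u`. -/
noncomputable def LabeledGraph.argmaxKey (f : Fin n → Fin (n * n)) (u : Fin n) : Fin n :=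
  ⟨G.maxKey f u % n, Nat.mod_lt _ u.pos⟩

theorem LabeledGraph.exists_maxKey (f : Fin n → Fin (n * n)) (u : Fin n) :
    ∃ x ∈ G.nbhd u, G.maxKey f u = hashKey f x :=
  exists_mem_eq_sup _ ⟨u, G.self_mem_nbhd u⟩ _

theorem LabeledGraph.argmaxKey_mem (f : Fin n → Fin (n * n)) (u : Fin n) :
    G.argmaxKey f u ∈ G.nbhd u ∧ G.maxKey f u = hashKey f (G.argmaxKey f u) := by
  obtain ⟨x, hx, h⟩ := G.exists_maxKey f u
  have : G.argmaxKey f u = x := Fin.ext ((congrArg (· % n) h).trans (hashKey_mod f x))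
  rw [this]
  exact ⟨hx, h⟩

theorem LabeledGraph.argmaxKey_eq_iff (f : Fin n → Fin (n * n)) (u v : Fin n) :
    G.argmaxKey f u = G.argmaxKey f v ↔ G.maxKey f u = G.maxKey f v := by
  rw [(G.argmaxKey_mem f u).2, (G.argmaxKey_mem f v).2]
  exact (hashKey_injective f).eq_iff.symm

theorem LabeledGraph.hashKey_le_argmaxKey (f : Fin n → Fin (n * n)) {u x : Fin n}
    (hx : x ∈ G.nbhd u) : hashKey f x ≤ hashKey f (G.argmaxKey f u) := by
  rw [← (G.argmaxKey_mem f u).2]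
  exact le_sup hx

/-- The max-wise hashing principle: the top vertex of the union lies in the intersection when the
two slots agree, and in the symmetric difference otherwise. -/
theorem LabeledGraph.exists_argmax_union (f : Fin n → Fin (n * n)) (u v : Fin n) :
    ∃ x ∈ (if G.argmaxKey f u = G.argmaxKey f v then G.nbhd u ∩ G.nbhd v
      else symmDiff (G.nbhd u) (G.nbhd v)),
      ∀ y ∈ G.nbhd u ∪ G.nbhd v, hashKey f y ≤ hashKey f x := by
  have hu := (G.argmaxKey_mem f u).1
  have hv := (G.argmaxKey_mem f v).1
  split_ifs with h
  · refine ⟨_, mem_inter.2 ⟨hu, h ▸ hv⟩, fun y hy => ?_⟩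
    rcases mem_union.1 hy with hy | hy
    · exact G.hashKey_le_argmaxKey f hy
    · rw [h]
      exact G.hashKey_le_argmaxKey f hy
  · rcases lt_or_gt_of_ne fun h' => h (hashKey_injective f h') with hlt | hlt
    · refine ⟨_, mem_symmDiff.2 (Or.inr ⟨hv, fun h' => ?_⟩), fun y hy => ?_⟩
      · exact hlt.not_ge (G.hashKey_le_argmaxKey f h')
      · rcases mem_union.1 hy with hy | hy
        · exact (G.hashKey_le_argmaxKey f hy).trans hlt.le
        · exact G.hashKey_le_argmaxKey f hy
    · refine ⟨_, mem_symmDiff.2 (Or.inl ⟨hu, fun h' => ?_⟩), fun y hy => ?_⟩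
      · exact hlt.not_ge (G.hashKey_le_argmaxKey f h')
      · rcases mem_union.1 hy with hy | hy
        · exact G.hashKey_le_argmaxKey f hy
        · exact (G.hashKey_le_argmaxKey f hy).trans hlt.le

/-- The sketches given by independent random keys. -/
noncomputable def LabeledGraph.sketch {K : ℕ} (ω : Fin K → Fin n → Fin (n * n)) (u : Fin n)
    (i : Fin K) : Fin n := G.argmaxKey (ω i) u

theorem card_le_of_argmax {E : Finset (Fin n → Fin (n * n))} {U A : Finset (Fin n)}
    (hU : 0 < #U) (hA : A ⊆ U) {q : ℝ} (hq : 2 * (#A : ℝ) ≤ q * #U)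
    (hE : ∀ f ∈ E, ∃ x ∈ A, ∀ y ∈ U, hashKey f y ≤ hashKey f x) :
    (#E : ℝ) ≤ q * Fintype.card (Fin n → Fin (n * n)) := by
  have h1 : #U * #E ≤ 2 * #A * Fintype.card (Fin n → Fin (n * n)) :=
    (Nat.mul_le_mul_left _ (card_le_card fun f hf => mem_filter.2 ⟨mem_univ _, hE f hf⟩)).trans
      (card_mul_card_argmax_le hA)
  have h2 : (#U : ℝ) * #E ≤ 2 * #A * Fintype.card (Fin n → Fin (n * n)) := by exact_mod_cast h1
  have hU' : (0 : ℝ) < #U := by exact_mod_cast hU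
  refine le_of_mul_le_mul_left ?_ hU'
  refine h2.trans ?_
  calc 2 * (#A : ℝ) * Fintype.card (Fin n → Fin (n * n))
      ≤ q * #U * Fintype.card (Fin n → Fin (n * n)) := by gcongr
    _ = _ := by ring

/-- The expected fraction of differing slots is at most 2/32 = 1/16, and the deviation 1/16 still
leaves it within 1/8. -/
theorem card_not_close_le (K : ℕ) {u v : Fin n} (h : ¬ G.Disagree u v) :
    (#{ω : Fin K → Fin n → Fin (n * n) | ¬ 8 * far (G.sketch ω) u v ≤ K} : ℝ) ≤
      Real.exp (-(K / 1024)) * Fintype.card (Fin K → Fin n → Fin (n * n)) := by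
  have : Nonempty (Fin (n * n)) := ⟨⟨0, Nat.mul_pos u.pos u.pos⟩⟩
  have hE := card_le_of_argmax (q := 1 / 16) (U := G.nbhd u ∪ G.nbhd v)
    (A := symmDiff (G.nbhd u) (G.nbhd v))
    (E := {f : Fin n → Fin (n * n) | G.argmaxKey f u ≠ G.argmaxKey f v})
    (card_pos.2 ⟨u, mem_union_left _ (G.self_mem_nbhd u)⟩)
    (symmDiff_le_sup) ?_ ?_
  · refine le_trans ?_ (card_count_ge_le _ K (by norm_num) hE)
    refine Nat.cast_le.2 (card_le_card fun ω hω => ?_)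
    simp only [mem_filter, mem_univ, true_and, not_le] at hω ⊢
    have h2 : (K : ℝ) < 8 * far (G.sketch ω) u v := by exact_mod_cast hω
    have h3 : #{i | G.argmaxKey (ω i) u ≠ G.argmaxKey (ω i) v} = far (G.sketch ω) u v := by
      unfold far LabeledGraph.sketch
      congr!
    rw [h3]
    linarith
  · unfold LabeledGraph.Disagree at h
    rw [not_lt] at h
    have h' : 32 * #(symmDiff (G.nbhd u) (G.nbhd v)) ≤ #(G.nbhd u ∪ G.nbhd v) := by
      refine le_trans (le_of_eq ?_) (h.trans (le_of_eq ?_)) <;> congr!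
    have : (32 : ℝ) * #(symmDiff (G.nbhd u) (G.nbhd v)) ≤ #(G.nbhd u ∪ G.nbhd v) := by
      exact_mod_cast h'
    linarith
  · intro f hf
    have := G.exists_argmax_union f u v
    rwa [if_neg (mem_filter.1 hf).2] at this

/-- The expected fraction of agreement is at most 2 · 1/4, and 1/2 + 1/16 < 3/4. -/
theorem card_not_apart_le (K : ℕ) (hK : 0 < K) {u v : Fin n}
    (h : 4 * #(G.nbhd u ∩ G.nbhd v) < #(G.nbhd u ∪ G.nbhd v)) :
    (#{ω : Fin K → Fin n → Fin (n * n) |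
      ¬ 4 * #{i | G.sketch ω u i = G.sketch ω v i} < 3 * K} : ℝ) ≤
      Real.exp (-(K / 1024)) * Fintype.card (Fin K → Fin n → Fin (n * n)) := by
  have : Nonempty (Fin (n * n)) := ⟨⟨0, Nat.mul_pos u.pos u.pos⟩⟩
  have hE := card_le_of_argmax (q := 1 / 2) (U := G.nbhd u ∪ G.nbhd v)
    (A := G.nbhd u ∩ G.nbhd v)
    (E := {f : Fin n → Fin (n * n) | G.argmaxKey f u = G.argmaxKey f v})
    (card_pos.2 ⟨u, mem_union_left _ (G.self_mem_nbhd u)⟩)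
    (inter_subset_left.trans subset_union_left) ?_ ?_
  · refine le_trans ?_ (card_count_ge_le _ K (by norm_num) hE)
    refine Nat.cast_le.2 (card_le_card fun ω hω => ?_)
    simp only [mem_filter, mem_univ, true_and, not_lt] at hω ⊢
    have h2 : (3 : ℝ) * K ≤ 4 * #{i | G.sketch ω u i = G.sketch ω v i} := by exact_mod_cast hω
    have h3 : #{i | G.argmaxKey (ω i) u = G.argmaxKey (ω i) v} =
        #{i | G.sketch ω u i = G.sketch ω v i} := by
      unfold LabeledGraph.sketch
      congr!
    rw [h3]
    have : (0 : ℝ) < K := by exact_mod_cast hK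
    linarith
  · have : (4 : ℝ) * #(G.nbhd u ∩ G.nbhd v) < #(G.nbhd u ∪ G.nbhd v) := by exact_mod_cast h
    linarith
  · intro f hf
    have := G.exists_argmax_union f u v
    rwa [if_pos (mem_filter.1 hf).2] at this

theorem card_not_sample_le (K : ℕ) {u : Fin n} (h : 32 * #(G.disagreeing u) ≤ #(G.nbhd u)) :
    (#{ω : Fin K → Fin n → Fin (n * n) |
      ¬ 8 * #{i | G.sketch ω u i ∈ G.disagreeing u} ≤ K} : ℝ) ≤
      Real.exp (-(K / 1024)) * Fintype.card (Fin K → Fin n → Fin (n * n)) := by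
  have : Nonempty (Fin (n * n)) := ⟨⟨0, Nat.mul_pos u.pos u.pos⟩⟩
  have hE := card_le_of_argmax (q := 1 / 16) (U := G.nbhd u) (A := G.disagreeing u)
    (E := {f : Fin n → Fin (n * n) | G.argmaxKey f u ∈ G.disagreeing u})
    (G.nbhd_card_pos u) (filter_subset _ _) ?_ ?_
  · refine le_trans ?_ (card_count_ge_le _ K (by norm_num) hE)
    refine Nat.cast_le.2 (card_le_card fun ω hω => ?_)
    simp only [mem_filter, mem_univ, true_and, not_le] at hω ⊢
    have h2 : (K : ℝ) < 8 * #{i | G.sketch ω u i ∈ G.disagreeing u} := by exact_mod_cast hω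
    have h3 : #{i | G.argmaxKey (ω i) u ∈ G.disagreeing u} =
        #{i | G.sketch ω u i ∈ G.disagreeing u} := by
      unfold LabeledGraph.sketch
      congr!
    rw [h3]
    linarith
  · have : (32 : ℝ) * #(G.disagreeing u) ≤ #(G.nbhd u) := by exact_mod_cast h
    linarith
  · intro f hf
    exact ⟨_, (mem_filter.1 hf).2, fun y hy => G.hashKey_le_argmaxKey f hy⟩

/-- Union bound: `close` and `apart` contribute n² events each and `sample` contributes n, while
`mem` holds always. -/
theorem card_not_isFaithful_le (K : ℕ) (hK : 0 < K) :
    (#{ω : Fin K → Fin n → Fin (n * n) | ¬ IsFaithful G (G.sketch ω)} : ℝ) ≤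
      (2 * n ^ 2 + n) *
        (Real.exp (-(K / 1024)) * Fintype.card (Fin K → Fin n → Fin (n * n))) := by
  set Ω := Fin K → Fin n → Fin (n * n) with hΩ
  set b := Real.exp (-(K / 1024)) * Fintype.card Ω with hb
  have hb0 : 0 ≤ b := by positivity
  set E₁ : Fin n × Fin n → Finset Ω := fun p =>
    {ω | ¬ (¬ G.Disagree p.1 p.2 → 8 * far (G.sketch ω) p.1 p.2 ≤ K)} with hE₁
  set E₂ : Fin n × Fin n → Finset Ω := fun p =>
    {ω | ¬ (4 * #(G.nbhd p.1 ∩ G.nbhd p.2) < #(G.nbhd p.1 ∪ G.nbhd p.2) →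
      4 * #{i | G.sketch ω p.1 i = G.sketch ω p.2 i} < 3 * K)} with hE₂
  set E₃ : Fin n → Finset Ω := fun u =>
    {ω | ¬ (32 * #(G.disagreeing u) ≤ #(G.nbhd u) →
      8 * #{i | G.sketch ω u i ∈ G.disagreeing u} ≤ K)} with hE₃
  have h₁ : ∀ p, (#(E₁ p) : ℝ) ≤ b := by
    intro p
    by_cases h : G.Disagree p.1 p.2
    · simp [hE₁, h, hb0]
    · simp only [hE₁, h, not_false_eq_true, true_imp_iff]
      exact card_not_close_le G K h
  have h₂ : ∀ p, (#(E₂ p) : ℝ) ≤ b := by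
    intro p
    by_cases h : 4 * #(G.nbhd p.1 ∩ G.nbhd p.2) < #(G.nbhd p.1 ∪ G.nbhd p.2)
    · simp only [hE₂, h, true_imp_iff]
      exact card_not_apart_le G K hK h
    · simp [hE₂, h, hb0]
  have h₃ : ∀ u, (#(E₃ u) : ℝ) ≤ b := by
    intro u
    by_cases h : 32 * #(G.disagreeing u) ≤ #(G.nbhd u)
    · simp only [hE₃, h, true_imp_iff]
      exact card_not_sample_le G K h
    · simp [hE₃, h, hb0]
  have hsub : ({ω : Ω | ¬ IsFaithful G (G.sketch ω)} : Finset Ω) ⊆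
      (univ.biUnion E₁ ∪ univ.biUnion E₂) ∪ univ.biUnion E₃ := by
    intro ω hω
    by_contra hcon
    simp only [mem_union, mem_biUnion, mem_univ, true_and, not_or, not_exists, hE₁, hE₂, hE₃,
      mem_filter, not_not] at hcon hω
    obtain ⟨⟨c1, c2⟩, c3⟩ := hcon
    refine hω ⟨fun u i => (G.argmaxKey_mem _ u).1, fun u v h => c1 (u, v) h, fun u v h => ?_,
      fun u h => ?_⟩
    · convert c2 (u, v) (by convert h)
    · convert c3 u h
  have hcard : (#{ω : Ω | ¬ IsFaithful G (G.sketch ω)} : ℝ) ≤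
      (∑ p, (#(E₁ p) : ℝ) + ∑ p, (#(E₂ p) : ℝ)) + ∑ u, (#(E₃ u) : ℝ) := by
    have := (card_le_card hsub).trans ((card_union_le _ _).trans
      (Nat.add_le_add ((card_union_le _ _).trans (Nat.add_le_add card_biUnion_le card_biUnion_le))
        card_biUnion_le))
    exact_mod_cast this
  refine hcard.trans ?_
  have s₁ := sum_le_card_nsmul (univ : Finset (Fin n × Fin n)) _ b fun p _ => h₁ p
  have s₂ := sum_le_card_nsmul (univ : Finset (Fin n × Fin n)) _ b fun p _ => h₂ p
  have s₃ := sum_le_card_nsmul (univ : Finset (Fin n)) _ b fun p _ => h₃ p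
  simp only [card_univ, Fintype.card_prod, Fintype.card_fin, nsmul_eq_mul] at s₁ s₂ s₃
  push_cast at s₁ s₂ s₃
  calc _ ≤ ((n : ℝ) * n * b + n * n * b) + n * b := by gcongr
    _ = _ := by ring

/-- Number of slots that suffices for the failure probability `n ^ (-k)`. -/
def numSlots (k n : ℕ) : ℕ := 1024 * (k + 4) * Nat.clog 2 n

/-- Since `e ≥ 2`, the exponential is at most n^(-(k+4)); the extra 4 absorbs the union bound, as
2n² + n ≤ n⁴ for n ≥ 2. -/
theorem exp_neg_numSlots_le (k : ℕ) (hn : 2 ≤ n) :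
    (2 * (n : ℝ) ^ 2 + n) * Real.exp (-(numSlots k n / 1024)) ≤ ((n : ℝ) ^ k)⁻¹ := by
  have hn0 : (2 : ℝ) ≤ n := by exact_mod_cast hn
  have h1 : (n : ℝ) ^ (k + 4) ≤ Real.exp (numSlots k n / 1024) := by
    have h2 : (n : ℝ) ≤ 2 ^ Nat.clog 2 n := by
      exact_mod_cast Nat.le_pow_clog one_lt_two n
    have h3 : (2 : ℝ) ≤ Real.exp 1 := by
      have := Real.add_one_le_exp (1 : ℝ)
      linarith
    calc (n : ℝ) ^ (k + 4) ≤ (Real.exp 1 ^ Nat.clog 2 n) ^ (k + 4) := by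
          refine pow_le_pow_left₀ (by positivity) (h2.trans ?_) _
          exact pow_le_pow_left₀ (by norm_num) h3 _
      _ = Real.exp (numSlots k n / 1024) := by
          rw [← pow_mul, ← Real.exp_nat_mul, numSlots]
          congr 1
          push_cast
          ring
  have h4 : 2 * (n : ℝ) ^ 2 + n ≤ (n : ℝ) ^ 4 := by nlinarith [sq_nonneg ((n : ℝ) ^ 2 - 4)]
  rw [Real.exp_neg, ← div_eq_mul_inv, div_le_iff₀ (Real.exp_pos _), inv_mul_eq_div,
    le_div_iff₀ (by positivity)]
  calc (2 * (n : ℝ) ^ 2 + n) * n ^ k ≤ (n : ℝ) ^ 4 * n ^ k := by gcongr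
    _ = (n : ℝ) ^ (k + 4) := by ring
    _ ≤ _ := h1

theorem card_not_isFaithful_numSlots_le (k : ℕ) (hn : 2 ≤ n) :
    (#{ω : Fin (numSlots k n) → Fin n → Fin (n * n) | ¬ IsFaithful G (G.sketch ω)} : ℝ) ≤
      ((n : ℝ) ^ k)⁻¹ * Fintype.card (Fin (numSlots k n) → Fin n → Fin (n * n)) := by
  have hK : 0 < numSlots k n :=
    Nat.mul_pos (by positivity) (Nat.clog_pos one_lt_two hn)
  refine (card_not_isFaithful_le G _ hK).trans ?_
  rw [← mul_assoc]
  gcongr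
  exact exp_neg_numSlots_le k hn

end

end

/-! ### Verification of the update program and deferred random choices. -/

/-! ## Straight-line programs on explicit states -/

/-- Register contents given by a list. -/
def regsOf (l : List ℕ) : ℕ → ℕ := fun i => l.getD i 0

theorem update_regsOf {l : List ℕ} {i : ℕ} (x : ℕ) (h : i < l.length) :
    Function.update (regsOf l) i x = regsOf (l.set i x) := by
  funext j
  by_cases hj : j = i
  · subst hj
    simp [regsOf, h]
  · simp [regsOf, hj, Ne.symm hj]

/-- Execute the commands one after the other. -/
def Cmd.block : List Cmd → Cmd
  | [] => .skip
  | c :: cs => .seq c (Cmd.block cs)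

section
variable {M : ℕ} {l : List ℕ} {m : ℕ → ℕ} {P i x a t : ℕ} {e ea : Expr} {cs : List Cmd} {s : State}

theorem runs_block_nil {s : State} : Runs M (Cmd.block []) s 1 (PMF.pure s) :=
  runs_of_step fun _ => rfl

/-- Stated for a command in front of the rest of its block, so that repeated `refine` executes a
straight-line program symbolically on an explicit register list. -/
theorem runs_assign (hi : i < l.length) (he : e.Fits M (regsOf l)) (hx : e.val (regsOf l) = x)
    (h : Runs M (Cmd.block cs) ⟨regsOf (l.set i x), m, P⟩ t (PMF.pure s)) :
    Runs M (Cmd.block (.assign i e :: cs)) ⟨regsOf l, m, P⟩ (1 + 1 + t) (PMF.pure s) := by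
  refine runs_seq (s₁ := ⟨regsOf (l.set i x), m, P⟩) (runs_of_step fun k => ?_) h
  simp only [step, Expr.eval_eq_val (s := ⟨regsOf l, m, P⟩) he, hx, State.setReg,
    update_regsOf x hi]

theorem runs_load_peak {Q : ℕ} (hi : i < l.length) (hea : ea.Fits M (regsOf l))
    (ha : ea.val (regsOf l) = a) (hQ : max P (a + 1) = Q) (hx : m a = x)
    (h : Runs M (Cmd.block cs) ⟨regsOf (l.set i x), m, Q⟩ t (PMF.pure s)) :
    Runs M (Cmd.block (.load i ea :: cs)) ⟨regsOf l, m, P⟩ (1 + 1 + t) (PMF.pure s) := by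
  refine runs_seq (s₁ := ⟨regsOf (l.set i x), m, Q⟩) (runs_of_step fun k => ?_) h
  simp only [step, Expr.eval_eq_val (s := ⟨regsOf l, m, P⟩) hea, ha, State.setReg, State.touch,
    hx, update_regsOf x hi, hQ]

theorem runs_load (hi : i < l.length) (hea : ea.Fits M (regsOf l)) (ha : ea.val (regsOf l) = a)
    (haP : a < P) (hx : m a = x)
    (h : Runs M (Cmd.block cs) ⟨regsOf (l.set i x), m, P⟩ t (PMF.pure s)) :
    Runs M (Cmd.block (.load i ea :: cs)) ⟨regsOf l, m, P⟩ (1 + 1 + t) (PMF.pure s) :=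
  runs_load_peak hi hea ha (max_eq_left (Nat.succ_le_of_lt haP)) hx h

theorem runs_store (hea : ea.Fits M (regsOf l)) (ha : ea.val (regsOf l) = a) (haP : a < P)
    (he : e.Fits M (regsOf l)) (hx : e.val (regsOf l) = x)
    (h : Runs M (Cmd.block cs) ⟨regsOf l, Function.update m a x, P⟩ t (PMF.pure s)) :
    Runs M (Cmd.block (.store ea e :: cs)) ⟨regsOf l, m, P⟩ (1 + 1 + t) (PMF.pure s) := by
  refine runs_seq (s₁ := ⟨regsOf l, Function.update m a x, P⟩) (runs_of_step fun k => ?_) h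
  simp only [step, Expr.eval_eq_val (s := ⟨regsOf l, m, P⟩) hea,
    Expr.eval_eq_val (s := ⟨regsOf l, m, P⟩) he, ha, hx, State.setMem, State.touch,
    max_eq_left (Nat.succ_le_of_lt haP)]

end

theorem uniformBelow_eq (m : ℕ) [NeZero m] :
    uniformBelow m = (PMF.uniformOfFintype (Fin m)).map Fin.val := by
  obtain ⟨k, rfl⟩ := Nat.exists_eq_succ_of_ne_zero (NeZero.ne m)
  rfl

theorem runs_rand {M : ℕ} {l : List ℕ} {mem : ℕ → ℕ} {P i m t : ℕ} [NeZero m] {e : Expr}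
    {cs : List Cmd} {ν : Fin m → PMF State} (hi : i < l.length) (he : e.Fits M (regsOf l))
    (hm : e.val (regsOf l) = m)
    (h : ∀ x : Fin m, Runs M (Cmd.block cs) ⟨regsOf (l.set i x), mem, P⟩ t (ν x)) :
    Runs M (Cmd.block (.rand i e :: cs)) ⟨regsOf l, mem, P⟩ (1 + 1 + t)
      ((PMF.uniformOfFintype (Fin m)).bind ν) := by
  intro k T
  rw [show 1 + 1 + t + T = 1 + (1 + (t + T)) by ring, steps_succ, Cmd.block, step, PMF.pure_bind,
    steps_succ, step, Expr.eval_eq_val (s := ⟨regsOf l, mem, P⟩) he, hm, uniformBelow_eq,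
    PMF.map_comp, PMF.bind_map, PMF.bind_bind]
  congr 1
  funext x
  rw [← h x k T]
  simp only [Function.comp_apply, State.setReg, update_regsOf _ hi]

/-! ## Memory layout -/

/-- The first `n` cells hold `o`, the next `n` cells hold `l`, and then follow `2 n` rows of `K`
cells that hold `X`. -/
def memory (n K : ℕ) (o l : ℕ → ℕ) (X : ℕ → ℕ → ℕ) : ℕ → ℕ := fun a =>
  if a < n then o a
  else if a < 2 * n then l (a - n)
  else if a < 2 * n + 2 * n * K then X ((a - 2 * n) / K) ((a - 2 * n) % K)
  else 0

/-- Number of cells of the memory layout. -/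
def memorySize (n K : ℕ) : ℕ := 2 * n + 2 * n * K

/-- Change one entry of a matrix. -/
def updateEntry (X : ℕ → ℕ → ℕ) (r i x : ℕ) : ℕ → ℕ → ℕ :=
  fun r' i' => if r' = r ∧ i' = i then x else X r' i'

section
variable {n K : ℕ} {o l : ℕ → ℕ} {X : ℕ → ℕ → ℕ} {r i : ℕ}

theorem slot_lt (hr : r < 2 * n) (hi : i < K) : 2 * n + (r * K + i) < memorySize n K := by
  have : (r + 1) * K ≤ 2 * n * K := Nat.mul_le_mul_right _ hr
  rw [add_mul] at this
  rw [memorySize]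
  omega

theorem memory_slot (hr : r < 2 * n) (hi : i < K) :
    memory n K o l X (2 * n + (r * K + i)) = X r i := by
  have := slot_lt hr hi
  rw [memorySize] at this
  have h1 : (r * K + i) / K = r := by
    rw [mul_comm, Nat.mul_add_div (by omega), Nat.div_eq_of_lt hi, add_zero]
  have h2 : (r * K + i) % K = i := by
    rw [Nat.mul_add_mod', Nat.mod_eq_of_lt hi]
  rw [memory, if_neg (by omega), if_neg (by omega), if_pos this, Nat.add_sub_cancel_left, h1, h2]

theorem update_memory_slot (hr : r < 2 * n) (hi : i < K) (x : ℕ) :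
    Function.update (memory n K o l X) (2 * n + (r * K + i)) x =
      memory n K o l (updateEntry X r i x) := by
  funext a
  by_cases ha : a = 2 * n + (r * K + i)
  · rw [ha, memory_slot hr hi]
    simp [updateEntry]
  · rw [Function.update_of_ne ha, memory, memory]
    split_ifs with h1 h2 h3
    · rfl
    · rfl
    · rw [updateEntry, if_neg]
      rintro ⟨h4, h5⟩
      have := Nat.div_add_mod' (a - 2 * n) K
      rw [h4, h5] at this
      omega
    · rfl

theorem memory_congr {o' l' : ℕ → ℕ} {X' : ℕ → ℕ → ℕ} (ho : ∀ v < n, o v = o' v)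
    (hl : ∀ v < n, l v = l' v) (hX : ∀ r < 2 * n, ∀ i < K, X r i = X' r i) :
    memory n K o l X = memory n K o' l' X' := by
  funext a
  rw [memory, memory]
  split_ifs with h1 h2 h3
  · exact ho a h1
  · exact hl _ (by omega)
  · have hK : 0 < K := by
      rcases Nat.eq_zero_or_pos K with h | h
      · rw [h, mul_zero] at h3; omega
      · exact h
    refine hX _ ?_ _ (Nat.mod_lt _ hK)
    rw [Nat.div_lt_iff_lt_mul hK]
    omega
  · rfl

end

/-- Words are large enough for the addresses and the keys. -/
structure LargeWords (n K M : ℕ) : Prop where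
  two_le : 2 ≤ n
  pos : 0 < K
  space : memorySize n K < M
  keys : 2 * (n * n * n + n) < M

theorem LargeWords.basic {n K M : ℕ} (h : LargeWords n K M) :
    1 < M ∧ 2 < M ∧ n < M ∧ 2 * n < M ∧ K < M ∧ n * n < M ∧ 2 * n + 2 * n * K < M := by
  have h1 := h.two_le
  have h2 := h.space
  rw [memorySize] at h2
  have h3 : K ≤ n * K := Nat.le_mul_of_pos_left _ (by omega)
  have h4 : n * n ≤ n * n * n := Nat.le_mul_of_pos_right _ (by omega)
  have h5 := h.keys
  have h6 : 2 * n * K = 2 * (n * K) := by ring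
  refine ⟨?_, ?_, ?_, ?_, ?_, ?_, h2⟩ <;> omega

/-- Address of the entry in the row `e` and the column given by register `c`. -/
def slotAddr (e : Expr) (c : ℕ) : Expr := .const 2 * .reg 0 + (e * .reg 4 + .reg c)

theorem slotAddr_val {n K r i c : ℕ} {e : Expr} {f : ℕ → ℕ} (h0 : f 0 = n) (h4 : f 4 = K)
    (hc : f c = i) (he : e.val f = r) : (slotAddr e c).val f = 2 * n + (r * K + i) := by
  simp [slotAddr, Expr.val, BinOp.eval, h0, h4, hc, he]

theorem slotAddr_fits {n K M r i c : ℕ} {e : Expr} {f : ℕ → ℕ} (hM : LargeWords n K M)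
    (h0 : f 0 = n) (h4 : f 4 = K) (hc : f c = i) (hr : r < 2 * n) (hi : i < K)
    (hf : e.Fits M f) (he : e.val f = r) : (slotAddr e c).Fits M f := by
  have := slot_lt hr hi
  have := hM.space
  obtain ⟨-, h2, -, h2n, -⟩ := hM.basic
  simp only [slotAddr, Expr.Fits, Expr.val, BinOp.eval, h0, h4, hc, he, hf, true_and]
  omega

/-! ## The update program -/

/-- The key stored in register `a`, or a new one made from the random number in register `r` and
the vertex in register `v` if there is none. -/
def newKey (a r v : ℕ) : Expr :=
  .reg a + .bin .eq (.reg a) (.const 0) * (.reg r * .reg 0 + .reg 0 + .reg v)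

/-- The maximum of the registers `a` and `b`. -/
def maxExpr (a b : ℕ) : Expr := .reg a + (.reg b - .reg a)

/-- The maximum of the registers `a` and `b` if register `3` holds `1`, and register `a` if
register `3` holds `0`. -/
def maxIfPlus (a b : ℕ) : Expr := .reg a + (.reg b - .reg a) * .reg 3

/-- Draw missing keys of the endpoints. -/
def drawKeys (cs : List Cmd) : List Cmd :=
  .load 8 (slotAddr (.reg 1) 5) :: .assign 8 (newKey 8 6 1) ::
  .store (slotAddr (.reg 1) 5) (.reg 8) ::
  .load 9 (slotAddr (.reg 2) 5) :: .assign 9 (newKey 9 7 2) ::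
  .store (slotAddr (.reg 2) 5) (.reg 9) :: cs

/-- Update the largest keys in the neighborhoods of the endpoints. -/
def mergeKeys (cs : List Cmd) : List Cmd :=
  .load 10 (slotAddr (.reg 0 + .reg 1) 5) :: .assign 10 (maxExpr 10 8) ::
  .assign 10 (maxIfPlus 10 9) :: .store (slotAddr (.reg 0 + .reg 1) 5) (.reg 10) ::
  .load 10 (slotAddr (.reg 0 + .reg 2) 5) :: .assign 10 (maxExpr 10 9) ::
  .assign 10 (maxIfPlus 10 8) :: .store (slotAddr (.reg 0 + .reg 2) 5) (.reg 10) :: cs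

/-- Clear the temporary registers and go to the next slot. -/
def nextSlot : List Cmd :=
  [.assign 5 (.reg 5 + .const 1), .assign 6 (.const 0), .assign 7 (.const 0),
    .assign 8 (.const 0), .assign 9 (.const 0), .assign 10 (.const 0)]

/-- Process the slot given by register `5`. -/
def slotBody : Cmd :=
  .block (.rand 6 (.reg 0 * .reg 0) :: .rand 7 (.reg 0 * .reg 0) ::
    drawKeys (mergeKeys nextSlot))

/-- The key `a` of the vertex `v`, or a new one if it is `0`. -/
def keyOr (n v r a : ℕ) : ℕ := if a = 0 then r * n + n + v else a

/-- Effect of `drawKeys`. -/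
def withKeys (n u v i r r' : ℕ) (X : ℕ → ℕ → ℕ) : ℕ → ℕ → ℕ :=
  let X₁ := updateEntry X u i (keyOr n u r (X u i))
  updateEntry X₁ v i (keyOr n v r' (X₁ v i))

/-- Effect of `mergeKeys` if the keys are `a` and `b`. -/
def withMax (n u v : ℕ) (plus : Bool) (i a b : ℕ) (X : ℕ → ℕ → ℕ) : ℕ → ℕ → ℕ :=
  let X₁ := updateEntry X (n + u) i (max (max (X (n + u) i) a) (if plus then b else 0))
  updateEntry X₁ (n + v) i (max (max (X₁ (n + v) i) b) (if plus then a else 0))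

/-- Effect of `slotBody`. -/
def slotUpdate (n u v : ℕ) (plus : Bool) (i r r' : ℕ) (X : ℕ → ℕ → ℕ) : ℕ → ℕ → ℕ :=
  let X₁ := updateEntry X u i (keyOr n u r (X u i))
  withMax n u v plus i (keyOr n u r (X u i)) (keyOr n v r' (X₁ v i)) (withKeys n u v i r r' X)

/-- Multiplication by a truth value replaces a branch. -/
theorem newKey_val {n a r v : ℕ} {f : ℕ → ℕ} (h0 : f 0 = n) :
    (newKey a r v).val f = keyOr n (f v) (f r) (f a) := by
  simp only [newKey, Expr.val, BinOp.eval, Expr.add_def, Expr.mul_def, h0, keyOr]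
  split_ifs with h <;> simp [h]

theorem key_lt {n v r : ℕ} (hv : v < n) (hr : r < n * n) : r * n + n + v < n * n * n + n := by
  have : (r + 1) * n ≤ n * n * n := Nat.mul_le_mul_right _ hr
  rw [add_mul] at this
  omega

theorem keyOr_lt {n v r a : ℕ} (hv : v < n) (hr : r < n * n) (ha : a < n * n * n + n) :
    keyOr n v r a < n * n * n + n := by
  rw [keyOr]
  split_ifs
  · exact key_lt hv hr
  · exact ha

theorem newKey_fits {n K M a r v : ℕ} {f : ℕ → ℕ} (hM : LargeWords n K M) (h0 : f 0 = n)
    (hv : f v < n) (hr : f r < n * n) (ha : f a < n * n * n + n) : (newKey a r v).Fits M f := by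
  have h1 := key_lt hv hr
  have h2 := hM.keys
  have h3 := hM.basic.1
  by_cases h : f a = 0 <;>
    simp only [newKey, Expr.Fits, Expr.val, BinOp.eval, Expr.add_def, Expr.mul_def, h0, h, true_and,
      if_true, if_false] <;> omega

/-- Subtraction on words is truncated at 0. -/
theorem maxExpr_val {a b : ℕ} {f : ℕ → ℕ} : (maxExpr a b).val f = max (f a) (f b) := by
  simp only [maxExpr, Expr.val, BinOp.eval, Expr.add_def, Expr.sub_def]
  omega

theorem maxExpr_fits {M a b : ℕ} {f : ℕ → ℕ} (ha : f a < M) (hb : f b < M) :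
    (maxExpr a b).Fits M f := by
  simp only [maxExpr, Expr.Fits, Expr.val, BinOp.eval, Expr.add_def, Expr.sub_def, true_and]
  omega

theorem maxIfPlus_val {a b : ℕ} {plus : Bool} {f : ℕ → ℕ} (h : f 3 = if plus then 1 else 0) :
    (maxIfPlus a b).val f = max (f a) (if plus then f b else 0) := by
  simp only [maxIfPlus, Expr.val, BinOp.eval, Expr.add_def, Expr.sub_def, Expr.mul_def, h]
  cases plus
  · simp
  · simp only [if_true, mul_one]
    omega

theorem maxIfPlus_fits {M a b : ℕ} {plus : Bool} {f : ℕ → ℕ} (h : f 3 = if plus then 1 else 0)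
    (ha : f a < M) (hb : f b < M) : (maxIfPlus a b).Fits M f := by
  simp only [maxIfPlus, Expr.Fits, Expr.val, BinOp.eval, Expr.add_def, Expr.sub_def, Expr.mul_def, h,
    true_and]
  cases plus
  · simp only [Bool.false_eq_true, if_false, mul_zero]
    omega
  · simp only [if_true, mul_one]
    omega

section
variable {n K M u v i : ℕ} {plus : Bool} {X : ℕ → ℕ → ℕ} {o l : ℕ → ℕ}

theorem updateEntry_lt {B r i x : ℕ} {X : ℕ → ℕ → ℕ} (hX : ∀ r i, X r i < B) (hx : x < B) :
    ∀ r' i', updateEntry X r i x r' i' < B := by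
  intro r' i'
  rw [updateEntry]
  split_ifs
  · exact hx
  · exact hX _ _

theorem runs_nextSlot (hM : LargeWords n K M) (hi : i < K) {P a b c d e : ℕ}
    {x : ℕ} {m : ℕ → ℕ} :
    Runs M (Cmd.block nextSlot) ⟨regsOf [n, u, v, x, K, i, a, b, c, d, e], m, P⟩ 13
      (PMF.pure ⟨regsOf [n, u, v, x, K, i + 1, 0, 0, 0, 0, 0], m, P⟩) := by
  obtain ⟨h1, h2, -, -, h5, -⟩ := hM.basic
  have h0 : 0 < M := by omega
  rw [show 13 = 1 + 1 + (1 + 1 + (1 + 1 + (1 + 1 + (1 + 1 + (1 + 1 + 1))))) by rfl]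
  refine runs_assign (x := i + 1) (by simp) (by simp [Expr.Fits, Expr.val, BinOp.eval, regsOf]; omega)
    rfl ?_
  iterate 5 refine runs_assign (x := 0) (by simp) (by simpa [Expr.Fits] using h0) rfl ?_
  exact runs_block_nil

theorem runs_mergeKeys (hM : LargeWords n K M) (hu : u < n) (hv : v < n)
    (hi : i < K) (hX : ∀ r i, X r i < n * n * n + n) {r r' a b c t : ℕ} {cs : List Cmd}
    {s : State} (ha : a < n * n * n + n) (hb : b < n * n * n + n)
    (h : ∀ c, Runs M (Cmd.block cs)
      ⟨regsOf [n, u, v, if plus then 1 else 0, K, i, r, r', a, b, c],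
        memory n K o l (withMax n u v plus i a b X), memorySize n K⟩ t (PMF.pure s)) :
    Runs M (Cmd.block (mergeKeys cs))
      ⟨regsOf [n, u, v, if plus then 1 else 0, K, i, r, r', a, b, c], memory n K o l X,
        memorySize n K⟩ (16 + t) (PMF.pure s) := by
  have hBM : n * n * n + n < M := by have := hM.keys; omega
  have hnu : (Expr.reg 0 + Expr.reg 1).Fits M
      (regsOf [n, u, v, if plus then 1 else 0, K, i, r, r', a, b, c]) := by
    have := hM.basic.2.2.2.1
    simp [Expr.Fits, Expr.val, BinOp.eval, regsOf]
    omega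
  have hnv : ∀ c, (Expr.reg 0 + Expr.reg 2).Fits M
      (regsOf [n, u, v, if plus then 1 else 0, K, i, r, r', a, b, c]) := by
    intro c
    have := hM.basic.2.2.2.1
    simp [Expr.Fits, Expr.val, BinOp.eval, regsOf]
    omega
  have hl : ∀ a b : ℕ, (if plus = true then b else 0) ≤ b := by
    intro a b; split_ifs <;> omega
  have hub : n + u < 2 * n := by omega
  have hvb : n + v < 2 * n := by omega
  rw [show 16 + t = 1 + 1 + (1 + 1 + (1 + 1 + (1 + 1 + (1 + 1 + (1 + 1 + (1 + 1 + (1 + 1 + t)))))))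
    by ring]
  set c₁ := X (n + u) i with hc₁
  have hc₁B : c₁ < n * n * n + n := hX _ _
  set c₂ := max (max c₁ a) (if plus then b else 0) with hc₂
  have hc₂B : c₂ < n * n * n + n := by have := hl 0 b; omega
  set X₁ := updateEntry X (n + u) i c₂ with hX₁
  have hX₁B : ∀ r i, X₁ r i < n * n * n + n := updateEntry_lt hX hc₂B
  set c₃ := X₁ (n + v) i with hc₃
  have hc₃B : c₃ < n * n * n + n := hX₁B _ _
  set c₄ := max (max c₃ b) (if plus then a else 0) with hc₄
  have hc₄B : c₄ < n * n * n + n := by have := hl 0 a; omega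
  refine runs_load (x := c₁) (by simp) (slotAddr_fits hM rfl rfl rfl hub hi hnu rfl)
    (slotAddr_val rfl rfl rfl rfl) (slot_lt hub hi) (memory_slot hub hi) ?_
  refine runs_assign (x := max c₁ a) (by simp)
    (maxExpr_fits (hc₁B.trans hBM) (ha.trans hBM)) maxExpr_val ?_
  refine runs_assign (x := c₂) (by simp)
    (maxIfPlus_fits rfl ((max_lt hc₁B ha).trans hBM) (hb.trans hBM)) (maxIfPlus_val rfl) ?_
  refine runs_store (a := 2 * n + ((n + u) * K + i)) (x := c₂) (slotAddr_fits hM rfl rfl rfl hub hi hnu rfl)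
    (slotAddr_val rfl rfl rfl rfl) (slot_lt hub hi) trivial rfl ?_
  rw [update_memory_slot hub hi]
  refine runs_load (x := c₃) (by simp) (slotAddr_fits hM rfl rfl rfl hvb hi (hnv _) rfl)
    (slotAddr_val rfl rfl rfl rfl) (slot_lt hvb hi) (memory_slot hvb hi) ?_
  refine runs_assign (x := max c₃ b) (by simp)
    (maxExpr_fits (hc₃B.trans hBM) (hb.trans hBM)) maxExpr_val ?_
  refine runs_assign (x := c₄) (by simp)
    (maxIfPlus_fits rfl ((max_lt hc₃B hb).trans hBM) (ha.trans hBM)) (maxIfPlus_val rfl) ?_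
  refine runs_store (a := 2 * n + ((n + v) * K + i)) (x := c₄) (slotAddr_fits hM rfl rfl rfl hvb hi (hnv _) rfl)
    (slotAddr_val rfl rfl rfl rfl) (slot_lt hvb hi) trivial rfl ?_
  rw [update_memory_slot hvb hi]
  exact h c₄

theorem runs_drawKeys (hM : LargeWords n K M) (hu : u < n) (hv : v < n)
    (hi : i < K) (hX : ∀ r i, X r i < n * n * n + n) {r r' a b c t x : ℕ} {cs : List Cmd}
    {s : State} (hr : r < n * n) (hr' : r' < n * n)
    (h : Runs M (Cmd.block cs)
      ⟨regsOf [n, u, v, x, K, i, r, r', keyOr n u r (X u i),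
        keyOr n v r' (updateEntry X u i (keyOr n u r (X u i)) v i), c],
        memory n K o l (withKeys n u v i r r' X), memorySize n K⟩ t (PMF.pure s)) :
    Runs M (Cmd.block (drawKeys cs))
      ⟨regsOf [n, u, v, x, K, i, r, r', a, b, c], memory n K o l X,
        memorySize n K⟩ (12 + t) (PMF.pure s) := by
  have hub : u < 2 * n := by omega
  have hvb : v < 2 * n := by omega
  rw [show 12 + t = 1 + 1 + (1 + 1 + (1 + 1 + (1 + 1 + (1 + 1 + (1 + 1 + t))))) by ring]
  have hB := keyOr_lt hu hr (hX u i)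
  have hX₁B := updateEntry_lt (r := u) (i := i) hX hB
  refine runs_load (x := X u i) (by simp) (slotAddr_fits hM rfl rfl rfl hub hi trivial rfl)
    (slotAddr_val rfl rfl rfl rfl) (slot_lt hub hi) (memory_slot hub hi) ?_
  refine runs_assign (x := keyOr n u r (X u i)) (by simp)
    (newKey_fits hM rfl hu hr (hX u i)) (newKey_val rfl) ?_
  refine runs_store (a := 2 * n + (u * K + i)) (x := keyOr n u r (X u i)) (slotAddr_fits hM rfl rfl rfl hub hi trivial rfl)
    (slotAddr_val rfl rfl rfl rfl) (slot_lt hub hi) trivial rfl ?_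
  rw [update_memory_slot hub hi]
  refine runs_load (x := updateEntry X u i (keyOr n u r (X u i)) v i) (by simp)
    (slotAddr_fits hM rfl rfl rfl hvb hi trivial rfl)
    (slotAddr_val rfl rfl rfl rfl) (slot_lt hvb hi) (memory_slot hvb hi) ?_
  refine runs_assign (x := keyOr n v r' (updateEntry X u i (keyOr n u r (X u i)) v i)) (by simp)
    (newKey_fits hM rfl hv hr' (hX₁B _ _)) (newKey_val rfl) ?_
  refine runs_store (a := 2 * n + (v * K + i)) (x := keyOr n v r' (updateEntry X u i (keyOr n u r (X u i)) v i))
    (slotAddr_fits hM rfl rfl rfl hvb hi trivial rfl)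
    (slotAddr_val rfl rfl rfl rfl) (slot_lt hvb hi) trivial rfl ?_
  rw [update_memory_slot hvb hi]
  exact h

/-- State of the machine during the update. -/
def slotState (n K u v : ℕ) (plus : Bool) (i : ℕ) (X : ℕ → ℕ → ℕ) : State :=
  ⟨regsOf [n, u, v, if plus then 1 else 0, K, i, 0, 0, 0, 0, 0],
    memory n K (fun _ => 0) (fun _ => 0) X, memorySize n K⟩

/-- Both numbers are drawn on every visit and `keyOr` discards those not needed, so the time is
always 45 = 2 + 2 + 12 + 16 + 13: two draws, `drawKeys`, `mergeKeys`, `nextSlot`. -/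
theorem runs_slotBody [NeZero (n * n)] (hM : LargeWords n K M) (hu : u < n) (hv : v < n)
    (hi : i < K) (hX : ∀ r i, X r i < n * n * n + n) :
    Runs M slotBody (slotState n K u v plus i X) 45
      ((PMF.uniformOfFintype (Fin (n * n))).bind fun r =>
        (PMF.uniformOfFintype (Fin (n * n))).bind fun r' =>
          PMF.pure (slotState n K u v plus (i + 1) (slotUpdate n u v plus i r r' X))) := by
  have hnn := hM.basic.2.2.2.2.2.1
  have hfit : ∀ l : List ℕ, regsOf l 0 = n → (Expr.reg 0 * Expr.reg 0).Fits M (regsOf l) := by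
    intro l hl
    simpa [Expr.Fits, Expr.val, BinOp.eval, Expr.add_def, Expr.sub_def, Expr.mul_def, hl] using hnn
  refine runs_rand (m := n * n) (t := 43) (by simp) (hfit _ rfl) rfl fun r => ?_
  refine runs_rand (m := n * n) (t := 41) (by simp) (hfit _ rfl) rfl fun r' => ?_
  refine runs_drawKeys (t := 29) hM hu hv hi hX r.2 r'.2 ?_
  have hB := keyOr_lt hu r.2 (hX u i)
  have hX₁B := updateEntry_lt (r := u) (i := i) hX hB
  have hB' := keyOr_lt hv r'.2 (hX₁B v i)
  refine runs_mergeKeys (t := 13) hM hu hv hi (updateEntry_lt hX₁B hB') hB hB' fun c => ?_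
  exact runs_nextSlot hM hi

end

/-! ## Tables of random keys -/

section
open Classical Finset
variable {n : ℕ}

/-- The vertex `x` is an endpoint of an edge in the list. -/
def Seen (π : List (Item n)) (x : Fin n) : Prop := ∃ z ∈ π, z.fst = x ∨ z.snd = x

/-- The vertices `x` and `y` are joined by a `(+)`-edge in the list. -/
def Linked (π : List (Item n)) (x y : Fin n) : Prop :=
  ∃ z ∈ π, z.plus = true ∧ ((z.fst = x ∧ z.snd = y) ∨ (z.fst = y ∧ z.snd = x))

/-- Closed neighborhood of `x` in the graph of the `(+)`-edges in the list. -/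
noncomputable def seenNbhd (π : List (Item n)) (x : Fin n) : Finset (Fin n) :=
  {y | (y = x ∧ Seen π x) ∨ Linked π x y}

theorem Linked.seen {π : List (Item n)} {x y : Fin n} (h : Linked π x y) : Seen π y := by
  obtain ⟨z, hz, -, h | h⟩ := h
  · exact ⟨z, hz, Or.inr h.2⟩
  · exact ⟨z, hz, Or.inl h.1⟩

theorem seen_of_mem_seenNbhd {π : List (Item n)} {x y : Fin n} (h : y ∈ seenNbhd π x) :
    Seen π y := by
  rw [seenNbhd, mem_filter] at h
  rcases h.2 with ⟨rfl, h⟩ | h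
  · exact h
  · exact h.seen

theorem seen_append {π : List (Item n)} {z : Item n} {x : Fin n} :
    Seen (π ++ [z]) x ↔ Seen π x ∨ z.fst = x ∨ z.snd = x := by
  simp [Seen, or_and_right, exists_or]

theorem linked_append {π : List (Item n)} {z : Item n} {x y : Fin n} :
    Linked (π ++ [z]) x y ↔ Linked π x y ∨
      (z.plus = true ∧ ((z.fst = x ∧ z.snd = y) ∨ (z.fst = y ∧ z.snd = x))) := by
  simp only [Linked, List.mem_append, List.mem_singleton, or_and_right, exists_or,
    exists_eq_left]

theorem mem_seenNbhd {π : List (Item n)} {x y : Fin n} :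
    y ∈ seenNbhd π x ↔ (y = x ∧ Seen π x) ∨ Linked π x y := by
  simp [seenNbhd]

theorem seenNbhd_append_fst {π : List (Item n)} {z : Item n} (hz : z.fst ≠ z.snd) :
    seenNbhd (π ++ [z]) z.fst =
      (seenNbhd π z.fst ∪ {z.fst}) ∪ (if z.plus then {z.snd} else ∅) := by
  ext y
  by_cases hp : z.plus = true <;>
    simp only [mem_seenNbhd, seen_append, linked_append, mem_union, mem_singleton, hp, if_true,
      true_and, notMem_empty, false_and, or_false, Bool.false_eq_true,
      if_false, hz.symm, and_false, eq_comm (a := z.snd)] <;> tauto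

theorem seenNbhd_append_snd {π : List (Item n)} {z : Item n} (hz : z.fst ≠ z.snd) :
    seenNbhd (π ++ [z]) z.snd =
      (seenNbhd π z.snd ∪ {z.snd}) ∪ (if z.plus then {z.fst} else ∅) := by
  ext y
  by_cases hp : z.plus = true <;>
    simp only [mem_seenNbhd, seen_append, linked_append, mem_union, mem_singleton, hp, if_true,
      true_and, notMem_empty, false_and, or_false, or_true, and_true, Bool.false_eq_true,
      if_false, hz, false_or, eq_comm (a := z.fst)] <;> tauto

theorem seenNbhd_append_of_ne {π : List (Item n)} {z : Item n} {x : Fin n} (h₁ : x ≠ z.fst)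
    (h₂ : x ≠ z.snd) : seenNbhd (π ++ [z]) x = seenNbhd π x := by
  ext y
  simp only [mem_seenNbhd, seen_append, linked_append, h₁.symm, h₂.symm, false_and, or_false,
    and_false]

/-- The keys and the largest keys in closed neighborhoods after the edges in the list have been
processed. -/
noncomputable def column (f : Fin n → Fin (n * n)) (π : List (Item n)) (r : ℕ) : ℕ :=
  if h : r < n then if Seen π ⟨r, h⟩ then hashKey f ⟨r, h⟩ else 0
  else if h : r - n < n then (seenNbhd π ⟨r - n, h⟩).sup (hashKey f) else 0

theorem column_key (f : Fin n → Fin (n * n)) (π : List (Item n)) (x : Fin n) :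
    column f π x = if Seen π x then hashKey f x else 0 := by
  rw [column, dif_pos x.2]

theorem column_cell (f : Fin n → Fin (n * n)) (π : List (Item n)) (x : Fin n) :
    column f π (n + x) = (seenNbhd π x).sup (hashKey f) := by
  rw [column, dif_neg (by omega), dif_pos (by rw [Nat.add_sub_cancel_left]; exact x.2)]
  simp only [Nat.add_sub_cancel_left]

theorem hashKey_lt_bound (f : Fin n → Fin (n * n)) (x : Fin n) :
    hashKey f x < n * n * n + n := key_lt x.2 (f x).2

theorem column_lt (hn : 0 < n) (f : Fin n → Fin (n * n)) (π : List (Item n)) (r : ℕ) :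
    column f π r < n * n * n + n := by
  rw [column]
  split_ifs
  · exact hashKey_lt_bound f _
  · omega
  · rw [Finset.sup_lt_iff (by rw [bot_eq_zero]; omega)]
    exact fun x _ => hashKey_lt_bound f x
  · omega

/-- Draw the random number of `x` unless this has been done before. -/
noncomputable def drawOne (f : Fin n → Fin (n * n)) (π : List (Item n)) (x : Fin n)
    (r : Fin (n * n)) : Fin n → Fin (n * n) :=
  if Seen π x then f else Function.update f x r

/-- Draw the random numbers of the endpoints of an edge unless this has been done before. -/
noncomputable def drawBoth (f : Fin n → Fin (n * n)) (π : List (Item n)) (z : Item n)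
    (r r' : Fin (n * n)) : Fin n → Fin (n * n) :=
  drawOne (drawOne f π z.fst r) π z.snd r'

theorem drawOne_of_seen {f : Fin n → Fin (n * n)} {π : List (Item n)} {x y : Fin n}
    {r : Fin (n * n)} (h : Seen π y) : drawOne f π x r y = f y := by
  rw [drawOne]
  split_ifs with hx
  · rfl
  · refine Function.update_of_ne (fun h' => hx ?_) _ _
    rwa [← h']

theorem drawOne_of_ne {f : Fin n → Fin (n * n)} {π : List (Item n)} {x y : Fin n}
    {r : Fin (n * n)} (h : y ≠ x) : drawOne f π x r y = f y := by
  rw [drawOne]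
  split_ifs with hx
  · rfl
  · exact Function.update_of_ne h _ _

theorem hashKey_congr {f g : Fin n → Fin (n * n)} {x : Fin n} (h : f x = g x) :
    hashKey f x = hashKey g x := by rw [hashKey, hashKey, h]

theorem drawBoth_of_seen {f : Fin n → Fin (n * n)} {π : List (Item n)} {z : Item n} {y : Fin n}
    {r r' : Fin (n * n)} (h : Seen π y) : drawBoth f π z r r' y = f y := by
  rw [drawBoth, drawOne_of_seen h, drawOne_of_seen h]

/-- As keys are positive, the zero test of the program recognizes exactly the unseen vertices. -/
theorem keyOr_column {f : Fin n → Fin (n * n)} {π : List (Item n)} {x : Fin n}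
    {r : Fin (n * n)} : keyOr n x r (column f π x) = hashKey (drawOne f π x r) x := by
  rw [column_key, drawOne]
  split_ifs with h
  · rw [keyOr, if_neg (hashKey_pos f x).ne']
  · rw [keyOr, if_pos rfl, hashKey, Function.update_self]

theorem keyOr_column_fst {f : Fin n → Fin (n * n)} {π : List (Item n)} {z : Item n}
    (hz : z.fst ≠ z.snd) {r r' : Fin (n * n)} :
    keyOr n z.fst r (column f π z.fst) = hashKey (drawBoth f π z r r') z.fst := by
  rw [keyOr_column]
  exact hashKey_congr (drawOne_of_ne hz).symm

theorem keyOr_column_snd {f : Fin n → Fin (n * n)} {π : List (Item n)} {z : Item n}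
    (hz : z.fst ≠ z.snd) {r r' : Fin (n * n)} :
    keyOr n z.snd r' (column f π z.snd) = hashKey (drawBoth f π z r r') z.snd := by
  rw [keyOr_column]
  refine hashKey_congr ?_
  rw [drawBoth, drawOne, drawOne]
  split_ifs
  · exact (drawOne_of_ne hz.symm).symm
  · rw [Function.update_self, Function.update_self]

/-- New numbers are given only to unseen vertices, and these belong to no neighborhood recorded so
far. -/
theorem sup_seenNbhd_drawBoth (f : Fin n → Fin (n * n)) (π : List (Item n)) (z : Item n)
    (r r' : Fin (n * n)) (x : Fin n) : (seenNbhd π x).sup (hashKey (drawBoth f π z r r')) =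
      (seenNbhd π x).sup (hashKey f) :=
  sup_congr rfl fun _ hy => hashKey_congr (drawBoth_of_seen (seen_of_mem_seenNbhd hy))

/-- The four rows written are distinct, so the successive writes do not interfere. -/
theorem slotUpdate_apply {u v : ℕ} (hu : u < n) (hv : v < n) (huv : u ≠ v) (plus : Bool)
    (i r r' : ℕ) (X : ℕ → ℕ → ℕ) (row j : ℕ) :
    slotUpdate n u v plus i r r' X row j =
      if j = i then
        if row = u then keyOr n u r (X u i)
        else if row = v then keyOr n v r' (X v i)
        else if row = n + u then max (max (X (n + u) i) (keyOr n u r (X u i)))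
          (if plus then keyOr n v r' (X v i) else 0)
        else if row = n + v then max (max (X (n + v) i) (keyOr n v r' (X v i)))
          (if plus then keyOr n u r (X u i) else 0)
        else X row i
      else X row j := by
  have e1 : v ≠ u := huv.symm
  have e2 : n + u ≠ u := by omega
  have e3 : n + u ≠ v := by omega
  have e4 : n + v ≠ u := by omega
  have e5 : n + v ≠ v := by omega
  have e6 : n + v ≠ n + u := by omega
  by_cases hj : j = i
  · subst hj
    simp only [slotUpdate, withMax, withKeys, updateEntry, and_true, e1, e2, e3, e4, e5, e6,
      if_false, if_true]
    by_cases h1 : row = u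
    · simp only [h1, e4.symm, huv, e2.symm, if_true, if_false]
    · by_cases h2 : row = v
      · simp only [h2, e3.symm, e5.symm, e1, if_true, if_false]
      · by_cases h3 : row = n + u
        · simp only [h3, e2, e3, e6.symm, if_true, if_false]
        · simp [h1, h2, h3]
  · simp [slotUpdate, withMax, withKeys, updateEntry, hj]

/-- The streaming invariant for one slot: processing an edge lazily agrees with the closed formula
`column` for the enlarged list, once the fresh numbers are written into `f`. -/
theorem slotUpdate_column {f : Fin n → Fin (n * n)} {π : List (Item n)} {z : Item n}
    (hz : z.fst ≠ z.snd) (r r' : Fin (n * n)) {i : ℕ} {X : ℕ → ℕ → ℕ}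
    (hX : ∀ row, X row i = column f π row) (row : ℕ) :
    slotUpdate n z.fst z.snd z.plus i r r' X row i =
      column (drawBoth f π z r r') (π ++ [z]) row := by
  rw [slotUpdate_apply z.fst.2 z.snd.2 (fun h => hz (Fin.ext h)), if_pos rfl]
  simp only [hX]
  rw [keyOr_column_fst hz (r' := r'), keyOr_column_snd hz (r := r)]
  by_cases h1 : row = z.fst
  · rw [if_pos h1, h1, column_key, if_pos (seen_append.2 (Or.inr (Or.inl rfl)))]
  rw [if_neg h1]
  by_cases h2 : row = z.snd
  · rw [if_pos h2, h2, column_key, if_pos (seen_append.2 (Or.inr (Or.inr rfl)))]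
  rw [if_neg h2]
  have hsup : ∀ (x : Fin n) (b : Bool), ((if b then {x} else ∅ : Finset (Fin n)).sup
      (hashKey (drawBoth f π z r r'))) = if b then hashKey (drawBoth f π z r r') x else 0 := by
    intro x b
    cases b <;> simp
  by_cases h3 : row = n + z.fst
  · rw [if_pos h3, h3, column_cell, column_cell, seenNbhd_append_fst hz, sup_union, sup_union,
      sup_singleton, hsup, sup_seenNbhd_drawBoth]
  rw [if_neg h3]
  by_cases h4 : row = n + z.snd
  · rw [if_pos h4, h4, column_cell, column_cell, seenNbhd_append_snd hz, sup_union, sup_union,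
      sup_singleton, hsup, sup_seenNbhd_drawBoth]
  rw [if_neg h4]
  by_cases h5 : row < n
  · obtain ⟨x, rfl⟩ : ∃ x : Fin n, row = x := ⟨⟨row, h5⟩, rfl⟩
    have hs : Seen (π ++ [z]) x ↔ Seen π x := by
      rw [seen_append]
      refine ⟨?_, Or.inl⟩
      rintro (h | h | h)
      · exact h
      · exact absurd (by rw [h]) h1
      · exact absurd (by rw [h]) h2
    rw [column_key, column_key]
    by_cases hx : Seen π x
    · rw [if_pos hx, if_pos (hs.2 hx)]
      exact hashKey_congr (drawBoth_of_seen hx).symm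
    · rw [if_neg hx, if_neg fun h => hx (hs.1 h)]
  by_cases h6 : row - n < n
  · obtain ⟨x, rfl⟩ : ∃ x : Fin n, row = n + x := ⟨⟨row - n, h6⟩, by simp only; omega⟩
    rw [column_cell, column_cell, seenNbhd_append_of_ne (fun h => h3 (by rw [h]))
      (fun h => h4 (by rw [h])), sup_seenNbhd_drawBoth]
  · rw [column, column, dif_neg h5, dif_neg h5, dif_neg h6, dif_neg h6]

end

/-! ## Random tables -/

/-- A bijection preserves the uniform law on the product, and the first marginal of that law is
uniform. -/
theorem bind_uniform_equiv {Ω R α : Type*} [Fintype Ω] [Nonempty Ω] [Fintype R] [Nonempty R]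
    (e : Ω × R ≃ Ω × R) (F : Ω → PMF α) :
    ((PMF.uniformOfFintype Ω).bind fun ω => (PMF.uniformOfFintype R).bind fun r =>
      F (e (ω, r)).1) = (PMF.uniformOfFintype Ω).bind F := by
  have key : ∀ H : Ω × R → PMF α, ((PMF.uniformOfFintype Ω).bind fun ω =>
      (PMF.uniformOfFintype R).bind fun r => H (ω, r)) =
        (PMF.uniformOfFintype (Ω × R)).bind H := by
    intro H
    ext a
    simp only [PMF.bind_apply, PMF.uniformOfFintype_apply, tsum_fintype, Fintype.sum_prod_type,
      Fintype.card_prod, Finset.mul_sum]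
    refine Finset.sum_congr rfl fun ω _ => Finset.sum_congr rfl fun r _ => ?_
    rw [← mul_assoc, Nat.cast_mul, ENNReal.mul_inv (Or.inr (ENNReal.natCast_ne_top _))
      (Or.inl (ENNReal.natCast_ne_top _))]
  have h1 := key fun p => F (e p).1
  have h2 := key fun p => F p.1
  simp only [PMF.bind_const] at h2
  rw [h1, h2]
  ext a
  simp only [PMF.bind_apply, PMF.uniformOfFintype_apply, tsum_fintype]
  exact Equiv.sum_comp e fun p => ((Fintype.card (Ω × R) : ENNReal))⁻¹ * F p.1 a

section
variable {n K : ℕ}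

/-- Random numbers of the vertices in all slots. -/
abbrev Draws (n K : ℕ) := Fin K → Fin n → Fin (n * n)

instance [NeZero n] : NeZero (n * n) := ⟨mul_ne_zero (NeZero.ne n) (NeZero.ne n)⟩

/-- Principle of deferred decisions. Exchanging an entry of the table with the fresh number is an
involution, so the redrawn table is again uniform. -/
theorem bind_update_draws [NeZero n] {α : Type*} (i : Fin K) (x : Fin n)
    (F : Draws n K → PMF α) :
    ((PMF.uniformOfFintype (Draws n K)).bind fun ω =>
      (PMF.uniformOfFintype (Fin (n * n))).bind fun r =>
        F (Function.update ω i (Function.update (ω i) x r))) =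
      (PMF.uniformOfFintype (Draws n K)).bind F := by
  have hinv : Function.Involutive fun p : Draws n K × Fin (n * n) =>
      (Function.update p.1 i (Function.update (p.1 i) x p.2), p.1 i x) := by
    rintro ⟨ω, r⟩
    simp
  exact bind_uniform_equiv hinv.toPerm F

theorem bind_drawOne [NeZero n] {α : Type*} (i : Fin K) (π : List (Item n)) (x : Fin n)
    (F : Draws n K → PMF α) :
    ((PMF.uniformOfFintype (Draws n K)).bind fun ω =>
      (PMF.uniformOfFintype (Fin (n * n))).bind fun r =>
        F (Function.update ω i (drawOne (ω i) π x r))) =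
      (PMF.uniformOfFintype (Draws n K)).bind F := by
  by_cases h : Seen π x
  · simp only [drawOne, if_pos h, Function.update_eq_self, PMF.bind_const]
  · simp only [drawOne, if_neg h]
    exact bind_update_draws i x F

theorem bind_drawBoth [NeZero n] {α : Type*} (i : Fin K) (π : List (Item n)) (z : Item n)
    (F : Draws n K → PMF α) :
    ((PMF.uniformOfFintype (Draws n K)).bind fun ω =>
      (PMF.uniformOfFintype (Fin (n * n))).bind fun r =>
        (PMF.uniformOfFintype (Fin (n * n))).bind fun r' =>
          F (Function.update ω i (drawBoth (ω i) π z r r'))) =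
      (PMF.uniformOfFintype (Draws n K)).bind F := by
  have h := bind_drawOne i π z.fst fun ω => (PMF.uniformOfFintype (Fin (n * n))).bind fun r' =>
    F (Function.update ω i (drawOne (ω i) π z.snd r'))
  rw [bind_drawOne] at h
  rw [← h]
  simp only [Function.update_self, Function.update_idem, drawBoth]

/-- The table after the edges in `π` have been processed, and also the edge `z` in the first `i`
slots. -/
noncomputable def table (ω : Draws n K) (π : List (Item n)) (z : Item n) (i : ℕ) :
    ℕ → ℕ → ℕ :=
  fun row j => if h : j < K then column (ω ⟨j, h⟩) (if j < i then π ++ [z] else π) row else 0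

/-- The table after the edges in `π` have been processed. -/
noncomputable def fullTable (ω : Draws n K) (π : List (Item n)) : ℕ → ℕ → ℕ :=
  fun row j => if h : j < K then column (ω ⟨j, h⟩) π row else 0

theorem table_zero (ω : Draws n K) (π : List (Item n)) (z : Item n) :
    table ω π z 0 = fullTable ω π := by
  funext row j
  simp [table, fullTable]

theorem table_last (ω : Draws n K) (π : List (Item n)) (z : Item n) :
    table ω π z K = fullTable ω (π ++ [z]) := by
  funext row j
  rw [table, fullTable]
  split_ifs <;> rfl

theorem table_lt (hn : 0 < n) (ω : Draws n K) (π : List (Item n)) (z : Item n) (i row j : ℕ) :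
    table ω π z i row j < n * n * n + n := by
  rw [table]
  split_ifs
  · exact column_lt hn _ _ _
  · exact column_lt hn _ _ _
  · omega

theorem slotUpdate_table {z : Item n} (hz : z.fst ≠ z.snd) (ω : Draws n K) (π : List (Item n))
    (i : Fin K) (r r' : Fin (n * n)) :
    slotUpdate n z.fst z.snd z.plus i r r' (table ω π z i) =
      table (Function.update ω i (drawBoth (ω i) π z r r')) π z (i + 1) := by
  funext row j
  by_cases hj : j = i
  · subst hj
    rw [slotUpdate_column (f := ω i) (π := π) hz]
    · simp [table]
    · intro row
      simp [table]
  · rw [slotUpdate_apply z.fst.2 z.snd.2 (fun h => hz (Fin.ext h)), if_neg hj, table, table]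
    by_cases hK : j < K
    · have h1 : (⟨j, hK⟩ : Fin K) ≠ i := fun h => hj (by rw [← h])
      have h2 : j < i ↔ j < i + 1 := by omega
      rw [dif_pos hK, dif_pos hK, Function.update_of_ne h1]
      simp only [h2]
    · rw [dif_neg hK, dif_neg hK]

/-- This holds only on average over the table: for fixed `ω` the machine draws fresh numbers, and
`bind_drawBoth` absorbs them into `ω`. -/
theorem runsOn_slotBody [NeZero n] {M : ℕ} (hM : LargeWords n K M) {z : Item n}
    (hz : z.fst ≠ z.snd) (π : List (Item n)) {i : ℕ} (hi : i < K) :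
    RunsOn (PMF.uniformOfFintype (Draws n K)) M slotBody
      (fun ω => slotState n K z.fst z.snd z.plus i (table ω π z i)) 45
      (fun ω => slotState n K z.fst z.snd z.plus (i + 1) (table ω π z (i + 1))) := by
  intro k T
  have h := fun ω : Draws n K => runs_slotBody (plus := z.plus) hM z.fst.2 z.snd.2 hi
    (table_lt z.fst.pos ω π z i) k T
  simp only [h, PMF.bind_bind, PMF.pure_bind]
  have h2 := fun ω r r' => slotUpdate_table hz ω π ⟨i, hi⟩ r r'
  simp only at h2
  simp only [h2]
  exact bind_drawBoth ⟨i, hi⟩ π z fun ω =>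
    steps M T ⟨k, slotState n K z.fst z.snd z.plus (i + 1) (table ω π z (i + 1))⟩

theorem runsOn_slotLoop [NeZero n] {M : ℕ} (hM : LargeWords n K M) {z : Item n}
    (hz : z.fst ≠ z.snd) (π : List (Item n)) :
    RunsOn (PMF.uniformOfFintype (Draws n K)) M (forLoop 5 4 slotBody)
      (fun ω => slotState n K z.fst z.snd z.plus 0 (fullTable ω π)) (K * (45 + 1) + 1)
      (fun ω => slotState n K z.fst z.snd z.plus K (fullTable ω (π ++ [z]))) := by
  have := RunsOn.forLoop (U := PMF.uniformOfFintype (Draws n K)) hM.basic.1 (i := 5) (b := 4)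
    (N := K) (t := 45) (p := slotBody)
    (fun i ω => slotState n K z.fst z.snd z.plus i (table ω π z i)) (fun _ _ => ⟨rfl, rfl⟩)
    fun i hi => runsOn_slotBody hM hz π hi
  simpa only [table_zero, table_last] using this

end

/-! ## Computing the number of slots -/

/-- Put `⌈log₂ n⌉` into register `4`. -/
def logLoop : Cmd :=
  .loop (.bin .lt (.reg 5) (.reg 0))
    (.block [.assign 5 (.reg 5 + .reg 5), .assign 4 (.reg 4 + .const 1)])

/-- Put the number of slots into register `4` and access the last memory cell. -/
def setup (c : ℕ) : Cmd :=
  .seq (.block [.assign 5 (.const 1)]) (.seq logLoop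
    (.block [.assign 4 (.const c * .reg 4),
      .load 6 (.const 2 * .reg 0 + .const 2 * .reg 0 * .reg 4 - .const 1),
      .assign 6 (.const 0), .assign 5 (.const 0)]))

theorem runs_logLoop {n M : ℕ} (hn : 2 ≤ n) (hM : 2 * n < M) (hL : Nat.clog 2 n < M)
    (a b c : ℕ) (m : ℕ → ℕ) (P : ℕ) :
    ∃ x, Runs M logLoop ⟨regsOf [n, a, b, c, 0, 1, 0, 0, 0, 0, 0], m, P⟩
      (Nat.clog 2 n * (5 + 1) + 1)
      (PMF.pure ⟨regsOf [n, a, b, c, Nat.clog 2 n, x, 0, 0, 0, 0, 0], m, P⟩) := by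
  have hpow : ∀ j, j < Nat.clog 2 n → 2 ^ j < n := fun j => Nat.pow_lt_of_lt_clog
  refine ⟨2 ^ Nat.clog 2 n, runs_iff_runsOn.2 ?_⟩
  -- After `j` rounds register `4` holds `j` and register `5` holds `2 ^ j`; the loop ends once this
  -- power reaches `n`.
  refine RunsOn.loop
    (fun j _ => ⟨regsOf [n, a, b, c, j, 2 ^ j, 0, 0, 0, 0, 0], m, P⟩) ?_ ?_
  · intro j hj _
    rw [eval_lt_regs (by omega)]
    simp only [regsOf, List.getD_cons_succ, List.getD_cons_zero]
    have h1 : n ≤ 2 ^ j ↔ Nat.clog 2 n ≤ j := (Nat.clog_le_iff_le_pow one_lt_two).symm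
    split_ifs with h
    · have : ¬ Nat.clog 2 n ≤ j := fun h' => absurd (h1.2 h') (by omega)
      simp only [false_iff]
      omega
    · have := h1.1 (by omega)
      simp only [true_iff]
      omega
  · intro j hj
    rw [← runs_iff_runsOn]
    have := hpow j hj
    rw [show 5 = 1 + 1 + (1 + 1 + 1) by rfl]
    refine runs_assign (x := 2 ^ (j + 1)) (by simp)
      (by simp [Expr.Fits, Expr.val, BinOp.eval, regsOf]; omega)
      (by simp [Expr.val, BinOp.eval, regsOf]; ring) ?_
    refine runs_assign (x := j + 1) (by simp)
      (by simp [Expr.Fits, Expr.val, BinOp.eval, regsOf]; omega)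
      (by simp [Expr.val, BinOp.eval, regsOf]) ?_
    exact runs_block_nil

theorem runs_setup {n K c M : ℕ} (hM : LargeWords n K M) (hK : K = c * Nat.clog 2 n)
    (a b d : ℕ) (m : ℕ → ℕ) {p : ℕ} (hp : p ≤ memorySize n K) :
    Runs M (setup c) ⟨regsOf [n, a, b, d, 0, 0, 0, 0, 0, 0, 0], m, p⟩
      (1 + 3 + (1 + (Nat.clog 2 n * (5 + 1) + 1) + 9))
      (PMF.pure ⟨regsOf [n, a, b, d, K, 0, 0, 0, 0, 0, 0], m, memorySize n K⟩) := by
  obtain ⟨h1, h2, h3, h4, h5, -, h6⟩ := hM.basic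
  have hn := hM.two_le
  have hKpos := hM.pos
  have hL : 0 < Nat.clog 2 n := Nat.clog_pos one_lt_two hn
  have hc : 0 < c := Nat.pos_of_ne_zero fun h => by rw [h, zero_mul] at hK; omega
  have hLK : Nat.clog 2 n ≤ K := hK ▸ Nat.le_mul_of_pos_left _ hc
  have hcK : c ≤ K := hK ▸ Nat.le_mul_of_pos_right _ hL
  obtain ⟨x, hx⟩ := runs_logLoop hn h4 (by omega) a b d m p
  refine runs_seq (s₁ := ⟨regsOf [n, a, b, d, 0, 1, 0, 0, 0, 0, 0], m, p⟩) ?_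
    (runs_seq hx ?_)
  · rw [show 3 = 1 + 1 + 1 by rfl]
    refine runs_assign (x := 1) (by simp) (by simpa [Expr.Fits] using h1) rfl ?_
    exact runs_block_nil
  · rw [show 9 = 1 + 1 + (1 + 1 + (1 + 1 + (1 + 1 + 1))) by rfl]
    refine runs_assign (x := K) (by simp) ?_ (by rw [hK]; rfl) ?_
    · simp [Expr.Fits, Expr.val, BinOp.eval, regsOf]
      rw [← hK]
      omega
    -- This read of the last cell raises `peak` to its final value, so later accesses leave it
    -- unchanged and the space need not be tracked.
    refine runs_load_peak (a := 2 * n + 2 * n * K - 1) (x := m (2 * n + 2 * n * K - 1)) (by simp)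
      ?_ rfl ?_ rfl ?_ (Q := memorySize n K)
    · simp [Expr.Fits, Expr.val, BinOp.eval, regsOf, Expr.sub_def, Expr.add_def, Expr.mul_def]
      omega
    · rw [memorySize] at hp ⊢
      omega
    refine runs_assign (x := 0) (by simp) (by simp [Expr.Fits]; omega) rfl ?_
    refine runs_assign (x := 0) (by simp) (by simp [Expr.Fits]; omega) rfl ?_
    exact runs_block_nil

/-! ## Reading the stream -/

/-- The program that is run for each stream element. -/
def updateProgram (c : ℕ) : Cmd :=
  .seq (setup c) (.seq (forLoop 5 4 slotBody)
    (.block [.assign 1 (.const 0), .assign 2 (.const 0), .assign 3 (.const 0),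
      .assign 4 (.const 0), .assign 5 (.const 0)]))

section
variable {n K c M : ℕ}

/-- State of the machine between stream elements. -/
noncomputable def tableState (π : List (Item n)) (p : ℕ) (ω : Draws n K) : State :=
  ⟨regsOf [n, 0, 0, 0, 0, 0, 0, 0, 0, 0, 0],
    memory n K (fun _ => 0) (fun _ => 0) (fullTable ω π), p⟩

/-- Running time of the update program. -/
def updateSteps (n K : ℕ) : ℕ :=
  1 + (1 + 3 + (1 + (Nat.clog 2 n * (5 + 1) + 1) + 9)) + (1 + (K * (45 + 1) + 1) + 11)

theorem receive_tableState (hM : LargeWords n K M) (π : List (Item n)) (p : ℕ) (ω : Draws n K)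
    (z : Item n) : (tableState π p ω).receive M z =
      ⟨regsOf [n, z.fst, z.snd, if z.plus then 1 else 0, 0, 0, 0, 0, 0, 0, 0],
        memory n K (fun _ => 0) (fun _ => 0) (fullTable ω π), p⟩ := by
  obtain ⟨h1, -, h3, -⟩ := hM.basic
  have e1 : (z.fst : ℕ) % M = z.fst := Nat.mod_eq_of_lt (z.fst.2.trans h3)
  have e2 : (z.snd : ℕ) % M = z.snd := Nat.mod_eq_of_lt (z.snd.2.trans h3)
  have e3 : (if z.plus then 1 else 0) % M = if z.plus then 1 else 0 :=
    Nat.mod_eq_of_lt (by split_ifs <;> omega)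
  simp only [State.receive, State.setReg, tableState, e1, e2, e3]
  rw [update_regsOf _ (by simp), update_regsOf _ (by simp), update_regsOf _ (by simp)]
  rfl

theorem runsOn_updateProgram [NeZero n] (hM : LargeWords n K M) (hK : K = c * Nat.clog 2 n)
    {z : Item n} (hz : z.fst ≠ z.snd) (π : List (Item n)) {p : ℕ} (hp : p ≤ memorySize n K) :
    RunsOn (PMF.uniformOfFintype (Draws n K)) M (updateProgram c)
      (fun ω => (tableState π p ω).receive M z) (updateSteps n K)
      (tableState (π ++ [z]) (memorySize n K)) := by
  have h0 : 0 < M := by have := hM.basic.1; omega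
  refine RunsOn.seq (RunsOn.of_runs fun ω => ?_) ((runsOn_slotLoop hM hz π).seq
    (RunsOn.of_runs fun ω => ?_))
  · rw [receive_tableState hM]
    exact runs_setup hM hK _ _ _ _ hp
  · rw [show 11 = 1 + 1 + (1 + 1 + (1 + 1 + (1 + 1 + (1 + 1 + 1)))) by rfl]
    iterate 5 refine runs_assign (x := 0) (by simp) (by simpa [Expr.Fits] using h0) rfl ?_
    exact runs_block_nil

/-- Induction along the stream with the processed prefix `π` as parameter. The peak `p` is free
because it is 0 before the first element and `memorySize n K` afterwards. -/
theorem bind_pass [NeZero n] {B : Budget} {post : Cmd} (hM : LargeWords n K (2 ^ B.wordBits))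
    (hK : K = c * Nat.clog 2 n) (hT : updateSteps n K ≤ B.updateTime)
    (hS : memorySize n K ≤ B.space) (σ : List (Item n)) (hσ : ∀ z ∈ σ, z.fst ≠ z.snd)
    (π : List (Item n)) {p : ℕ} (hp : p ≤ memorySize n K) :
    ((PMF.uniformOfFintype (Draws n K)).bind fun ω =>
      StreamAlg.pass ⟨updateProgram c, post⟩ B σ (tableState π p ω)) =
    (PMF.uniformOfFintype (Draws n K)).map fun ω =>
      some (tableState (π ++ σ) (if σ = [] then p else memorySize n K) ω) := by
  induction σ generalizing π p with
  | nil =>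
    simp only [StreamAlg.pass, List.append_nil, if_true]
    rfl
  | cons z σ ih =>
    simp only [StreamAlg.pass]
    rw [← PMF.bind_bind, (runsOn_updateProgram hM hK (hσ z (by simp)) π hp).exec hT
      (fun ω => hS), PMF.bind_map]
    have := ih (fun y hy => hσ y (by simp [hy])) (π ++ [z]) le_rfl
    simp only [ite_self, List.append_assoc, List.singleton_append] at this
    simp only [reduceCtorEq, if_false]
    exact this

/-- Nothing has been seen, so every table gives the same zero memory; this lets the uniform table
enter before anything is drawn. -/
theorem startState_eq (hM : LargeWords n K M) (ω : Draws n K) :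
    startState M n = tableState [] 0 ω := by
  have hn : n % M = n := Nat.mod_eq_of_lt hM.basic.2.2.1
  rw [startState, hn, State.setReg, State.zero, tableState]
  congr 1
  · funext i
    rcases i with _ | i
    · rfl
    · rw [Function.update_of_ne (by simp)]
      simp only [regsOf, List.getD_cons_succ]
      match i with
      | 0 | 1 | 2 | 3 | 4 | 5 | 6 | 7 | 8 | 9 => rfl
      | i + 10 => rfl
  · funext a
    rw [memory]
    have h : ∀ row j, fullTable ω [] row j = 0 := by
      intro row j
      simp [fullTable, column, Seen, seenNbhd, Linked]
    simp only [h, ite_self]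

theorem pass_eq [NeZero n] {B : Budget} {post : Cmd} (hM : LargeWords n K (2 ^ B.wordBits))
    (hK : K = c * Nat.clog 2 n) (hT : updateSteps n K ≤ B.updateTime)
    (hS : memorySize n K ≤ B.space) {σ : List (Item n)} (hσ : ∀ z ∈ σ, z.fst ≠ z.snd)
    (hne : σ ≠ []) :
    StreamAlg.pass ⟨updateProgram c, post⟩ B σ (startState (2 ^ B.wordBits) n) =
      (PMF.uniformOfFintype (Draws n K)).map fun ω =>
        some (tableState σ (memorySize n K) ω) := by
  have := bind_pass (post := post) hM hK hT hS σ hσ [] (Nat.zero_le _)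
  simp only [← startState_eq hM, PMF.bind_const, List.nil_append, hne, if_false] at this
  exact this

end

/-! ### Verification of the post-processing program. -/

/-! ## The post-processing program -/

theorem runs_cons {M t₁ t : ℕ} {c : Cmd} {cs : List Cmd} {s s₁ s₂ : State}
    (h₁ : Runs M c s t₁ (PMF.pure s₁)) (h : Runs M (Cmd.block cs) s₁ t (PMF.pure s₂)) :
    Runs M (Cmd.block (c :: cs)) s (1 + t₁ + t) (PMF.pure s₂) := runs_seq h₁ h

/-- `1` if register `d` exceeds an eighth of the number of slots, and `0` otherwise. -/
def manyExpr (d : ℕ) : Expr := .bin .lt (.reg 4 / .const 8) (.reg d)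

/-- Row of the largest keys for the vertex in register `d`. -/
def cellRow (d : ℕ) : Expr := .reg 0 + .reg d

/-- Count in register `3` the slots in which the vertices in the registers `1` and `2` differ. -/
def diffBody : Cmd :=
  .block [.load 8 (slotAddr (cellRow 1) 5), .load 9 (slotAddr (cellRow 2) 5),
    .assign 3 (.reg 3 + (.const 1 - .bin .eq (.reg 8) (.reg 9))), .assign 5 (.reg 5 + .const 1),
    .assign 8 (.const 0), .assign 9 (.const 0)]

/-- Replace the key in the slot given by the registers `1` and `6` by the address of the leader of
the vertex in the slot, or by `0` if the slot is bad. Count the bad slots in register `7`. -/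
def pointerBody : Cmd :=
  .block [.load 2 (slotAddr (cellRow 1) 6), .assign 2 (.reg 2 % .reg 0), forLoop 5 4 diffBody,
    .assign 3 (manyExpr 3), .assign 7 (.reg 7 + .reg 3),
    .store (slotAddr (.reg 1) 6) ((.reg 0 + .reg 2) * (.const 1 - .reg 3)),
    .assign 6 (.reg 6 + .const 1), .assign 2 (.const 0), .assign 3 (.const 0),
    .assign 5 (.const 0)]

/-- Do this for all slots of the vertex in register `1`, and output the number of bad slots. -/
def pointerRow : Cmd :=
  .block [forLoop 6 4 pointerBody, .store (.reg 1) (.reg 7), .assign 1 (.reg 1 + .const 1),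
    .assign 6 (.const 0), .assign 7 (.const 0)]

/-- The vertex in register `1` becomes the leader of the vertex in the slot given by register `6`
if it is dense and the slot is good. -/
def leaderBody : Cmd :=
  .block [.load 2 (slotAddr (.reg 1) 6),
    .cond (.reg 2 * (.const 1 - manyExpr 7)) (.store (.reg 2) (.reg 1 + .const 1)) .skip,
    .assign 6 (.reg 6 + .const 1), .assign 2 (.const 0)]

/-- Do this for all slots. -/
def leaderRow : Cmd :=
  .block [.load 7 (.reg 1), forLoop 6 4 leaderBody, .assign 1 (.reg 1 + .const 1),
    .assign 6 (.const 0), .assign 7 (.const 0)]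

/-- Find in register `3` the largest leader in the good slots of the vertex in register `1`. -/
def labelBody : Cmd :=
  .block [.load 2 (slotAddr (.reg 1) 6), .load 8 (.reg 2),
    .assign 8 (.bin .lt (.const 0) (.reg 2) * .reg 8), .assign 3 (maxExpr 3 8),
    .assign 6 (.reg 6 + .const 1), .assign 2 (.const 0), .assign 8 (.const 0)]

/-- Output the name of the cluster of the vertex in register `1`. -/
def labelRow : Cmd :=
  .block [.load 7 (.reg 1), forLoop 6 4 labelBody, .assign 7 (manyExpr 7),
    .store (.reg 1) (.reg 3 * (.const 1 - .reg 7) + .reg 7 * (.reg 0 + .const 1 + .reg 1)),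
    .assign 1 (.reg 1 + .const 1), .assign 3 (.const 0), .assign 6 (.const 0),
    .assign 7 (.const 0)]

/-- The program that is run at the end of the stream. -/
def postProgram (c : ℕ) : Cmd :=
  .seq (setup c) (.block [forLoop 1 0 pointerRow, .assign 1 (.const 0), forLoop 1 0 leaderRow,
    .assign 1 (.const 0), forLoop 1 0 labelRow])

section
variable (n K : ℕ) (X : ℕ → ℕ → ℕ)

/-- The vertex in the slot `i` of `v`. -/
def slotVertex (v i : ℕ) : ℕ := X (n + v) i % n

/-- Number of slots among the first `j` in which `u` and `w` differ. -/
def slotDiff (u w j : ℕ) : ℕ := Nat.count (fun i => X (n + u) i ≠ X (n + w) i) j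

/-- The vertex in the slot `i` of `v` differs from `v` in many slots. -/
abbrev BadSlot (v i : ℕ) : Prop := K / 8 < slotDiff n X v (slotVertex n X v i) K

/-- Number of bad slots of `v` among the first `i`. -/
def badCount (v i : ℕ) : ℕ := Nat.count (BadSlot n K X v) i

/-- Address of the leader of the vertex in the slot `i` of `v`, or `0` if the slot is bad. -/
def pointer (v i : ℕ) : ℕ := if BadSlot n K X v i then 0 else n + slotVertex n X v i

/-- The table with pointers in all slots before the slot `i` of `u`. -/
def pointers (u i : ℕ) : ℕ → ℕ → ℕ :=
  fun r j => if r < u ∨ (r = u ∧ j < i) then pointer n K X r j else X r j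

/-- The vertex `v` has few bad slots. -/
abbrev FewBad (v : ℕ) : Prop := badCount n K X v K ≤ K / 8

/-- The leaders after the first `i` slots of `u` have been processed. -/
def leadersRow (u : ℕ) (l : ℕ → ℕ) : ℕ → ℕ → ℕ
  | 0 => l
  | i + 1 => if FewBad n K X u ∧ ¬ BadSlot n K X u i then
      Function.update (leadersRow u l i) (slotVertex n X u i) (u + 1) else leadersRow u l i

/-- The leaders after the first `u` vertices have been processed. -/
def leaders : ℕ → ℕ → ℕ
  | 0 => fun _ => 0
  | u + 1 => leadersRow n K X u (leaders u) K

/-- Largest leader in the first `i` slots of `v`. -/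
def maxLeader (v i : ℕ) : ℕ :=
  (Finset.range i).sup fun j => if BadSlot n K X v j then 0
    else leaders n K X n (slotVertex n X v j)

/-- Name of the cluster of `v`. -/
def clusterName (v : ℕ) : ℕ :=
  if FewBad n K X v then maxLeader n K X v K else n + 1 + v

end

section
variable {n K M : ℕ} {X : ℕ → ℕ → ℕ} {o l : ℕ → ℕ}

theorem memory_out {v : ℕ} (hv : v < n) : memory n K o l X v = o v := if_pos hv

theorem update_memory_out {v : ℕ} (hv : v < n) (x : ℕ) :
    Function.update (memory n K o l X) v x = memory n K (Function.update o v x) l X := by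
  funext a
  by_cases ha : a = v
  · subst ha
    rw [Function.update_self, memory_out hv, Function.update_self]
  · rw [Function.update_of_ne ha, memory, memory, Function.update_of_ne ha]

theorem memory_leader {v : ℕ} (hv : v < n) : memory n K o l X (n + v) = l v := by
  rw [memory, if_neg (by omega), if_pos (by omega), Nat.add_sub_cancel_left]

theorem update_memory_leader {v : ℕ} (hv : v < n) (x : ℕ) :
    Function.update (memory n K o l X) (n + v) x = memory n K o (Function.update l v x) X := by
  funext a
  by_cases ha : a = n + v
  · subst ha
    rw [Function.update_self, memory_leader hv, Function.update_self]
  · rw [Function.update_of_ne ha, memory, memory]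
    split_ifs with h1 h2 h3
    · rfl
    · rw [Function.update_of_ne (by omega)]
    · rfl
    · rfl

theorem LargeWords.post (hM : LargeWords n K M) :
    4 * n < M ∧ 8 < M ∧ 2 * n < memorySize n K ∧ n < memorySize n K := by
  have h1 := hM.two_le
  have h2 := hM.pos
  have h3 := hM.space
  have h4 := hM.keys
  have h5 : 4 ≤ n * n := Nat.mul_le_mul h1 h1
  have h6 : 4 * n ≤ n * n * n := Nat.mul_le_mul_right _ h5
  have h7 : n ≤ n * K := Nat.le_mul_of_pos_right _ h2
  have h8 : 2 * n * K = 2 * (n * K) := by ring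
  rw [memorySize] at h3 ⊢
  refine ⟨?_, ?_, ?_, ?_⟩ <;> omega

theorem slotVertex_lt (hn : 0 < n) (v i : ℕ) : slotVertex n X v i < n := Nat.mod_lt _ hn

theorem slotDiff_le (u w j : ℕ) : slotDiff n X u w j ≤ j := Nat.count_le _

theorem badCount_le (v i : ℕ) : badCount n K X v i ≤ i := Nat.count_le _

/-- State of the machine during post-processing. -/
def postState (n K u w d j i b : ℕ) (o l : ℕ → ℕ) (X : ℕ → ℕ → ℕ) : State :=
  ⟨regsOf [n, u, w, d, K, j, i, b, 0, 0, 0], memory n K o l X, memorySize n K⟩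

theorem manyExpr_val {d : ℕ} {f : ℕ → ℕ} (h4 : f 4 = K) :
    (manyExpr d).val f = if K / 8 < f d then 1 else 0 := by
  simp [manyExpr, Expr.val, BinOp.eval, Expr.div_def, h4]

theorem manyExpr_fits (hM : LargeWords n K M) {d : ℕ} {f : ℕ → ℕ} (h4 : f 4 = K) :
    (manyExpr d).Fits M f := by
  obtain ⟨h1, -, -, -, h5, -⟩ := hM.basic
  have h8 := hM.post.2.1
  simp only [manyExpr, Expr.Fits, Expr.val, BinOp.eval, Expr.div_def, h4, true_and]
  split_ifs <;> omega

theorem cellRow_fits (hM : LargeWords n K M) {d u : ℕ} {f : ℕ → ℕ} (h0 : f 0 = n) (hu : f d = u)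
    (hun : u < n) : (cellRow d).Fits M f := by
  have := hM.post.1
  simp only [cellRow, Expr.Fits, Expr.val, BinOp.eval, Expr.add_def, h0, hu, true_and]
  omega

theorem cellRow_val {d u : ℕ} {f : ℕ → ℕ} (h0 : f 0 = n) (hu : f d = u) :
    (cellRow d).val f = n + u := by
  simp only [cellRow, Expr.val, BinOp.eval, Expr.add_def, h0, hu]

theorem runs_diffBody (hM : LargeWords n K M) {u w i b j : ℕ} (hu : u < n) (hw : w < n)
    (hj : j < K) :
    Runs M diffBody (postState n K u w (slotDiff n X u w j) j i b o l X) 13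
      (PMF.pure (postState n K u w (slotDiff n X u w (j + 1)) (j + 1) i b o l X)) := by
  obtain ⟨h1, h2, -, -, h5, -⟩ := hM.basic
  have h0 : 0 < M := by omega
  have hnu : n + u < 2 * n := by omega
  have hnw : n + w < 2 * n := by omega
  have hd := slotDiff_le (n := n) (X := X) u w j
  have e : ∀ x y : ℕ, 1 - (if x = y then 1 else 0) = if x ≠ y then 1 else 0 := by
    intro x y
    by_cases h : x = y <;> simp [h]
  rw [show 13 = 1 + 1 + (1 + 1 + (1 + 1 + (1 + 1 + (1 + 1 + (1 + 1 + 1))))) by rfl]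
  refine runs_load (x := X (n + u) j) (by simp)
    (slotAddr_fits hM rfl rfl rfl hnu hj (cellRow_fits hM rfl rfl hu) (cellRow_val rfl rfl))
    (slotAddr_val rfl rfl rfl (cellRow_val rfl rfl)) (slot_lt hnu hj) (memory_slot hnu hj) ?_
  refine runs_load (x := X (n + w) j) (by simp)
    (slotAddr_fits hM rfl rfl rfl hnw hj (cellRow_fits hM rfl rfl hw) (cellRow_val rfl rfl))
    (slotAddr_val rfl rfl rfl (cellRow_val rfl rfl)) (slot_lt hnw hj) (memory_slot hnw hj) ?_
  refine runs_assign (x := slotDiff n X u w (j + 1)) (by simp) ?_ ?_ ?_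
  · simp [Expr.Fits, Expr.val, BinOp.eval, Expr.sub_def, regsOf]
    split_ifs <;> omega
  · exact (congrArg _ (e _ _)).trans
      (Nat.count_succ (fun i => X (n + u) i ≠ X (n + w) i) j).symm
  refine runs_assign (x := j + 1) (by simp)
    (by simp [Expr.Fits, Expr.val, BinOp.eval, regsOf]; omega) rfl ?_
  iterate 2 refine runs_assign (x := 0) (by simp) (by simpa [Expr.Fits] using h0) rfl ?_
  exact runs_block_nil

theorem runs_diffLoop (hM : LargeWords n K M) {u w i b : ℕ} (hu : u < n) (hw : w < n) :
    Runs M (forLoop 5 4 diffBody) (postState n K u w 0 0 i b o l X) (K * (13 + 1) + 1)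
      (PMF.pure (postState n K u w (slotDiff n X u w K) K i b o l X)) :=
  Runs.forLoop hM.basic.1 (fun j => postState n K u w (slotDiff n X u w j) j i b o l X)
    (fun _ => ⟨rfl, rfl⟩) fun _ hj => runs_diffBody hM hu hw hj

/-- Pointers replace the vertex keys, which are no longer needed; sketches are compared in the rows
from `n` on, which stay intact. -/
theorem pointers_cell {u i v j : ℕ} (hu : u < n) :
    pointers n K X u i (n + v) j = X (n + v) j := by
  rw [pointers, if_neg]
  omega

theorem slotDiff_pointers {u i v w j : ℕ} (hu : u < n) :
    slotDiff n (pointers n K X u i) v w j = slotDiff n X v w j := by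
  simp only [slotDiff, pointers_cell hu]

theorem updateEntry_pointers (u i : ℕ) :
    updateEntry (pointers n K X u i) u i (pointer n K X u i) = pointers n K X u (i + 1) := by
  funext r j
  rw [updateEntry, pointers, pointers]
  by_cases hr : r = u
  · subst hr
    by_cases hj : j = i
    · subst hj
      simp
    · have : j < i ↔ j < i + 1 := by omega
      simp [hj, this]
  · simp [hr]

theorem runs_pointerBody (hM : LargeWords n K M) {u i : ℕ} (hu : u < n) (hi : i < K) :
    Runs M pointerBody
      (postState n K u 0 0 0 i (badCount n K X u i) o l (pointers n K X u i))
      (2 + (2 + ((1 + (K * (13 + 1) + 1)) + 15)))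
      (PMF.pure (postState n K u 0 0 0 (i + 1) (badCount n K X u (i + 1)) o l
        (pointers n K X u (i + 1)))) := by
  obtain ⟨h1, h2, h3, h4, h5, -⟩ := hM.basic
  have h0 : 0 < M := by omega
  have h4n := hM.post.1
  have hn : 0 < n := by omega
  have hnu : n + u < 2 * n := by omega
  have hu2 : u < 2 * n := by omega
  have hb := badCount_le (n := n) (K := K) (X := X) u i
  have hw := slotVertex_lt (X := X) hn u i
  set w := slotVertex n X u i with hwdef
  refine runs_load (x := X (n + u) i) (by simp)
    (slotAddr_fits hM rfl rfl rfl hnu hi (cellRow_fits hM rfl rfl hu) (cellRow_val rfl rfl))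
    (slotAddr_val rfl rfl rfl (cellRow_val rfl rfl)) (slot_lt hnu hi)
    ((memory_slot hnu hi).trans (pointers_cell hu)) ?_
  refine runs_assign (x := w) (by simp) ?_ rfl ?_
  · simp only [Expr.Fits, Expr.val, BinOp.eval, true_and]
    exact hw.trans h3
  refine runs_cons (runs_diffLoop (i := i) (b := badCount n K X u i) hM hu hw) ?_
  rw [slotDiff_pointers hu]
  rw [show 15 = 1 + 1 + (1 + 1 + (1 + 1 + (1 + 1 + (1 + 1 + (1 + 1 + (1 + 1 + 1)))))) by rfl]
  set e : ℕ := if BadSlot n K X u i then 1 else 0 with he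
  have he1 : e ≤ 1 := by rw [he]; split_ifs <;> omega
  have hp : (n + w) * (1 - e) = pointer n K X u i := by
    rw [he, pointer]
    split_ifs <;> simp [hwdef]
  have hp2 : pointer n K X u i < 2 * n := by
    rw [pointer]
    split_ifs <;> omega
  refine runs_assign (x := e) (by simp) (manyExpr_fits hM rfl) (manyExpr_val rfl) ?_
  refine runs_assign (x := badCount n K X u (i + 1)) (by simp) ?_ ?_ ?_
  · simp [Expr.Fits, Expr.val, BinOp.eval, regsOf]
    omega
  · exact (Nat.count_succ (BadSlot n K X u) i).symm
  refine runs_store (a := 2 * n + (u * K + i)) (x := pointer n K X u i)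
    (slotAddr_fits hM rfl rfl rfl hu2 hi trivial rfl) (slotAddr_val rfl rfl rfl rfl)
    (slot_lt hu2 hi) ?_ hp ?_
  · simp [Expr.Fits, Expr.val, BinOp.eval, Expr.sub_def, regsOf, hp]
    omega
  rw [update_memory_slot hu2 hi, updateEntry_pointers]
  refine runs_assign (x := i + 1) (by simp)
    (by simp [Expr.Fits, Expr.val, BinOp.eval, regsOf]; omega) rfl ?_
  iterate 3 refine runs_assign (x := 0) (by simp) (by simpa [Expr.Fits] using h0) rfl ?_
  exact runs_block_nil

theorem runs_pointerLoop (hM : LargeWords n K M) {u : ℕ} (hu : u < n) :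
    Runs M (forLoop 6 4 pointerBody) (postState n K u 0 0 0 0 0 o l (pointers n K X u 0))
      (K * ((2 + (2 + ((1 + (K * (13 + 1) + 1)) + 15))) + 1) + 1)
      (PMF.pure (postState n K u 0 0 0 K (badCount n K X u K) o l (pointers n K X u K))) :=
  Runs.forLoop hM.basic.1 (fun i => postState n K u 0 0 0 i (badCount n K X u i) o l
    (pointers n K X u i)) (fun _ => ⟨rfl, rfl⟩) fun _ hi => runs_pointerBody hM hu hi

/-- State of the machine before `pointerRow`. -/
def pointerState (n K : ℕ) (X : ℕ → ℕ → ℕ) (u : ℕ) : State :=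
  postState n K u 0 0 0 0 0 (fun v => if v < u then badCount n K X v K else 0) (fun _ => 0)
    (pointers n K X u 0)

theorem runs_pointerRow (hM : LargeWords n K M) {u : ℕ} (hu : u < n) :
    Runs M pointerRow (pointerState n K X u)
      ((1 + (K * ((2 + (2 + ((1 + (K * (13 + 1) + 1)) + 15))) + 1) + 1)) + 9)
      (PMF.pure (pointerState n K X (u + 1))) := by
  obtain ⟨h1, h2, h3, h4, h5, -⟩ := hM.basic
  have h0 : 0 < M := by omega
  refine runs_cons (runs_pointerLoop hM hu) ?_
  rw [show 9 = 1 + 1 + (1 + 1 + (1 + 1 + (1 + 1 + 1))) by rfl]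
  refine runs_store (a := u) (x := badCount n K X u K) trivial rfl (hu.trans hM.post.2.2.2)
    trivial rfl ?_
  rw [update_memory_out hu]
  -- Having finished row `u` is the same as being about to start row `u + 1`.
  have hmem : ∀ o' l', memory n K o' l' (pointers n K X u K) =
      memory n K o' l' (pointers n K X (u + 1) 0) := by
    intro o' l'
    refine memory_congr (fun _ _ => rfl) (fun _ _ => rfl) fun r _ j hj => ?_
    have : r < u ∨ (r = u ∧ j < K) ↔ r < u + 1 ∨ (r = u + 1 ∧ j < 0) := by omega
    simp only [pointers, this]
  have ho : Function.update (fun v => if v < u then badCount n K X v K else 0) u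
      (badCount n K X u K) = fun v => if v < u + 1 then badCount n K X v K else 0 := by
    funext v
    by_cases hv : v = u
    · subst hv
      simp
    · have : v < u ↔ v < u + 1 := by omega
      rw [Function.update_of_ne hv]
      simp only [this]
  rw [hmem, ho]
  refine runs_assign (x := u + 1) (by simp)
    (by simp [Expr.Fits, Expr.val, BinOp.eval, regsOf]; omega) rfl ?_
  iterate 2 refine runs_assign (x := 0) (by simp) (by simpa [Expr.Fits] using h0) rfl ?_
  exact runs_block_nil

theorem leadersRow_le {u : ℕ} {l : ℕ → ℕ} (hl : ∀ x, l x ≤ u + 1) (i x : ℕ) :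
    leadersRow n K X u l i x ≤ u + 1 := by
  induction i with
  | zero => exact hl x
  | succ i ih =>
    rw [leadersRow]
    split_ifs
    · by_cases hx : x = slotVertex n X u i
      · rw [hx, Function.update_self]
      · rwa [Function.update_of_ne hx]
    · exact ih

theorem leaders_le (u x : ℕ) : leaders n K X u x ≤ u := by
  induction u generalizing x with
  | zero => exact le_rfl
  | succ u ih => exact leadersRow_le (fun x => (ih x).trans (Nat.le_succ u)) K x

theorem pointers_last (u : ℕ) {v i : ℕ} (hv : v < n) :
    pointers n K X n u v i = pointer n K X v i := by
  rw [pointers, if_pos (Or.inl hv)]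

theorem pointer_lt (hn : 0 < n) (v i : ℕ) : pointer n K X v i < 2 * n := by
  have := slotVertex_lt (X := X) hn v i
  rw [pointer]
  split_ifs <;> omega

/-- The pointer serves as address and as flag: leader cells have addresses at least `n > 0`, so 0
can mark a bad slot. -/
theorem runs_leaderBody (hM : LargeWords n K M) {u i : ℕ} (hu : u < n) (hi : i < K) :
    Runs M leaderBody
      (postState n K u 0 0 0 i (badCount n K X u K) o (leadersRow n K X u l i)
        (pointers n K X n 0)) 10
      (PMF.pure (postState n K u 0 0 0 (i + 1) (badCount n K X u K) o
        (leadersRow n K X u l (i + 1)) (pointers n K X n 0))) := by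
  obtain ⟨h1, h2, h3, h4, h5, -⟩ := hM.basic
  have h0 : 0 < M := by omega
  have hn : 0 < n := by omega
  have hu2 : u < 2 * n := by omega
  have hw := slotVertex_lt (X := X) hn u i
  have hp := pointer_lt (K := K) (X := X) hn u i
  rw [show 10 = 1 + 1 + (1 + (1 + 1) + (1 + 1 + (1 + 1 + 1))) by rfl]
  refine runs_load (x := pointer n K X u i) (by simp)
    (slotAddr_fits hM rfl rfl rfl hu2 hi trivial rfl) (slotAddr_val rfl rfl rfl rfl)
    (slot_lt hu2 hi) ((memory_slot hu2 hi).trans (pointers_last 0 hu)) ?_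
  have hev : (Expr.reg 2 * (.const 1 - manyExpr 7)).eval M
      ⟨regsOf [n, u, pointer n K X u i, 0, K, 0, i, badCount n K X u K, 0, 0, 0],
        memory n K o (leadersRow n K X u l i) (pointers n K X n 0), memorySize n K⟩ =
      if FewBad n K X u ∧ ¬ BadSlot n K X u i then n + slotVertex n X u i else 0 := by
    rw [Expr.eval_eq_val]
    · simp only [Expr.sub_def, Expr.val, BinOp.eval]
      rw [manyExpr_val (K := K) rfl]
      simp only [regsOf, List.getD_cons_succ, List.getD_cons_zero, pointer]
      by_cases hb : BadSlot n K X u i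
      · simp [hb]
      · by_cases hf : FewBad n K X u
        · simp [hb, hf, not_lt.2 hf]
        · simp [hf, not_le.1 hf]
    · simp only [Expr.sub_def, Expr.Fits, Expr.val, BinOp.eval, true_and]
      rw [manyExpr_val (K := K) rfl]
      refine ⟨⟨h1, manyExpr_fits hM rfl, by omega⟩, ?_⟩
      simp only [regsOf, List.getD_cons_succ, List.getD_cons_zero]
      refine lt_of_le_of_lt (Nat.mul_le_mul_left _ (Nat.sub_le 1 _)) ?_
      omega
  refine runs_cons (s₁ := ⟨regsOf [n, u, pointer n K X u i, 0, K, 0, i, badCount n K X u K, 0, 0,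
    0], memory n K o (leadersRow n K X u l (i + 1)) (pointers n K X n 0), memorySize n K⟩)
    (runs_cond (fun h => ?_) fun h => ?_) ?_
  · have h' := hev ▸ h
    split_ifs at h' with hc
    · refine runs_of_step fun k => ?_
      have e1 : (Expr.reg 1 + Expr.const 1).eval M
          ⟨regsOf [n, u, pointer n K X u i, 0, K, 0, i, badCount n K X u K, 0, 0, 0],
            memory n K o (leadersRow n K X u l i) (pointers n K X n 0), memorySize n K⟩ =
          u + 1 := by
        rw [Expr.eval_eq_val]
        · rfl
        · simp [Expr.Fits, Expr.val, BinOp.eval, regsOf]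
          omega
      have e2 : pointer n K X u i = n + slotVertex n X u i := if_neg hc.2
      have e3 : (Expr.reg 2).eval M
          ⟨regsOf [n, u, pointer n K X u i, 0, K, 0, i, badCount n K X u K, 0, 0, 0],
            memory n K o (leadersRow n K X u l i) (pointers n K X n 0), memorySize n K⟩ =
          n + slotVertex n X u i := e2
      have e4 : max (memorySize n K) (n + slotVertex n X u i + 1) = memorySize n K :=
        max_eq_left (by have := hM.post.2.2.1; omega)
      change step M ⟨Cmd.store (.reg 2) (.reg 1 + .const 1) :: k, ⟨regsOf [n, u,
        pointer n K X u i, 0, K, 0, i, badCount n K X u K, 0, 0, 0],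
        memory n K o (leadersRow n K X u l i) (pointers n K X n 0), memorySize n K⟩⟩ = _
      rw [step, e1, e3, State.setMem, State.touch, e4, leadersRow, if_pos hc,
        update_memory_leader hw]
    · exact absurd rfl h'
  · have h' := hev ▸ h
    split_ifs at h' with hc
    · omega
    · refine runs_of_step fun k => ?_
      rw [leadersRow, if_neg hc]
      rfl
  · refine runs_assign (x := i + 1) (by simp)
      (by simp [Expr.Fits, Expr.val, BinOp.eval, regsOf]; omega) rfl ?_
    refine runs_assign (x := 0) (by simp) (by simpa [Expr.Fits] using h0) rfl ?_
    exact runs_block_nil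

theorem runs_leaderLoop (hM : LargeWords n K M) {u : ℕ} (hu : u < n) :
    Runs M (forLoop 6 4 leaderBody)
      (postState n K u 0 0 0 0 (badCount n K X u K) o l (pointers n K X n 0))
      (K * (10 + 1) + 1)
      (PMF.pure (postState n K u 0 0 0 K (badCount n K X u K) o (leadersRow n K X u l K)
        (pointers n K X n 0))) :=
  Runs.forLoop hM.basic.1 (fun i => postState n K u 0 0 0 i (badCount n K X u K) o
    (leadersRow n K X u l i) (pointers n K X n 0)) (fun _ => ⟨rfl, rfl⟩)
    fun _ hi => runs_leaderBody hM hu hi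

/-- State of the machine before `leaderRow`. -/
def leaderState (n K : ℕ) (X : ℕ → ℕ → ℕ) (u : ℕ) : State :=
  postState n K u 0 0 0 0 0 (fun v => badCount n K X v K) (leaders n K X u) (pointers n K X n 0)

theorem runs_leaderRow (hM : LargeWords n K M) {u : ℕ} (hu : u < n) :
    Runs M leaderRow (leaderState n K X u) (2 + ((1 + (K * (10 + 1) + 1)) + 7))
      (PMF.pure (leaderState n K X (u + 1))) := by
  obtain ⟨h1, h2, h3, h4, h5, -⟩ := hM.basic
  have h0 : 0 < M := by omega
  refine runs_load (a := u) (x := badCount n K X u K) (by simp) trivial rfl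
    (hu.trans hM.post.2.2.2) (memory_out hu) ?_
  refine runs_cons (runs_leaderLoop hM hu) ?_
  rw [show 7 = 1 + 1 + (1 + 1 + (1 + 1 + 1)) by rfl]
  refine runs_assign (x := u + 1) (by simp)
    (by simp [Expr.Fits, Expr.val, BinOp.eval, regsOf]; omega) rfl ?_
  iterate 2 refine runs_assign (x := 0) (by simp) (by simpa [Expr.Fits] using h0) rfl ?_
  exact runs_block_nil

theorem maxLeader_succ (v i : ℕ) : maxLeader n K X v (i + 1) = max (maxLeader n K X v i)
    (if BadSlot n K X v i then 0 else leaders n K X n (slotVertex n X v i)) := by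
  rw [maxLeader, Finset.range_add_one, Finset.sup_insert, sup_comm]
  rfl

theorem maxLeader_le (v i : ℕ) : maxLeader n K X v i ≤ n := by
  refine Finset.sup_le fun j _ => ?_
  split_ifs
  · exact Nat.zero_le _
  · exact leaders_le n _

theorem runs_labelBody (hM : LargeWords n K M) {u i : ℕ} (hu : u < n) (hi : i < K)
    (ho : o 0 < M) :
    Runs M labelBody
      (postState n K u 0 (maxLeader n K X u i) 0 i (badCount n K X u K) o (leaders n K X n)
        (pointers n K X n 0)) 15
      (PMF.pure (postState n K u 0 (maxLeader n K X u (i + 1)) 0 (i + 1) (badCount n K X u K) o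
        (leaders n K X n) (pointers n K X n 0))) := by
  obtain ⟨h1, h2, h3, h4, h5, -⟩ := hM.basic
  have h0 : 0 < M := by omega
  have hn : 0 < n := by omega
  have hu2 : u < 2 * n := by omega
  have hw := slotVertex_lt (X := X) hn u i
  have hp := pointer_lt (K := K) (X := X) hn u i
  have hL := leaders_le (n := n) (K := K) (X := X) n (slotVertex n X u i)
  have hmax := maxLeader_le (n := n) (K := K) (X := X) u i
  rw [show 15 = 1 + 1 + (1 + 1 + (1 + 1 + (1 + 1 + (1 + 1 + (1 + 1 + (1 + 1 + 1)))))) by rfl]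
  set y := memory n K o (leaders n K X n) (pointers n K X n 0) (pointer n K X u i) with hy
  set x := if BadSlot n K X u i then 0 else leaders n K X n (slotVertex n X u i) with hx
  -- For a bad slot the program reads the unrelated output cell 0, and the factor 0 discards what it
  -- finds.
  have hval : (if 0 < pointer n K X u i then 1 else 0) * y = x ∧ y < M ∧ x ≤ n := by
    by_cases hb : BadSlot n K X u i
    · have e : pointer n K X u i = 0 := if_pos hb
      rw [e, memory_out hn] at hy
      rw [if_pos hb] at hx
      simp [e, hx, hy, ho]
    · have e : pointer n K X u i = n + slotVertex n X u i := if_neg hb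
      rw [e, memory_leader hw] at hy
      rw [if_neg hb] at hx
      rw [e, if_pos (by omega)]
      omega
  refine runs_load (x := pointer n K X u i) (by simp)
    (slotAddr_fits hM rfl rfl rfl hu2 hi trivial rfl) (slotAddr_val rfl rfl rfl rfl)
    (slot_lt hu2 hi) ((memory_slot hu2 hi).trans (pointers_last 0 hu)) ?_
  refine runs_load (a := pointer n K X u i) (x := y) (by simp) trivial rfl
    (hp.trans hM.post.2.2.1) rfl ?_
  refine runs_assign (x := x) (by simp) ?_ hval.1 ?_
  · simp only [Expr.Fits, Expr.val, BinOp.eval, true_and]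
    refine ⟨⟨h0, ?_⟩, lt_of_eq_of_lt hval.1 (by omega)⟩
    exact lt_of_le_of_lt (ite_le_one le_rfl zero_le_one) h1
  refine runs_assign (x := maxLeader n K X u (i + 1)) (by simp)
    (maxExpr_fits (hmax.trans_lt h3) (hval.2.2.trans_lt h3)) ?_ ?_
  · rw [maxExpr_val, maxLeader_succ]
    rfl
  refine runs_assign (x := i + 1) (by simp)
    (by simp [Expr.Fits, Expr.val, BinOp.eval, regsOf]; omega) rfl ?_
  iterate 2 refine runs_assign (x := 0) (by simp) (by simpa [Expr.Fits] using h0) rfl ?_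
  exact runs_block_nil

theorem runs_labelLoop (hM : LargeWords n K M) {u : ℕ} (hu : u < n) (ho : o 0 < M) :
    Runs M (forLoop 6 4 labelBody)
      (postState n K u 0 0 0 0 (badCount n K X u K) o (leaders n K X n) (pointers n K X n 0))
      (K * (15 + 1) + 1)
      (PMF.pure (postState n K u 0 (maxLeader n K X u K) 0 K (badCount n K X u K) o
        (leaders n K X n) (pointers n K X n 0))) :=
  Runs.forLoop hM.basic.1 (fun i => postState n K u 0 (maxLeader n K X u i) 0 i
    (badCount n K X u K) o (leaders n K X n) (pointers n K X n 0)) (fun _ => ⟨rfl, rfl⟩)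
    fun _ hi => runs_labelBody hM hu hi ho

/-- State of the machine before `labelRow`. -/
def labelState (n K : ℕ) (X : ℕ → ℕ → ℕ) (u : ℕ) : State :=
  postState n K u 0 0 0 0 0 (fun v => if v < u then clusterName n K X v else badCount n K X v K)
    (leaders n K X n) (pointers n K X n 0)

theorem clusterName_lt (hM : LargeWords n K M) {v : ℕ} (hv : v < n) : clusterName n K X v < M := by
  have := hM.post.1
  have := maxLeader_le (n := n) (K := K) (X := X) v K
  rw [clusterName]
  split_ifs <;> omega

theorem runs_labelRow (hM : LargeWords n K M) {u : ℕ} (hu : u < n) :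
    Runs M labelRow (labelState n K X u) (2 + ((1 + (K * (15 + 1) + 1)) + 13))
      (PMF.pure (labelState n K X (u + 1))) := by
  obtain ⟨h1, h2, h3, h4, h5, -⟩ := hM.basic
  have h0 : 0 < M := by omega
  have h4n := hM.post.1
  have hmax := maxLeader_le (n := n) (K := K) (X := X) u K
  refine runs_load (a := u) (x := badCount n K X u K) (by simp) trivial rfl
    (hu.trans hM.post.2.2.2) ((memory_out hu).trans (if_neg (lt_irrefl u))) ?_
  refine runs_cons (runs_labelLoop hM hu ?_) ?_
  · have := badCount_le (n := n) (K := K) (X := X) 0 K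
    split_ifs
    · exact clusterName_lt hM (by omega)
    · omega
  rw [show 13 = 1 + 1 + (1 + 1 + (1 + 1 + (1 + 1 + (1 + 1 + (1 + 1 + 1))))) by rfl]
  set e : ℕ := if K / 8 < badCount n K X u K then 1 else 0 with he
  have hval : maxLeader n K X u K * (1 - e) + e * (n + 1 + u) = clusterName n K X u := by
    rw [he, clusterName]
    by_cases hf : FewBad n K X u
    · simp [hf, not_lt.2 hf]
    · simp [hf, not_le.1 hf]
  have hcl := clusterName_lt (X := X) hM hu
  refine runs_assign (x := e) (by simp) (manyExpr_fits hM rfl) (manyExpr_val rfl) ?_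
  refine runs_store (a := u) (x := clusterName n K X u) trivial rfl (hu.trans hM.post.2.2.2)
    ?_ hval ?_
  · simp [Expr.Fits, Expr.val, BinOp.eval, Expr.sub_def, regsOf]
    rw [hval]
    refine ⟨⟨⟨h1, by omega⟩, by omega⟩, ⟨⟨⟨h1, by omega⟩, by omega⟩, by omega⟩, hcl⟩
  rw [update_memory_out hu]
  have ho : Function.update (fun v => if v < u then clusterName n K X v else badCount n K X v K) u
      (clusterName n K X u) =
      fun v => if v < u + 1 then clusterName n K X v else badCount n K X v K := by
    funext v
    by_cases hv : v = u
    · subst hv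
      simp
    · have : v < u ↔ v < u + 1 := by omega
      rw [Function.update_of_ne hv]
      simp only [this]
  rw [ho]
  refine runs_assign (x := u + 1) (by simp)
    (by simp [Expr.Fits, Expr.val, BinOp.eval, regsOf]; omega) rfl ?_
  iterate 3 refine runs_assign (x := 0) (by simp) (by simpa [Expr.Fits] using h0) rfl ?_
  exact runs_block_nil

/-- Running time of the post-processing program. -/
def postSteps (n K : ℕ) : ℕ :=
  1 + (1 + 3 + (1 + (Nat.clog 2 n * (5 + 1) + 1) + 9)) +
    ((1 + (n * (((1 + (K * ((2 + (2 + ((1 + (K * (13 + 1) + 1)) + 15))) + 1) + 1)) + 9) + 1) +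
      1)) + (2 + ((1 + (n * ((2 + ((1 + (K * (10 + 1) + 1)) + 7)) + 1) + 1)) + (2 +
        ((1 + (n * ((2 + ((1 + (K * (15 + 1) + 1)) + 13)) + 1) + 1)) + 1)))))

theorem runs_postProgram {c : ℕ} (hM : LargeWords n K M) (hK : K = c * Nat.clog 2 n) :
    Runs M (postProgram c)
      ⟨regsOf [n, 0, 0, 0, 0, 0, 0, 0, 0, 0, 0], memory n K (fun _ => 0) (fun _ => 0) X,
        memorySize n K⟩ (postSteps n K) (PMF.pure (labelState n K X n)) := by
  have h0 : 0 < M := by have := hM.basic.1; omega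
  refine runs_seq (runs_setup hM hK 0 0 0 _ le_rfl) ?_
  have hstart : (⟨regsOf [n, 0, 0, 0, K, 0, 0, 0, 0, 0, 0],
      memory n K (fun _ => 0) (fun _ => 0) X, memorySize n K⟩ : State) =
      pointerState n K X 0 := by
    rw [pointerState, postState]
    congr 1
    refine memory_congr (fun v _ => ?_) (fun _ _ => rfl) fun r _ j _ => ?_
    · simp
    · simp [pointers]
  rw [hstart]
  refine runs_cons (Runs.forLoop hM.basic.1 (pointerState n K X) (fun _ => ⟨rfl, rfl⟩)
    fun u hu => runs_pointerRow hM hu) ?_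
  refine runs_assign (x := 0) (by simp) (by simpa [Expr.Fits] using h0) rfl ?_
  have hleader : memory n K (fun v => if v < n then badCount n K X v K else 0) (fun _ => 0)
      (pointers n K X n 0) = memory n K (fun v => badCount n K X v K) (leaders n K X 0)
        (pointers n K X n 0) :=
    memory_congr (fun v hv => if_pos hv) (fun _ _ => rfl) fun _ _ _ _ => rfl
  rw [hleader]
  refine runs_cons (Runs.forLoop hM.basic.1 (leaderState n K X) (fun _ => ⟨rfl, rfl⟩)
    fun u hu => runs_leaderRow hM hu) ?_
  refine runs_assign (x := 0) (by simp) (by simpa [Expr.Fits] using h0) rfl ?_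
  have hlabel : memory n K (fun v => badCount n K X v K) (leaders n K X n)
      (pointers n K X n 0) = memory n K
        (fun v => if v < 0 then clusterName n K X v else badCount n K X v K) (leaders n K X n)
        (pointers n K X n 0) :=
    memory_congr (fun v hv => (if_neg (Nat.not_lt_zero v)).symm) (fun _ _ => rfl)
      fun _ _ _ _ => rfl
  rw [hlabel]
  refine runs_cons (Runs.forLoop hM.basic.1 (labelState n K X) (fun _ => ⟨rfl, rfl⟩)
    fun u hu => runs_labelRow hM hu) ?_
  exact runs_block_nil

end

/-! ### Assembly: correctness of the output, resource bounds and success probability. -/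

/-! ## Correctness of the clustering -/

section
variable {n K : ℕ} {X : ℕ → ℕ → ℕ}

/-- All writes made for one vertex store the same value, so their order is irrelevant. -/
theorem leadersRow_eq (u : ℕ) (l : ℕ → ℕ) (i x : ℕ) : leadersRow n K X u l i x =
    if FewBad n K X u ∧ ∃ j < i, ¬ BadSlot n K X u j ∧ slotVertex n X u j = x then u + 1
    else l x := by
  induction i with
  | zero => simp [leadersRow]
  | succ i ih =>
    rw [leadersRow]
    by_cases hc : FewBad n K X u ∧ ¬ BadSlot n K X u i
    · rw [if_pos hc]
      by_cases hx : x = slotVertex n X u i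
      · rw [hx, Function.update_self, if_pos ⟨hc.1, i, Nat.lt_succ_self i, hc.2, rfl⟩]
      · rw [Function.update_of_ne hx, ih]
        refine if_congr (and_congr_right fun _ => ⟨?_, ?_⟩) rfl rfl
        · rintro ⟨j, hj, h⟩
          exact ⟨j, by omega, h⟩
        · rintro ⟨j, hj, h1, h2⟩
          exact ⟨j, lt_of_le_of_ne (Nat.lt_succ_iff.1 hj) fun h => hx (by rw [← h2, h]), h1, h2⟩
    · rw [if_neg hc, ih]
      refine if_congr (and_congr_right fun hf => ⟨?_, ?_⟩) rfl rfl
      · rintro ⟨j, hj, h⟩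
        exact ⟨j, by omega, h⟩
      · rintro ⟨j, hj, h1, h2⟩
        exact ⟨j, lt_of_le_of_ne (Nat.lt_succ_iff.1 hj) fun h => hc ⟨hf, h ▸ h1⟩, h1, h2⟩

/-- Vertices are processed in increasing order, so overwriting a leader only increases it. -/
theorem le_leaders {u v j : ℕ} (hv : v < u) (hj : j < K) (hf : FewBad n K X v)
    (hb : ¬ BadSlot n K X v j) : v + 1 ≤ leaders n K X u (slotVertex n X v j) := by
  induction u with
  | zero => omega
  | succ u ih =>
    rw [leaders, leadersRow_eq]
    split_ifs with h
    · exact hv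
    · refine ih (lt_of_le_of_ne (Nat.lt_succ_iff.1 hv) ?_)
      rintro rfl
      exact h ⟨hf, j, hj, hb, rfl⟩

theorem exists_of_leaders_ne_zero {u x : ℕ} (h : leaders n K X u x ≠ 0) :
    ∃ v < u, ∃ j < K, FewBad n K X v ∧ ¬ BadSlot n K X v j ∧ slotVertex n X v j = x ∧
      leaders n K X u x = v + 1 := by
  induction u with
  | zero => exact absurd rfl h
  | succ u ih =>
    rw [leaders, leadersRow_eq] at h ⊢
    split_ifs at h ⊢ with hc
    · obtain ⟨hf, j, hj, hb, hx⟩ := hc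
      exact ⟨u, Nat.lt_succ_self u, j, hj, hf, hb, hx, rfl⟩
    · obtain ⟨v, hv, r⟩ := ih h
      exact ⟨v, hv.trans (Nat.lt_succ_self u), r⟩

theorem count_eq_card_fin (p : ℕ → Prop) [DecidablePred p] (q : Fin K → Prop) {_ : DecidablePred q}
    (h : ∀ i : Fin K, p i ↔ q i) : Nat.count p K = (Finset.univ.filter q).card := by
  rw [Nat.count_eq_card_filter_range, ← Finset.card_map Fin.valEmbedding]
  congr 1
  ext i
  simp only [Finset.mem_filter, Finset.mem_range, Finset.mem_map, Finset.mem_univ, true_and,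
    Fin.valEmbedding_apply]
  constructor
  · rintro ⟨hi, hp⟩
    exact ⟨⟨i, hi⟩, (h _).1 hp, rfl⟩
  · rintro ⟨i, hq, rfl⟩
    exact ⟨i.2, (h i).2 hq⟩

end

section
open Classical
variable {n : ℕ} {G : LabeledGraph (Fin n)} {σ : List (Item n)}

theorem IsStream.fst_ne_snd (hσ : IsStream G σ) {z : Item n} (hz : z ∈ σ) : z.fst ≠ z.snd :=
  (hσ.complete z.edge).1 (List.mem_map_of_mem hz)

theorem IsStream.exists_item (hσ : IsStream G σ) {x y : Fin n} (h : x ≠ y) :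
    ∃ z ∈ σ, (z.fst = x ∧ z.snd = y) ∨ (z.fst = y ∧ z.snd = x) := by
  obtain ⟨z, hz, he⟩ := List.mem_map.1 ((hσ.complete s(x, y)).2 h)
  exact ⟨z, hz, Sym2.eq_iff.1 he⟩

theorem IsStream.linked_iff (hσ : IsStream G σ) {x y : Fin n} :
    Linked σ x y ↔ G.pos.Adj x y := by
  constructor
  · rintro ⟨z, hz, hp, ⟨rfl, rfl⟩ | ⟨rfl, rfl⟩⟩
    · exact (hσ.label z hz).1 hp
    · exact ((hσ.label z hz).1 hp).symm
  · intro h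
    obtain ⟨z, hz, he⟩ := hσ.exists_item h.ne
    refine ⟨z, hz, (hσ.label z hz).2 ?_, he⟩
    rcases he with ⟨rfl, rfl⟩ | ⟨rfl, rfl⟩
    · exact h
    · exact h.symm

theorem IsStream.seen (hσ : IsStream G σ) (hn : 2 ≤ n) (x : Fin n) : Seen σ x := by
  have : Nontrivial (Fin n) := Fin.nontrivial_iff_two_le.2 hn
  obtain ⟨y, hy⟩ := exists_ne x
  obtain ⟨z, hz, h | h⟩ := hσ.exists_item hy.symm
  · exact ⟨z, hz, Or.inl h.1⟩
  · exact ⟨z, hz, Or.inr h.2⟩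

theorem IsStream.ne_nil (hσ : IsStream G σ) (hn : 2 ≤ n) : σ ≠ [] := by
  rintro rfl
  obtain ⟨z, hz, -⟩ := hσ.seen hn ⟨0, by omega⟩
  exact absurd hz List.not_mem_nil

/-- For `n ≥ 2` every vertex has an incident edge in the stream, so its own key has been merged even
if all its edges are negative. -/
theorem IsStream.seenNbhd_eq (hσ : IsStream G σ) (hn : 2 ≤ n) (x : Fin n) :
    seenNbhd σ x = G.nbhd x := by
  ext y
  rw [mem_seenNbhd, LabeledGraph.mem_nbhd, hσ.linked_iff, and_iff_left (hσ.seen hn x)]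

variable {K : ℕ} {ω : Draws n K}

theorem IsStream.fullTable_cell (hσ : IsStream G σ) (hn : 2 ≤ n) (v : Fin n) (i : Fin K) :
    fullTable ω σ (n + v) i = G.maxKey (ω i) v := by
  rw [fullTable, dif_pos i.2, column_cell, hσ.seenNbhd_eq hn, LabeledGraph.maxKey]

theorem IsStream.slotVertex_eq (hσ : IsStream G σ) (hn : 2 ≤ n) (v : Fin n) (i : Fin K) :
    slotVertex n (fullTable ω σ) v i = G.sketch ω v i := by
  rw [slotVertex, hσ.fullTable_cell hn]
  rfl

/-- The machine compares keys instead of vertices, which is equivalent because keys are injective.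
-/
theorem IsStream.slotDiff_eq (hσ : IsStream G σ) (hn : 2 ≤ n) (u v : Fin n) :
    slotDiff n (fullTable ω σ) u v K = far (G.sketch ω) u v := by
  refine count_eq_card_fin _ _ fun i => not_congr ?_
  rw [hσ.fullTable_cell hn, hσ.fullTable_cell hn]
  exact (G.argmaxKey_eq_iff (ω i) u v).symm

theorem IsStream.badSlot_iff (hσ : IsStream G σ) (hn : 2 ≤ n) (v : Fin n) (i : Fin K) :
    BadSlot n K (fullTable ω σ) v i ↔ ¬ IsGoodSlot (G.sketch ω) v i := by
  rw [BadSlot, IsGoodSlot, hσ.slotVertex_eq hn, hσ.slotDiff_eq hn]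
  omega

theorem IsStream.fewBad_iff (hσ : IsStream G σ) (hn : 2 ≤ n) (v : Fin n) :
    FewBad n K (fullTable ω σ) v ↔ IsDense (G.sketch ω) v := by
  rw [FewBad, IsDense, badCount, count_eq_card_fin _ _ (hσ.badSlot_iff hn v)]
  omega

theorem IsStream.isSketchClustering (hσ : IsStream G σ) (hn : 2 ≤ n) (hK : 0 < K) :
    IsSketchClustering (G.sketch ω) fun v : Fin n => clusterName n K (fullTable ω σ) v := by
  have hv := hσ.slotVertex_eq (ω := ω) hn
  have hb := hσ.badSlot_iff (ω := ω) hn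
  have hf := hσ.fewBad_iff (ω := ω) hn
  refine isSketchClustering_of_leaders hK
    (fun x => leaders n K (fullTable ω σ) n x) ?_ ?_ ?_ ?_
  · intro v i hd hg
    have := le_leaders v.2 i.2 ((hf v).2 hd) fun h => (hb v i).1 h hg
    rwa [hv] at this
  · intro x hx
    obtain ⟨v, hvn, j, hj, h1, h2, h3, h4⟩ := exists_of_leaders_ne_zero hx
    refine ⟨⟨v, hvn⟩, ⟨j, hj⟩, (hf ⟨v, hvn⟩).1 h1,
      not_not.1 fun h => h2 ((hb ⟨v, hvn⟩ ⟨j, hj⟩).2 h), Fin.ext ?_, h4⟩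
    rw [← hv, ← h3]
  · intro u hu
    rw [clusterName, if_pos ((hf u).2 hu), maxLeader]
    apply le_antisymm
    · refine Finset.sup_le fun j hj => ?_
      have hj := Finset.mem_range.1 hj
      split_ifs with h
      · exact Nat.zero_le _
      · have hg : IsGoodSlot (G.sketch ω) u ⟨j, hj⟩ :=
          not_not.1 fun h' => h ((hb u ⟨j, hj⟩).2 h')
        have := hv u ⟨j, hj⟩
        simp only at this
        rw [this]
        exact Finset.le_sup (f := fun i => leaders n K (fullTable ω σ) n (G.sketch ω u i))
          (Finset.mem_filter.2 ⟨Finset.mem_univ _, hg⟩)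
    · refine Finset.sup_le fun i hi => ?_
      have h : ¬ BadSlot n K (fullTable ω σ) u i :=
        fun h => (hb u i).1 h (Finset.mem_filter.1 hi).2
      refine le_trans (le_of_eq ?_) (Finset.le_sup (Finset.mem_range.2 i.2))
      rw [if_neg h, hv]
  · intro u hu
    rw [clusterName, if_neg fun h => hu ((hf u).1 h)]

/-! ## Running the algorithm -/

/-- All randomness is now a single uniform table, and the rest of the argument is counting. -/
theorem IsStream.run_eq {B : Budget} {c : ℕ} (hσ : IsStream G σ)
    (hM : LargeWords n K (2 ^ B.wordBits)) (hK : K = c * Nat.clog 2 n)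
    (hT : updateSteps n K ≤ B.updateTime) (hP : postSteps n K ≤ B.postTime)
    (hS : memorySize n K ≤ B.space) :
    haveI : NeZero n := ⟨by have := hM.two_le; omega⟩
    StreamAlg.run ⟨updateProgram c, postProgram c⟩ B σ =
      (PMF.uniformOfFintype (Draws n K)).map fun ω =>
        some fun v : Fin n => clusterName n K (fullTable ω σ) v := by
  have hn := hM.two_le
  have : NeZero n := ⟨by omega⟩
  rw [StreamAlg.run, pass_eq hM hK hT hS (fun z hz => hσ.fst_ne_snd hz) (hσ.ne_nil hn),
    PMF.bind_map]
  congr 1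
  funext ω
  simp only [Function.comp_apply]
  rw [tableState, exec_of_runs (runs_postProgram hM hK) hP hS, PMF.pure_map, Option.map_some]
  congr 2
  funext v
  simp only [State.output, labelState, postState, memory_out v.2, v.2, if_true]

end

/-! ## Resources -/

theorem le_two_pow_clog (n : ℕ) : n ≤ 2 ^ Nat.clog 2 n := Nat.le_pow_clog one_lt_two n

/-- The constant in the resource bounds for `c ⌈log₂ n⌉` slots. -/
def resourceConst (c : ℕ) : ℕ := 400 * (c + 1) ^ 2

section
variable {n c : ℕ}

theorem memorySize_le (hn : 2 ≤ n) :
    memorySize n (c * Nat.clog 2 n) ≤ 4 * (c + 1) * (n * Nat.clog 2 n) := by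
  have hL : 1 ≤ Nat.clog 2 n := Nat.clog_pos one_lt_two hn
  have : n ≤ n * Nat.clog 2 n := Nat.le_mul_of_pos_right _ hL
  rw [memorySize]
  nlinarith

/-- With Q = 2^L, which bounds both `n` and L = `Nat.clog 2 n`, words reach at least Q^(c+6): the
power Q^(c+1) pays for the constants, including `c + 1`, and Q^5 for the polynomial in `n` and L. -/
theorem largeWords_semiStreamingBudget (hn : 2 ≤ n) (hc : 0 < c) :
    LargeWords n (c * Nat.clog 2 n)
      (2 ^ (semiStreamingBudget (resourceConst c) n).wordBits) := by
  have hL : 1 ≤ Nat.clog 2 n := Nat.clog_pos one_lt_two hn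
  set L := Nat.clog 2 n with hLdef
  have h1 : n ≤ 2 ^ L := le_two_pow_clog n
  have h2 : 2 ≤ 2 ^ L := hn.trans h1
  have h3 : L ≤ 2 ^ L := Nat.lt_two_pow_self.le
  have h4 : c + 1 ≤ 2 ^ (c + 1) := Nat.lt_two_pow_self.le
  have h5 : 2 ^ (c + 1) ≤ (2 ^ L) ^ (c + 1) := Nat.pow_le_pow_left h2 _
  have hw : (semiStreamingBudget (resourceConst c) n).wordBits = L * resourceConst c :=
    mul_comm _ _
  have h6 : (2 ^ L) ^ (c + 6) ≤ (2 ^ L) ^ resourceConst c := by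
    refine Nat.pow_le_pow_right (by omega) ?_
    rw [resourceConst]
    nlinarith
  have hM : (2 ^ L) ^ (c + 6) ≤ 2 ^ (semiStreamingBudget (resourceConst c) n).wordBits := by
    rwa [hw, pow_mul]
  have h7 : (2 ^ L) ^ (c + 6) = (2 ^ L) ^ (c + 1) * (2 ^ L) ^ 5 := by ring
  generalize 2 ^ L = Q at *
  have hQ5 : Q ^ 5 = Q * (Q * (Q * (Q * Q))) := by ring
  refine ⟨hn, Nat.mul_pos hc hL, lt_of_lt_of_le ?_ hM, lt_of_lt_of_le ?_ hM⟩
  · refine lt_of_le_of_lt (memorySize_le hn) ?_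
    have ha : c + 1 ≤ Q ^ (c + 1) := h4.trans h5
    have hb : 4 * (n * L) < Q ^ 5 := by
      have e1 : n * L ≤ Q * Q := Nat.mul_le_mul h1 h3
      have e2 : 2 * (2 * (2 * (Q * Q))) ≤ Q * (Q * (Q * (Q * Q))) :=
        Nat.mul_le_mul h2 (Nat.mul_le_mul h2 (Nat.mul_le_mul h2 le_rfl))
      have e3 : 0 < Q * Q := Nat.mul_pos (by omega) (by omega)
      omega
    calc 4 * (c + 1) * (n * L) = (c + 1) * (4 * (n * L)) := by ring
      _ < (c + 1) * Q ^ 5 := Nat.mul_lt_mul_of_pos_left hb (Nat.succ_pos c)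
      _ ≤ Q ^ (c + 1) * Q ^ 5 := Nat.mul_le_mul_right _ ha
      _ = Q ^ (c + 6) := h7.symm
  · have ha : 2 ≤ Q ^ (c + 1) := le_trans (by omega) (h4.trans h5)
    have hb : n * n * n + n < Q ^ 5 := by
      have e1 : n * n * n ≤ Q * Q * Q := Nat.mul_le_mul (Nat.mul_le_mul h1 h1) h1
      have e2 : 2 * (2 * (Q * Q * Q)) ≤ Q * (Q * (Q * Q * Q)) :=
        Nat.mul_le_mul h2 (Nat.mul_le_mul h2 le_rfl)
      have e3 : 2 * 2 * Q ≤ Q * Q * Q := Nat.mul_le_mul (Nat.mul_le_mul h2 h2) le_rfl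
      have e4 : Q ^ 5 = Q * (Q * (Q * Q * Q)) := by ring
      omega
    calc 2 * (n * n * n + n) < 2 * Q ^ 5 := by omega
      _ ≤ Q ^ (c + 1) * Q ^ 5 := Nat.mul_le_mul_right _ ha
      _ = Q ^ (c + 6) := h7.symm

theorem memorySize_le_space (hn : 2 ≤ n) :
    memorySize n (c * Nat.clog 2 n) ≤ (semiStreamingBudget (resourceConst c) n).space := by
  refine (memorySize_le hn).trans (Nat.mul_le_mul_right _ ?_)
  rw [resourceConst]
  nlinarith

theorem updateSteps_le_updateTime (hn : 2 ≤ n) :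
    updateSteps n (c * Nat.clog 2 n) ≤
      (semiStreamingBudget (resourceConst c) n).updateTime := by
  have hL : 1 ≤ Nat.clog 2 n := Nat.clog_pos one_lt_two hn
  have : 100 * (c + 1) ≤ resourceConst c := by
    rw [resourceConst]
    nlinarith
  refine le_trans ?_ (Nat.mul_le_mul_right _ this)
  rw [updateSteps]
  nlinarith

/-- The leading term is 14 n K² from the sketch comparisons, that is, 14 c² n L²; all other terms
are also bounded by multiples of n L². -/
theorem postSteps_le_postTime (hn : 2 ≤ n) :
    postSteps n (c * Nat.clog 2 n) ≤ (semiStreamingBudget (resourceConst c) n).postTime := by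
  have hL : 1 ≤ Nat.clog 2 n := Nat.clog_pos one_lt_two hn
  simp only [postSteps, semiStreamingBudget, resourceConst]
  set L := Nat.clog 2 n
  set K := c * L with hK
  have h1 : L ≤ n * L ^ 2 := by nlinarith [Nat.le_mul_of_pos_left (L ^ 2) (by omega : 0 < n)]
  have h2 : 1 ≤ L := hL
  have h3 : n ≤ n * L ^ 2 := Nat.le_mul_of_pos_right _ (by positivity)
  have h4 : n * K ≤ c * (n * L ^ 2) := by
    rw [hK]
    nlinarith [Nat.zero_le (c * n), Nat.mul_le_mul_left (c * n * L) hL]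
  have h5 : n * (K * K) = c ^ 2 * (n * L ^ 2) := by rw [hK]; ring
  generalize n * L ^ 2 = Y at *
  have h6 : n * K * K = c ^ 2 * Y := by rw [← h5]; ring
  nlinarith [Nat.zero_le (c * Y), Nat.zero_le (c ^ 2 * Y)]

end

/-! ## Probability of success -/

theorem le_toOuterMeasure_map_uniform {Ω β : Type*} [Fintype Ω] [Nonempty Ω] (g : Ω → β)
    {P : Ω → Prop} [DecidablePred P] {S : Set β} (hS : ∀ ω, P ω → g ω ∈ S) {ε : ℝ} (hε : 0 ≤ ε)
    (h : ((Finset.univ.filter fun ω => ¬ P ω).card : ℝ) ≤ ε * Fintype.card Ω) :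
    1 - ENNReal.ofReal ε ≤ ((PMF.uniformOfFintype Ω).map g).toOuterMeasure S := by
  classical
  have hpos : (0 : ℝ) < Fintype.card Ω := by exact_mod_cast Fintype.card_pos
  have hsum := Finset.card_filter_add_card_filter_not (s := Finset.univ) P
  rw [Finset.card_univ] at hsum
  rw [PMF.toOuterMeasure_map_apply, PMF.toOuterMeasure_uniformOfFintype_apply]
  have hle : (Finset.univ.filter P).card ≤ Fintype.card (g ⁻¹' S) := by
    rw [← Set.toFinset_card]
    refine Finset.card_le_card fun ω hω => ?_
    rw [Set.mem_toFinset]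
    exact hS ω (Finset.mem_filter.1 hω).2
  have hreal : 1 - ε ≤ (Fintype.card (g ⁻¹' S) : ℝ) / Fintype.card Ω := by
    rw [le_div_iff₀ hpos]
    have h1 : ((Finset.univ.filter P).card : ℝ) + (Finset.univ.filter fun ω => ¬ P ω).card =
        Fintype.card Ω := by exact_mod_cast hsum
    have h2 : ((Finset.univ.filter P).card : ℝ) ≤ Fintype.card (g ⁻¹' S) := by
      exact_mod_cast hle
    linarith
  rw [← ENNReal.ofReal_one, ← ENNReal.ofReal_sub _ hε]
  refine (ENNReal.ofReal_le_ofReal hreal).trans (le_of_eq ?_)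
  rw [ENNReal.ofReal_div_of_pos hpos, ENNReal.ofReal_natCast, ENNReal.ofReal_natCast]

end CorrClust

open CorrClust

theorem mainTheorem2 :
    ∃ α : ℕ, ∀ k : ℕ, ∃ (A : StreamAlg) (C : ℕ), ∀ n : ℕ, 2 ≤ n →
      ∀ (G : LabeledGraph (Fin n)) (σ : List (Item n)), IsStream G σ →
        none ∉ (A.run (semiStreamingBudget C n) σ).support ∧
        1 - ((n : ENNReal) ^ k)⁻¹ ≤
          (A.run (semiStreamingBudget C n) σ).toOuterMeasure
            {o | ∃ c : Clustering (Fin n), o = some c ∧ G.IsApprox α c} := by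
  classical
  -- The factor `1024 * (k + 4)` makes the number of slots equal to `numSlots k n`; only this factor
  -- depends on `k`, not the approximation ratio.
  refine ⟨4282, fun k => ⟨⟨updateProgram (1024 * (k + 4)), postProgram (1024 * (k + 4))⟩,
    resourceConst (1024 * (k + 4)), fun n hn G σ hσ => ?_⟩⟩
  have : NeZero n := ⟨by omega⟩
  have hM := largeWords_semiStreamingBudget hn (c := 1024 * (k + 4)) (by omega)
  rw [hσ.run_eq hM rfl (updateSteps_le_updateTime hn) (postSteps_le_postTime hn)
    (memorySize_le_space hn)]
  constructor
  -- The output law is a pushforward under a map into `some`, so the budget is never exceeded.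
  · simp
  · have hε : ((n : ENNReal) ^ k)⁻¹ = ENNReal.ofReal (((n : ℝ) ^ k)⁻¹) := by
      rw [ENNReal.ofReal_inv_of_pos (by positivity), ENNReal.ofReal_pow (by positivity),
        ENNReal.ofReal_natCast]
    rw [hε]
    refine le_toOuterMeasure_map_uniform (P := fun ω => IsFaithful G (G.sketch ω)) _ ?_
      (by positivity) ?_
    · intro ω hω
      exact ⟨_, rfl, fun c' =>
        IsSketchClustering.cost_le hω (hσ.isSketchClustering hn hM.pos) hM.pos c'⟩
    · have := card_not_isFaithful_numSlots_le G k hn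
      rw [numSlots] at this
      convert this
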